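/- Theorem 4.4. Setting. Let $d,d_x\ge 0$ and $N\ge 1$ be integers, let $\Phi:\mathbb R^d\times\mathbb R^{d_x}\to\mathbb R$, $(\theta,x)\mapsto\Phi(\theta;x)$, be a model and $(x_n,y_n)_{n=1}^N$ with $x_n\in\mathbb R^{d_x}$, $y_n\in\{\pm1\}$ a data set. Put $q_n(\theta)=y_n\Phi(\theta;x_n)$ and let $\mathcal L(\theta)=\sum_{n=1}^N e^{-q_n(\theta)}$ be the training loss (exponential loss). Assume that there is $L>0$ with $\Phi(\alpha\theta;x)=\alpha^L\Phi(\theta;x)$ for all $\alpha>0$, $\theta$, $x$. Definitions. All norms are Euclidean. The Clarke subdifferential of $f:\mathbb R^d\to\mathbb R$ at $\theta$ is $$\partial^\circ f(\theta)=\mathrm{conv}\{\lim_k\nabla f(\theta_k):\theta_k\to\theta,\ f\text{ differentiable at every }\theta_k\}.$$ An arc is a map $z:[0,\infty)\to\mathbb R^d$ that is absolutely continuous on every compact subinterval. A locally Lipschitz function $f$ admits a chain rule if for every arc $z$, for almost every $t>0$, $(f\circ z)'(t)=\langle h,z'(t)\rangle$ for all $h\in\partial^\circ f(z(t))$. A KKT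 point of the problem $$(P)\qquad \min\ \tfrac12\|\theta\|^2\quad\text{subject to}\quad q_n(\theta)\ge 1\ \text{ for all } n\in\{1,\dots,N\}$$ is a point $\theta$ with $q_n(\theta)\ge1$ for all $n$ for which there are $\lambda_1,\dots,\lambda_N\ge0$ such that $0\in\partial^\circ\big(\tfrac12\|\cdot\|^2\big)(\theta)+\sum_n\lambda_n\,\partial^\circ(1-q_n)(\theta)$ and $\lambda_n(1-q_n(\theta))=0$ for all $n$. A limit point of a trajectory $u(t)$ is a point $\bar u$ such that $u(t_m)\to\bar u$ for some times $t_m\to\infty$. (i) Gradient flow. Assume that for every $x$ the function $\Phi(\cdot;x)$ is locally Lipschitz and admits a chain rule. Let $\theta:[0,\infty)\to\mathbb R^d$ be an arc with $\theta'(t)\in-\partial^\circ\mathcal L(\theta(t))$ for almost every $t\ge0$, and assume $\mathcal L(\theta(t_0))<1$ for some $t_0\ge0$. Then for every limit point $\bar\theta$ of $\theta(t)/\|\theta(t)\|$ there is $\alpha>0$ such that $\alpha\bar\theta$ is a KKT point of $(P)$. (ii) Gradient descent. Assume that for every $x$ the function $\Phi(\cdot;x)$ is $C^2$ on $\mathbb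 R^d\setminus\{0\}$. Let $\theta(t+1)=\theta(t)-\eta(t)\nabla\mathcal L(\theta(t))$ for $t=0,1,2,\dots$ with learning rates $\eta(t)\ge0$, and assume that for some $t_0\in\mathbb N$ we have $\mathcal L(\theta(t_0))<1$, and that $$\sum_{t\ge0}\eta(t)=+\infty,\qquad \eta(t)\le H(\mathcal L(\theta(t)))\ \text{ for all } t\ge t_0,\qquad H(u)=\frac{\mu(u)}{C_\eta\,\kappa(u)}.$$ Here, with $\ell_0=\mathcal L(\theta(t_0))$ and $\rho_0=\|\theta(t_0)\|$, $$\mu(u)=\frac{\log\frac1{\ell_0}}{2\log\frac1u},\qquad \kappa(u)=\begin{cases}u\,(\log\frac1u)^{2-2/L}&\text{if } L\le1\text{ or }u\le e^{2/L-2},\\ e^{(2-2/L)(\log(2-2/L)-1)}&\text{otherwise,}\end{cases}$$ $$C_\eta=\tfrac12\big(B_1^2+\rho_0^{-L}B_2\big)\max\{\hat\gamma_0^{-2+2/L},B_0^{-2+2/L}\},\qquad \hat\gamma_0=e^{\phi(\ell_0)}\rho_0^{-L},$$ where $B_0$, $B_1$, $B_2$ are the suprema over $n$ and over $\|\theta\|=1$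 of $q_n(\theta)$, of $\|\nabla q_n(\theta)\|$ and of the operator norm $\|\nabla^2q_n(\theta)\|$, respectively, and, for $u\in(0,\ell_0]$, $$\phi(u)=\log\log\tfrac1u+\int_0^u\Big(\psi(w)+\frac1{w\log\frac1w}\Big)dw,\qquad \psi(u)=-\sup_{w\in[u,\ell_0]}\frac{1+2\big(1+\frac{1}{L\log(1/w)}\big)\mu(w)}{w\log\frac1w}.$$ Then for every limit point $\bar\theta$ of $\theta(t)/\|\theta(t)\|$ there is $\alpha>0$ such that $\alpha\bar\theta$ is a KKT point of $(P)$. -/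

import Mathlib

open Set Filter Topology MeasureTheory

noncomputable section

/-! ### Non-smooth analysis -/

/-- The Clarke subdifferential of `f` at `x`: the convex hull of all limits of gradients of `f`
along sequences of points of differentiability converging to `x`. -/
def clarkeSubdifferential {d : ℕ} (f : EuclideanSpace ℝ (Fin d) → ℝ)
    (x : EuclideanSpace ℝ (Fin d)) : Set (EuclideanSpace ℝ (Fin d)) :=
  convexHull ℝ {g | ∃ u : ℕ → EuclideanSpace ℝ (Fin d), Tendsto u atTop (𝓝 x) ∧
    (∀ k, DifferentiableAt ℝ f (u k)) ∧ Tendsto (fun k => gradient f (u k)) atTop (𝓝 g)}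

/-- An arc `[0, ∞) → ℝᵈ`: absolutely continuous on every compact subinterval of `[0, ∞)`.
(Values at negative times are irrelevant.) -/
def IsArc {d : ℕ} (z : ℝ → EuclideanSpace ℝ (Fin d)) : Prop :=
  ∀ a b : ℝ, 0 ≤ a → a ≤ b → AbsolutelyContinuousOnInterval z a b

/-- `f` admits a chain rule: along every arc `z : [0, ∞) → ℝᵈ`, for almost every `t > 0`, the
equality `(f ∘ z)'(t) = ⟪h, z'(t)⟫` holds for all `h` in the Clarke subdifferential of `f` at
`z t`. -/
def AdmitsChainRule {d : ℕ} (f : EuclideanSpace ℝ (Fin d) → ℝ) : Prop :=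
  ∀ z : ℝ → EuclideanSpace ℝ (Fin d), IsArc z →
    ∀ᵐ t ∂(volume.restrict (Ioi (0 : ℝ))), ∃ v, HasDerivAt z v t ∧
      ∀ h ∈ clarkeSubdifferential f (z t), HasDerivAt (fun s => f (z s)) (inner ℝ h v) t

/-- KKT points (in the Clarke sense) of the problem `min f(x)` subject to `g n x ≤ 0` for all
`n`: feasibility, multipliers `lam n ≥ 0` with
`0 ∈ ∂f(x) + ∑ n, lam n • ∂(g n)(x)`, and complementary slackness. -/
def IsKKTPoint {d N : ℕ} (f : EuclideanSpace ℝ (Fin d) → ℝ)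
    (g : Fin N → EuclideanSpace ℝ (Fin d) → ℝ) (x : EuclideanSpace ℝ (Fin d)) : Prop :=
  (∀ n, g n x ≤ 0) ∧
  ∃ lam : Fin N → ℝ, (∀ n, 0 ≤ lam n) ∧
    (∃ k ∈ clarkeSubdifferential f x, ∃ h : Fin N → EuclideanSpace ℝ (Fin d),
      (∀ n, h n ∈ clarkeSubdifferential (g n) x) ∧ k + ∑ n, lam n • h n = 0) ∧
    ∀ n, lam n * g n x = 0

/-! ### The training problem -/

/-- The margin `q_n(θ) = y_n Φ(θ; x_n)` of the `n`-th data point. -/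
def margin {d dx N : ℕ} (Φ : EuclideanSpace ℝ (Fin d) → EuclideanSpace ℝ (Fin dx) → ℝ)
    (x : Fin N → EuclideanSpace ℝ (Fin dx)) (y : Fin N → ℝ) (n : Fin N)
    (θ : EuclideanSpace ℝ (Fin d)) : ℝ :=
  y n * Φ θ (x n)

/-- The exponential loss `ℓ(q) = e^{-q}`. -/
def expLoss (q : ℝ) : ℝ := Real.exp (-q)

/-- The training loss `∑ n, ℓ(y_n Φ(θ; x_n))` for the exponential loss `ℓ`. -/
def trainLoss {d dx N : ℕ} (Φ : EuclideanSpace ℝ (Fin d) → EuclideanSpace ℝ (Fin dx) → ℝ)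
    (x : Fin N → EuclideanSpace ℝ (Fin dx)) (y : Fin N → ℝ)
    (θ : EuclideanSpace ℝ (Fin d)) : ℝ :=
  ∑ n, expLoss (margin Φ x y n θ)

/-- `L`-homogeneity of the model in its parameters, with the same degree for all inputs. -/
def IsHomogeneousModel {d dx : ℕ} (L : ℝ)
    (Φ : EuclideanSpace ℝ (Fin d) → EuclideanSpace ℝ (Fin dx) → ℝ) : Prop :=
  ∀ (x : EuclideanSpace ℝ (Fin dx)) (θ : EuclideanSpace ℝ (Fin d)) (α : ℝ), 0 < α →
    Φ (α • θ) x = α ^ L * Φ θ x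

/-- `θ` is a gradient flow of `F`: an arc with `θ'(t) ∈ -∂F(θ(t))` for almost every `t ≥ 0`. -/
def IsGradientFlow {d : ℕ} (F : EuclideanSpace ℝ (Fin d) → ℝ)
    (θ : ℝ → EuclideanSpace ℝ (Fin d)) : Prop :=
  IsArc θ ∧ ∀ᵐ t ∂(volume.restrict (Ici (0 : ℝ))),
    ∃ v, HasDerivAt θ v t ∧ -v ∈ clarkeSubdifferential F (θ t)

/-- `θ` is produced by gradient descent on `F` with learning rates `η`. -/
def IsGradientDescent {d : ℕ} (F : EuclideanSpace ℝ (Fin d) → ℝ) (η : ℕ → ℝ)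
    (θ : ℕ → EuclideanSpace ℝ (Fin d)) : Prop :=
  ∀ t, θ (t + 1) = θ t - η t • gradient F (θ t)

/-- `α • θ` is, for some `α > 0`, a KKT point of the margin problem
`min ½‖θ‖²` subject to `q_n(θ) ≥ 1` for all `n`. -/
def IsAlongKKTDirection {d dx N : ℕ}
    (Φ : EuclideanSpace ℝ (Fin d) → EuclideanSpace ℝ (Fin dx) → ℝ)
    (x : Fin N → EuclideanSpace ℝ (Fin dx)) (y : Fin N → ℝ)
    (θ : EuclideanSpace ℝ (Fin d)) : Prop :=
  ∃ α : ℝ, 0 < α ∧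
    IsKKTPoint (fun w => (1 / 2 : ℝ) * ‖w‖ ^ 2) (fun n w => 1 - margin Φ x y n w) (α • θ)

/-! ### The learning rate condition for gradient descent

Below `L` is the degree of homogeneity, `ℓ₀ ∈ (0, 1)` the training loss at time `t₀`, and the
argument `u ∈ (0, ℓ₀]` the current training loss. -/

/-- `μ(u) = log(1/ℓ₀) / (2 log(1/u))`. -/
def lrMu (ℓ₀ u : ℝ) : ℝ := Real.log (1 / ℓ₀) / (2 * Real.log (1 / u))

/-- `κ(u) = u (log(1/u))^{2-2/L}`, replaced for `L > 1` by its maximum to the right of the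
maximizer `e^{2/L-2}`. -/
def lrKappa (L u : ℝ) : ℝ :=
  if L ≤ 1 ∨ u ≤ Real.exp (2 / L - 2) then u * Real.log (1 / u) ^ (2 - 2 / L)
  else Real.exp ((2 - 2 / L) * (Real.log (2 - 2 / L) - 1))

/-- `φ'(u) = - sup { (1 + 2 (1 + λ(w)/L) μ(w)) / (w log(1/w)) : w ∈ [u, ℓ₀] }`, where
`λ(w) = 1 / log(1/w)`. -/
def lrPhiDeriv (L ℓ₀ u : ℝ) : ℝ :=
  -sSup ((fun w : ℝ => (1 + 2 * (1 + (Real.log (1 / w))⁻¹ / L) * lrMu ℓ₀ w) /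
    (w * Real.log (1 / w))) '' Icc u ℓ₀)

/-- `φ(u) = log log (1/u) + ∫₀ᵘ (φ'(w) + 1 / (w log(1/w))) dw`. -/
def lrPhi (L ℓ₀ u : ℝ) : ℝ :=
  Real.log (Real.log (1 / u)) +
    ∫ w in (0 : ℝ)..u, (lrPhiDeriv L ℓ₀ w + 1 / (w * Real.log (1 / w)))

/-- `γ̂(θ₀) = e^{φ(ℓ₀)} / ‖θ₀‖^L`, the smoothed normalized margin at time `t₀`, where `θ₀` is the
parameter and `ℓ₀` the training loss at time `t₀`. -/
def lrGammaHat {d : ℕ} (L ℓ₀ : ℝ) (θ₀ : EuclideanSpace ℝ (Fin d)) : ℝ :=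
  Real.exp (lrPhi L ℓ₀ ℓ₀) / ‖θ₀‖ ^ L

/-- `B₀ = sup { q_n(θ) : ‖θ‖ = 1, n }`. -/
def lrB0 {d N : ℕ} (q : Fin N → EuclideanSpace ℝ (Fin d) → ℝ) : ℝ :=
  sSup {r | ∃ n, ∃ θ, ‖θ‖ = 1 ∧ r = q n θ}

/-- `B₁ = sup { ‖∇q_n(θ)‖ : ‖θ‖ = 1, n }`. -/
def lrB1 {d N : ℕ} (q : Fin N → EuclideanSpace ℝ (Fin d) → ℝ) : ℝ :=
  sSup {r | ∃ n, ∃ θ, ‖θ‖ = 1 ∧ r = ‖gradient (q n) θ‖}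

/-- `B₂ = sup { ‖∇²q_n(θ)‖ : ‖θ‖ = 1, n }`, with the operator norm of the Hessian. -/
def lrB2 {d N : ℕ} (q : Fin N → EuclideanSpace ℝ (Fin d) → ℝ) : ℝ :=
  sSup {r | ∃ n, ∃ θ, ‖θ‖ = 1 ∧ r = ‖fderiv ℝ (gradient (q n)) θ‖}

/-- `C_η = ½ (B₁² + ‖θ₀‖^{-L} B₂) max { γ̂(θ₀)^{-2+2/L}, B₀^{-2+2/L} }`. -/
def lrConst {d N : ℕ} (L ℓ₀ : ℝ) (q : Fin N → EuclideanSpace ℝ (Fin d) → ℝ)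
    (θ₀ : EuclideanSpace ℝ (Fin d)) : ℝ :=
  (1 / 2 : ℝ) * (lrB1 q ^ 2 + ‖θ₀‖ ^ (-L) * lrB2 q) *
    max (lrGammaHat L ℓ₀ θ₀ ^ (-2 + 2 / L)) (lrB0 q ^ (-2 + 2 / L))

/-- The learning rate condition from time `t₀` on: the (nonnegative) learning rates have infinite
sum and satisfy `η(t) ≤ H(𝓛(θ(t)))` for `t ≥ t₀`, where `H(u) = μ(u) / (C_η κ(u))`. -/
def LearningRateCondition {d dx N : ℕ} (L : ℝ)
    (Φ : EuclideanSpace ℝ (Fin d) → EuclideanSpace ℝ (Fin dx) → ℝ)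
    (x : Fin N → EuclideanSpace ℝ (Fin dx)) (y : Fin N → ℝ)
    (η : ℕ → ℝ) (θ : ℕ → EuclideanSpace ℝ (Fin d)) (t₀ : ℕ) : Prop :=
  (∀ t, 0 ≤ η t) ∧
  Tendsto (fun T => ∑ t ∈ Finset.range T, η t) atTop atTop ∧
  ∀ t, t₀ ≤ t → η t ≤
    lrMu (trainLoss Φ x y (θ t₀)) (trainLoss Φ x y (θ t)) /
      (lrConst L (trainLoss Φ x y (θ t₀)) (margin Φ x y) (θ t₀) *
        lrKappa L (trainLoss Φ x y (θ t)))

end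

/-! ### Convex hulls and absolutely continuous functions -/

/-! Write `S` for the loss and `ℓ = -log S`, a soft minimum that lies below every margin. For a
negative loss subgradient `v = ∑ e^{-q_n} h_n` at `w`, Euler's identity gives `⟨v, w⟩ = L ∑ e^{-q_n}
q_n ≥ L S ℓ`.

Gradient flow: the chain rule gives `S' = -‖v‖²`, hence `(log ℓ)' = ‖v‖² / (S ℓ)`, and by
Cauchy–Schwarz this is at least `L (log ‖θ‖)'`. So the logarithm `log ℓ - L log ‖θ‖` of the smoothed
margin increases; homogeneity bounds it above, the loss tends to zero and the norm to infinity.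
While the squared cosine of the angle between `v` and `θ` stays below `1 / (1 + c)`, this quantity
gains at least `L c` times the gain of `log ‖θ‖`. At late times its boundedness leaves no room for
such a gain over a window in which `log ‖θ‖` grows by `Δ`, so the window contains a time at which
`v` is almost radial (`exists_regularTime_of_late`). The direction moves at most a constant times
the growth of `log ‖θ‖`, so it has hardly changed by then.

At such times `w ≈ ∑ λ_n h_n` up to scaling, with `λ_n` proportional to `e^{-q_n}`. Exponential
weights make all but the smallest margins negligible, which is complementary slackness in the limit.
Compactness of the multipliers and the closed graph of the Clarke subdifferential give the KKT
conditions (`exists_isKKTPoint_smul_of_tendsto`).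

Gradient descent: `log log (1/u)` is replaced by a convex minorant `φ`, steep enough to pay for the
second-order errors of a step (`mul_logNorm_sub_le`). This requires sufficient decrease of the loss,
hence a curvature bound along the segment, which in turn rests on invariants that follow from
sufficient decrease. A continuity argument along the segment breaks the circle
(`forall_le_sub_of_deriv2_le`). -/

/-- In a finite-dimensional space the convex hull of a compact set is compact. -/
theorem isCompact_convexHull_of_finiteDimensional {E : Type*} [NormedAddCommGroup E]
    [NormedSpace ℝ E] [FiniteDimensional ℝ E] {s : Set E} (hs : IsCompact s) :
    IsCompact (convexHull ℝ s) := by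
  -- Carathéodory: at most `finrank + 1` affinely independent points are needed, so the hull is a
  -- finite union of continuous images of compact sets.
  have key : convexHull ℝ s = ⋃ n ∈ Finset.range (Module.finrank ℝ E + 2),
      (fun p : (Fin n → ℝ) × (Fin n → E) => ∑ i, p.1 i • p.2 i) ''
        (stdSimplex ℝ (Fin n) ×ˢ Set.pi univ fun _ => s) := by
    apply Subset.antisymm
    · intro x hx
      obtain ⟨ι, _, z, w, hz, hind, hw, hw1, rfl⟩ := eq_pos_convex_span_of_mem_convexHull hx
      have hcard := hind.card_le_finrank_succ
      have h2 := Submodule.finrank_le (vectorSpan ℝ (Set.range z))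
      simp only [mem_iUnion, Finset.mem_range]
      refine ⟨Fintype.card ι, by omega, ?_⟩
      let e := (Fintype.equivFin ι).symm
      refine ⟨(fun i => w (e i), fun i => z (e i)), ⟨⟨fun i => (hw _).le, ?_⟩, ?_⟩, ?_⟩
      · exact (e.sum_comp w).trans hw1
      · exact fun i _ => hz ⟨_, rfl⟩
      · exact e.sum_comp (fun i => w i • z i)
    · simp only [iUnion_subset_iff]
      rintro n - _ ⟨⟨w, z⟩, ⟨⟨hw, hw1⟩, hz⟩, rfl⟩
      exact (convex_convexHull ℝ s).sum_mem (fun i _ => hw i) hw1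
        fun i _ => subset_convexHull ℝ s (hz i (mem_univ i))
  rw [key]
  refine (Finset.range _).isCompact_biUnion fun n _ => ?_
  refine IsCompact.image ((isCompact_stdSimplex ℝ (Fin n)).prod
    (isCompact_univ_pi fun _ => hs)) ?_
  fun_prop

/-- An absolutely continuous function with almost everywhere nonnegative derivative increases. -/
theorem AbsolutelyContinuousOnInterval.le_of_ae_hasDerivAt_nonneg {f : ℝ → ℝ} {a b : ℝ}
    (hab : a ≤ b) (hf : AbsolutelyContinuousOnInterval f a b)
    (h : ∀ᵐ t, t ∈ Ioc a b → ∃ v, 0 ≤ v ∧ HasDerivAt f v t) : f a ≤ f b := by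
  have h1 := hf.integral_deriv_eq_sub
  have h2 : 0 ≤ ∫ x in a..b, deriv f x := by
    rw [intervalIntegral.integral_of_le hab]
    apply setIntegral_nonneg_of_ae_restrict
    rw [EventuallyLE, ae_restrict_iff' measurableSet_Ioc]
    filter_upwards [h] with t ht htm
    obtain ⟨v, hv, hd⟩ := ht htm
    rw [hd.deriv]; exact hv
  linarith

theorem AbsolutelyContinuousOnInterval.lipschitzOnWith_comp {X Y : Type*} [PseudoMetricSpace X]
    [PseudoMetricSpace Y] {z : ℝ → X} {F : X → Y} {a b : ℝ} {K : NNReal} {s : Set X}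
    (hz : AbsolutelyContinuousOnInterval z a b) (hF : LipschitzOnWith K F s)
    (hs : ∀ t ∈ uIcc a b, z t ∈ s) : AbsolutelyContinuousOnInterval (fun t => F (z t)) a b := by
  rw [absolutelyContinuousOnInterval_iff] at hz ⊢
  intro ε hε
  obtain ⟨δ, hδ, h⟩ := hz (ε / (K + 1)) (by positivity)
  refine ⟨δ, hδ, fun E hE hlt => ?_⟩
  have h1 := h E hE hlt
  have hK : (0 : ℝ) < K + 1 := by positivity
  rw [lt_div_iff₀ hK] at h1
  have h2 : ∑ i ∈ Finset.range E.1, dist (F (z (E.2 i).1)) (F (z (E.2 i).2)) ≤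
      ∑ i ∈ Finset.range E.1, K * dist (z (E.2 i).1) (z (E.2 i).2) := by
    refine Finset.sum_le_sum fun i hi => ?_
    have := hE.1 i hi
    exact hF.dist_le_mul _ (hs _ this.1) _ (hs _ this.2)
  rw [← Finset.mul_sum] at h2
  have h3 : 0 ≤ ∑ i ∈ Finset.range E.1, dist (z (E.2 i).1) (z (E.2 i).2) :=
    Finset.sum_nonneg fun _ _ => dist_nonneg
  nlinarith

/-- The image of the interval is compact, so one Lipschitz constant serves on all of it. A general
`U` is allowed because logarithms and normalized vectors are only regular away from singular points.
-/
theorem AbsolutelyContinuousOnInterval.locallyLipschitzOn_comp {X Y : Type*}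
    [NormedAddCommGroup X] [PseudoMetricSpace Y] {z : ℝ → X} {F : X → Y} {a b : ℝ} {U : Set X}
    (hz : AbsolutelyContinuousOnInterval z a b) (hF : LocallyLipschitzOn U F)
    (hs : ∀ t ∈ uIcc a b, z t ∈ U) : AbsolutelyContinuousOnInterval (fun t => F (z t)) a b := by
  have hc : IsCompact (z '' uIcc a b) := isCompact_uIcc.image_of_continuousOn hz.continuousOn
  have hsub : z '' uIcc a b ⊆ U := by rintro _ ⟨t, ht, rfl⟩; exact hs t ht
  have hF' : LocallyLipschitzOn (z '' uIcc a b) F := hF.mono hsub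
  obtain ⟨K, hK⟩ : ∃ K, LipschitzOnWith K F (z '' uIcc a b) :=
    LocallyLipschitzOn.exists_lipschitzOnWith_of_compact hc hF'
  exact hz.lipschitzOnWith_comp hK fun t ht => ⟨t, ht, rfl⟩

/-! ### Clarke subdifferential -/

/-- Lipschitz continuity on some neighbourhood of `x`. -/
def LipschitzNear {E F : Type*} [PseudoEMetricSpace E] [PseudoEMetricSpace F] (f : E → F) (x : E) :
    Prop :=
  ∃ K : NNReal, ∃ s ∈ 𝓝 x, LipschitzOnWith K f s

section Clarke

variable {d : ℕ} {f : EuclideanSpace ℝ (Fin d) → ℝ} {x : EuclideanSpace ℝ (Fin d)}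

/-- The limits of gradients of `f` along sequences converging to `x`. -/
def limitingGradients (f : EuclideanSpace ℝ (Fin d) → ℝ) (x : EuclideanSpace ℝ (Fin d)) :
    Set (EuclideanSpace ℝ (Fin d)) :=
  {g | ∃ u : ℕ → EuclideanSpace ℝ (Fin d), Tendsto u atTop (𝓝 x) ∧
    (∀ k, DifferentiableAt ℝ f (u k)) ∧ Tendsto (fun k => gradient f (u k)) atTop (𝓝 g)}

/-- The set is the slice over `x` of the closure of the graph of the gradient. -/
theorem isClosed_limitingGradients : IsClosed (limitingGradients f x) := by
  have : limitingGradients f x = (fun g => (x, g)) ⁻¹'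
      closure ((fun u => (u, gradient f u)) '' {u | DifferentiableAt ℝ f u}) := by
    ext g
    simp only [mem_preimage, mem_closure_iff_seq_limit]
    constructor
    · rintro ⟨u, hu, hd, hg⟩
      exact ⟨fun k => (u k, gradient f (u k)), fun k => ⟨u k, hd k, rfl⟩, hu.prodMk_nhds hg⟩
    · rintro ⟨p, hp, hlim⟩
      choose u hu hpu using hp
      obtain rfl : (fun k => (u k, gradient f (u k))) = p := funext hpu
      rw [nhds_prod_eq, tendsto_prod_iff'] at hlim
      exact ⟨u, hlim.1, hu, hlim.2⟩
  rw [this]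
  exact isClosed_closure.preimage (by fun_prop)

theorem norm_gradient_le_of_lipschitzOn {K : NNReal} {s : Set (EuclideanSpace ℝ (Fin d))}
    (hs : s ∈ 𝓝 x) (hf : LipschitzOnWith K f s) : ‖gradient f x‖ ≤ K := by
  rw [gradient, LinearIsometryEquiv.norm_map]
  exact norm_fderiv_le_of_lipschitzOn ℝ hs hf

theorem limitingGradients_subset_closedBall {K : NNReal} {s : Set (EuclideanSpace ℝ (Fin d))}
    (hs : s ∈ 𝓝 x) (hf : LipschitzOnWith K f s) :
    limitingGradients f x ⊆ Metric.closedBall 0 K := by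
  rintro g ⟨u, hu, -, hg⟩
  rw [mem_closedBall_zero_iff]
  refine le_of_tendsto hg.norm ?_
  filter_upwards [hu.eventually (eventually_mem_nhds_iff.mpr hs)] with k hk
  exact norm_gradient_le_of_lipschitzOn hk hf

theorem norm_le_of_mem_clarkeSubdifferential {K : NNReal} {s : Set (EuclideanSpace ℝ (Fin d))}
    (hs : s ∈ 𝓝 x) (hf : LipschitzOnWith K f s) {h : EuclideanSpace ℝ (Fin d)}
    (hh : h ∈ clarkeSubdifferential f x) : ‖h‖ ≤ K :=
  mem_closedBall_zero_iff.mp (convexHull_min (limitingGradients_subset_closedBall hs hf)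
    (convex_closedBall 0 _) hh)

theorem isCompact_limitingGradients (hf : LipschitzNear f x) :
    IsCompact (limitingGradients f x) := by
  obtain ⟨K, s, hs, hK⟩ := hf
  exact (isCompact_closedBall 0 (K : ℝ)).of_isClosed_subset isClosed_limitingGradients
    (limitingGradients_subset_closedBall hs hK)

theorem isCompact_clarkeSubdifferential (hf : LipschitzNear f x) :
    IsCompact (clarkeSubdifferential f x) :=
  isCompact_convexHull_of_finiteDimensional (isCompact_limitingGradients hf)

theorem gradient_mem_clarkeSubdifferential (hf : DifferentiableAt ℝ f x) :
    gradient f x ∈ clarkeSubdifferential f x :=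
  subset_convexHull ℝ _ ⟨fun _ => x, tendsto_const_nhds, fun _ => hf, tendsto_const_nhds⟩

/-- A bounded sequence of gradients at points tending to `x` clusters at a limiting gradient. -/
theorem exists_limitingGradient_of_seq (hf : LipschitzNear f x)
    {u : ℕ → EuclideanSpace ℝ (Fin d)} (hu : Tendsto u atTop (𝓝 x))
    (hd : ∀ k, DifferentiableAt ℝ f (u k)) :
    ∃ g ∈ limitingGradients f x, ∃ φ : ℕ → ℕ, StrictMono φ ∧
      Tendsto (fun k => gradient f (u (φ k))) atTop (𝓝 g) := by
  obtain ⟨K, s, hs, hK⟩ := hf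
  have hev : ∀ᶠ k in atTop, gradient f (u k) ∈ Metric.closedBall (0 : EuclideanSpace ℝ (Fin d)) K := by
    filter_upwards [hu.eventually (eventually_mem_nhds_iff.mpr hs)] with k hk
    exact mem_closedBall_zero_iff.mpr (norm_gradient_le_of_lipschitzOn hk hK)
  obtain ⟨g, -, φ, hφ, hg⟩ :=
    (isCompact_closedBall (0 : EuclideanSpace ℝ (Fin d)) (K : ℝ)).tendsto_subseq' hev.frequently
  exact ⟨g, ⟨u ∘ φ, hu.comp hφ.tendsto_atTop, fun k => hd _, hg⟩, φ, hφ, hg⟩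

/-- Otherwise gradients along some sequence of violating points would cluster at a limiting gradient
with inner product at most `c`. -/
theorem eventually_lt_inner_gradient (hf : LipschitzNear f x) {v : EuclideanSpace ℝ (Fin d)} {c : ℝ}
    (h : ∀ g ∈ limitingGradients f x, c < inner ℝ g v) :
    ∀ᶠ u in 𝓝 x, DifferentiableAt ℝ f u → c < inner ℝ (gradient f u) v := by
  by_contra hcon
  obtain ⟨u, hu, hu2⟩ := exists_seq_forall_of_frequently (not_eventually.mp hcon)
  push Not at hu2
  obtain ⟨g, hg, φ, hφ, hlim⟩ := exists_limitingGradient_of_seq hf hu fun k => (hu2 k).1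
  have : inner ℝ g v ≤ c :=
    le_of_tendsto (hlim.inner tendsto_const_nhds) (Eventually.of_forall fun k => (hu2 (φ k)).2)
  exact absurd (h g hg) this.not_gt

/-- The Clarke subdifferential is upper semicontinuous. -/
theorem eventually_forall_clarkeSubdifferential_le_inner (hf : LipschitzNear f x)
    {v : EuclideanSpace ℝ (Fin d)} {c : ℝ} (h : ∀ g ∈ limitingGradients f x, c < inner ℝ g v) :
    ∀ᶠ u in 𝓝 x, ∀ g ∈ clarkeSubdifferential f u, c ≤ inner ℝ g v := by
  filter_upwards [(eventually_lt_inner_gradient hf h).eventually_nhds] with u hu g hg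
  have hconv : Convex ℝ {g : EuclideanSpace ℝ (Fin d) | c ≤ inner ℝ g v} := by
    intro p hp q hq s t hs ht hst
    simp only [mem_ofPred_eq, inner_add_left, real_inner_smul_left] at hp hq ⊢
    have : s * c + t * c = c := by rw [← add_mul, hst, one_mul]
    linarith [mul_le_mul_of_nonneg_left hp hs, mul_le_mul_of_nonneg_left hq ht]
  refine convexHull_min ?_ hconv hg
  rintro g ⟨w, hw, hd, hlim⟩
  refine mem_ofPred_eq ▸ ge_of_tendsto (hlim.inner tendsto_const_nhds) ?_
  filter_upwards [hw.eventually hu] with k hk using (hk (hd k)).le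

/-- The graph of the Clarke subdifferential is closed. -/
theorem mem_clarkeSubdifferential_of_tendsto (hf : LipschitzNear f x)
    {u h : ℕ → EuclideanSpace ℝ (Fin d)} {g : EuclideanSpace ℝ (Fin d)}
    (hu : Tendsto u atTop (𝓝 x)) (hmem : ∀ k, h k ∈ clarkeSubdifferential f (u k))
    (hg : Tendsto h atTop (𝓝 g)) : g ∈ clarkeSubdifferential f x := by
  by_contra hcon
  -- A hyperplane strictly separating `g` from the compact convex subdifferential at `x` also
  -- bounds, by upper semicontinuity, the subdifferentials at nearby points, hence the limit `g`
  -- itself.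
  obtain ⟨F, c, hlt, hF⟩ := geometric_hahn_banach_point_closed (convex_convexHull ℝ _)
    (isCompact_clarkeSubdifferential hf).isClosed hcon
  obtain ⟨v, rfl⟩ := (InnerProductSpace.toDual ℝ (EuclideanSpace ℝ (Fin d))).surjective F
  simp only [InnerProductSpace.toDual_apply_apply] at hlt hF
  have hev := eventually_forall_clarkeSubdifferential_le_inner hf (v := v) (c := c)
    fun g hg => by rw [real_inner_comm]; exact hF g (subset_convexHull ℝ _ hg)
  have : c ≤ inner ℝ g v := by
    refine ge_of_tendsto (hg.inner tendsto_const_nhds) ?_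
    filter_upwards [hu.eventually hev] with k hk using hk _ (hmem k)
  rw [real_inner_comm] at this
  linarith

end Clarke

/-! ### Mean value inequality and sum rule for Clarke subgradients. -/

section ClarkeCalculus

variable {d : ℕ} {f : EuclideanSpace ℝ (Fin d) → ℝ} {x : EuclideanSpace ℝ (Fin d)}

theorem hasDerivAt_comp_of_differentiableAt {u v : EuclideanSpace ℝ (Fin d)} {s : ℝ}
    {z : ℝ → EuclideanSpace ℝ (Fin d)} (hz : HasDerivAt z v s) (hu : z s = u)
    (hf : DifferentiableAt ℝ f u) :
    HasDerivAt (fun t => f (z t)) (inner ℝ (gradient f u) v) s := by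
  subst hu
  have := hf.hasGradientAt.hasFDerivAt.comp_hasDerivAt s hz
  exact this

theorem hasDerivAt_comp_line {u v : EuclideanSpace ℝ (Fin d)} {s : ℝ}
    (hf : DifferentiableAt ℝ f (u + s • v)) :
    HasDerivAt (fun t => f (u + t • v)) (inner ℝ (gradient f (u + s • v)) v) s := by
  refine hasDerivAt_comp_of_differentiableAt ?_ rfl hf
  simpa using ((hasDerivAt_id s).smul_const v).const_add u

theorem ae_differentiableAt_of_lipschitzOn_ball {K : NNReal} {r : ℝ}
    (hf : LipschitzOnWith K f (Metric.ball x r)) :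
    ∀ᵐ u, u ∈ Metric.ball x r → DifferentiableAt ℝ f u := by
  filter_upwards [hf.ae_differentiableWithinAt_of_mem (μ := volume)] with u hu hmem
  exact (hu hmem).differentiableAt (Metric.isOpen_ball.mem_nhds hmem)

/-- Almost every translate of a line meets a null set in a null set. -/
theorem ae_ae_add_smul {p : EuclideanSpace ℝ (Fin d) → Prop} (hp : ∀ᵐ u, p u)
    (v : EuclideanSpace ℝ (Fin d)) : ∀ᵐ u, ∀ᵐ s : ℝ, p (u + s • v) := by
  -- Exchanging the two quantifiers by Fubini needs a measurable exceptional set, so a measurable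
  -- null superset is used.
  set S := toMeasurable volume {u | ¬ p u} with hS
  have hS0 : volume S = 0 := by rw [hS, measure_toMeasurable]; exact hp
  have hSm : MeasurableSet S := measurableSet_toMeasurable _ _
  have hae : ∀ᵐ u, u ∉ S := measure_eq_zero_iff_ae_notMem.mp hS0
  have h1 : ∀ᵐ s : ℝ, ∀ᵐ u : EuclideanSpace ℝ (Fin d), u + s • v ∉ S :=
    Eventually.of_forall fun s => (quasiMeasurePreserving_add_right volume (s • v)).ae hae
  have hmeas : MeasurableSet {q : ℝ × EuclideanSpace ℝ (Fin d) | q.2 + q.1 • v ∉ S} := by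
    have : Measurable fun q : ℝ × EuclideanSpace ℝ (Fin d) => q.2 + q.1 • v := by fun_prop
    exact this hSm.compl
  have h2 := (Measure.ae_ae_comm hmeas).mp h1
  filter_upwards [h2] with u hu
  filter_upwards [hu] with s hs
  by_contra hcon
  exact hs (subset_toMeasurable _ _ hcon)

/-- A mean value inequality for Lipschitz functions, from a bound on the gradients where they
exist. -/
theorem mul_le_sub_of_le_inner_gradient {K : NNReal} {r : ℝ}
    (hf : LipschitzOnWith K f (Metric.ball x r)) {v : EuclideanSpace ℝ (Fin d)} {c : ℝ}
    (hc : ∀ u ∈ Metric.ball x r, DifferentiableAt ℝ f u → c ≤ inner ℝ (gradient f u) v)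
    {u : EuclideanSpace ℝ (Fin d)} {s : ℝ} (hs : 0 ≤ s) (hu : u ∈ Metric.ball x r)
    (hus : u + s • v ∈ Metric.ball x r) : c * s ≤ f (u + s • v) - f u := by
  -- A strict violation persists under small changes of `u`. The base point can thus be moved to
  -- some `w` whose line meets the non-differentiability points in a null set; there the derivative
  -- can be integrated.
  by_contra! hcon
  have hcont : ∀ w ∈ Metric.ball x r, ContinuousAt f w := fun w hw =>
    hf.continuousOn.continuousAt (Metric.isOpen_ball.mem_nhds hw)
  have hadd : ContinuousAt (fun w : EuclideanSpace ℝ (Fin d) => w + s • v) u := by fun_prop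
  have hcomp : ContinuousAt (fun w => f (w + s • v) - f w) u :=
    (ContinuousAt.comp (f := fun w => w + s • v) (g := f) (hcont _ hus) hadd).sub (hcont u hu)
  have hev : ∀ᶠ w in 𝓝 u, f (w + s • v) - f w < c * s ∧ w ∈ Metric.ball x r ∧
      w + s • v ∈ Metric.ball x r :=
    (hcomp.eventually_lt continuousAt_const hcon).and
      ((Metric.isOpen_ball.eventually_mem hu).and
        (hadd.eventually (Metric.isOpen_ball.eventually_mem hus)))
  have hdense := Measure.dense_of_ae
    (ae_ae_add_smul (ae_differentiableAt_of_lipschitzOn_ball hf) v)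
  obtain ⟨w, hwae, hw⟩ := hdense.inter_nhds_nonempty hev
  obtain ⟨hlt, hw1, hw2⟩ := hw
  have hseg : ∀ t ∈ uIcc 0 s, w + t • v ∈ Metric.ball x r := by
    intro t ht
    rw [uIcc_of_le hs] at ht
    rcases hs.eq_or_lt with rfl | hs'
    · obtain rfl : t = 0 := le_antisymm ht.2 ht.1
      exact hw2
    · have := (convex_ball x r) hw1 hw2 (a := 1 - t / s) (b := t / s)
        (by rw [sub_nonneg]; exact (div_le_one hs').mpr ht.2) (div_nonneg ht.1 hs) (by ring)
      convert this using 1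
      rw [smul_add, smul_smul, div_mul_cancel₀ _ hs'.ne', ← add_assoc, ← add_smul]
      simp
  have hlip : LipschitzOnWith (K * (‖v‖₊)) (fun t : ℝ => f (w + t • v)) (uIcc 0 s) := by
    refine hf.comp (g := f) (f := fun t : ℝ => w + t • v) (t := Metric.ball x r) ?_ hseg
    refine (LipschitzWith.of_dist_le_mul fun a b => ?_).lipschitzOnWith
    rw [dist_add_left, dist_eq_norm, ← sub_smul, norm_smul, mul_comm]
    rfl
  have hid : AbsolutelyContinuousOnInterval (fun t : ℝ => c * t) 0 s :=
    (LipschitzWith.id.lipschitzOnWith.absolutelyContinuousOnInterval).const_mul c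
  have hle := AbsolutelyContinuousOnInterval.le_of_ae_hasDerivAt_nonneg hs
    (hlip.absolutelyContinuousOnInterval.fun_sub hid) (by
      filter_upwards [hwae] with t ht htm
      have hmem := hseg t (by rw [uIcc_of_le hs]; exact Ioc_subset_Icc_self htm)
      have hd := ht hmem
      refine ⟨_, sub_nonneg.mpr (hc _ hmem hd),
        (hasDerivAt_comp_line hd).sub ?_⟩
      simpa using (hasDerivAt_id t).const_mul c)
  simp only [zero_smul, add_zero, mul_zero, sub_zero] at hle
  linarith

/-- The lower bound on increments holds at every base point near `x`, differentiable or not. The sum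
rule needs this because a sum can be differentiable where its terms are not. -/
theorem eventually_mul_le_sub (hf : LipschitzNear f x) {v : EuclideanSpace ℝ (Fin d)} {c : ℝ}
    (h : ∀ g ∈ limitingGradients f x, c < inner ℝ g v) :
    ∀ᶠ u in 𝓝 x, ∀ᶠ s in 𝓝[>] (0 : ℝ), c * s ≤ f (u + s • v) - f u := by
  have h1 := eventually_lt_inner_gradient hf h
  obtain ⟨K, S, hS, hK⟩ := hf
  obtain ⟨r, hr, hball⟩ := Metric.eventually_nhds_iff_ball.mp (h1.and hS)
  filter_upwards [Metric.ball_mem_nhds x hr] with u hu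
  have hcont : ContinuousAt (fun s : ℝ => u + s • v) 0 := by fun_prop
  have h0 : ∀ᶠ s in 𝓝 (0 : ℝ), u + s • v ∈ Metric.ball x r :=
    hcont (by simpa using Metric.isOpen_ball.mem_nhds hu)
  filter_upwards [nhdsWithin_le_nhds h0, self_mem_nhdsWithin] with s hs hs0
  exact mul_le_sub_of_le_inner_gradient (hK.mono fun w hw => (hball w hw).2)
    (fun w hw hd => ((hball w hw).1 hd).le) (le_of_lt hs0) hu hs

/-- By Rademacher's theorem there are differentiability points arbitrarily close to `x`, and their
gradients are bounded. -/
theorem clarkeSubdifferential_nonempty (hf : LipschitzNear f x) :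
    (clarkeSubdifferential f x).Nonempty := by
  have hfreq : ∃ᶠ u in 𝓝 x, DifferentiableAt ℝ f u := by
    obtain ⟨K, S, hS, hK⟩ := hf
    obtain ⟨r, hr, hball⟩ := Metric.mem_nhds_iff.mp hS
    have hae := ae_differentiableAt_of_lipschitzOn_ball (hK.mono hball)
    rw [frequently_iff]
    intro U hU
    obtain ⟨u, hp, hu⟩ := (Measure.dense_of_ae hae).inter_nhds_nonempty
      (inter_mem hU (Metric.ball_mem_nhds x hr))
    exact ⟨u, hu.1, hp hu.2⟩
  obtain ⟨u, hu, hd⟩ := exists_seq_forall_of_frequently hfreq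
  obtain ⟨g, hg, -⟩ := exists_limitingGradient_of_seq hf hu hd
  exact ⟨g, subset_convexHull ℝ _ hg⟩

/-- If `f ≤ g` to the right of `0` with equality at `0`, the derivatives at `0` are ordered. -/
theorem le_of_hasDerivAt_of_eventually_le {f g : ℝ → ℝ} {a b : ℝ} (hf : HasDerivAt f a 0)
    (hg : HasDerivAt g b 0) (h0 : f 0 = g 0) (h : ∀ᶠ s in 𝓝[>] (0 : ℝ), f s ≤ g s) : a ≤ b := by
  have h1 := hf.tendsto_slope_zero_right
  have h2 := hg.tendsto_slope_zero_right
  simp only [zero_add, smul_eq_mul] at h1 h2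
  refine le_of_tendsto_of_tendsto h1 h2 ?_
  filter_upwards [h, self_mem_nhdsWithin] with s hs hs0
  have : (0 : ℝ) < s := hs0
  rw [h0]
  gcongr

/-- The sum and chain rule for the Clarke subdifferential of a sum of exponentials. -/
theorem exists_eq_neg_sum_exp_smul_of_mem_clarkeSubdifferential {N : ℕ}
    {q : Fin N → EuclideanSpace ℝ (Fin d) → ℝ} (hq : ∀ n, LocallyLipschitz (q n))
    {g : EuclideanSpace ℝ (Fin d)}
    (hg : g ∈ clarkeSubdifferential (fun θ => ∑ n, Real.exp (-q n θ)) x) :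
    ∃ h : Fin N → EuclideanSpace ℝ (Fin d), (∀ n, h n ∈ clarkeSubdifferential (q n) x) ∧
      g = -∑ n, Real.exp (-q n x) • h n := by
  have hqx : ∀ n, LipschitzNear (q n) x := fun n => hq n x
  set T : (Fin N → EuclideanSpace ℝ (Fin d)) → EuclideanSpace ℝ (Fin d) :=
    fun h => -∑ n, Real.exp (-q n x) • h n with hT
  set A : Set (Fin N → EuclideanSpace ℝ (Fin d)) :=
    Set.pi univ fun n => clarkeSubdifferential (q n) x with hA
  have hTlin : IsLinearMap ℝ T := by
    constructor
    · intro a b; simp [hT, smul_add, Finset.sum_add_distrib, add_comm]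
    · intro c a; simp only [hT, Pi.smul_apply, smul_neg, Finset.smul_sum]
      simp_rw [smul_comm c]
  have hconv : Convex ℝ (T '' A) :=
    (convex_pi fun n _ => convex_convexHull ℝ _).is_linear_image hTlin
  have hcomp : IsCompact (T '' A) :=
    (isCompact_univ_pi fun n => isCompact_clarkeSubdifferential (hqx n)).image (by fun_prop)
  suffices hsub : limitingGradients (fun θ => ∑ n, Real.exp (-q n θ)) x ⊆ T '' A by
    obtain ⟨h, hh, rfl⟩ := convexHull_min hsub hconv hg
    exact ⟨h, fun n => hh n (mem_univ n), rfl⟩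
  clear hg g
  rintro g ⟨u, hu, hd, hlim⟩
  by_contra hcon
  obtain ⟨F, c₀, hlt, hF⟩ := geometric_hahn_banach_point_closed hconv hcomp.isClosed hcon
  obtain ⟨v, rfl⟩ := (InnerProductSpace.toDual ℝ (EuclideanSpace ℝ (Fin d))).surjective F
  simp only [InnerProductSpace.toDual_apply_apply] at hlt hF
  -- Minimizing each `⟨h, -v⟩` separately yields the point `T h` of the image that reaches farthest
  -- in direction `-v`. It remains to show that `g` reaches no farther, against the separation.
  have hmin : ∀ n, ∃ h ∈ clarkeSubdifferential (q n) x, ∀ h' ∈ clarkeSubdifferential (q n) x,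
      inner ℝ h (-v) ≤ inner ℝ h' (-v) := fun n => by
    obtain ⟨h, hh, hm⟩ := (isCompact_clarkeSubdifferential (hqx n)).exists_isMinOn
      (clarkeSubdifferential_nonempty (hqx n))
      (f := fun h => inner ℝ h (-v)) (by fun_prop)
    exact ⟨h, hh, fun h' hh' => hm hh'⟩
  choose h hh hm using hmin
  have hTh := hF (T h) ⟨h, fun n _ => hh n, rfl⟩
  -- Only the full sum is known to be differentiable at `u k`. One-sided lower bounds on the
  -- increments of the `q n` bound the sum from above by explicit exponentials with equality at `s =
  -- 0`, so the derivatives at `0` are ordered.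
  have hbound : ∀ ε > 0, inner ℝ g (-v) ≤
      ∑ n, Real.exp (-q n x) * -(inner ℝ (h n) (-v) - ε) := by
    intro ε hε
    have hev : ∀ᶠ w in 𝓝 x, ∀ n, ∀ᶠ s in 𝓝[>] (0 : ℝ),
        (inner ℝ (h n) (-v) - ε) * s ≤ q n (w + s • (-v)) - q n w :=
      eventually_all.mpr fun n => eventually_mul_le_sub (hqx n) fun g hg => by
        have := hm n g (subset_convexHull ℝ _ hg)
        linarith
    have hcont : ∀ n, Tendsto (fun k => q n (u k)) atTop (𝓝 (q n x)) := fun n =>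
      ((hq n).continuous.tendsto x).comp hu
    refine le_of_tendsto_of_tendsto (hlim.inner tendsto_const_nhds)
      (tendsto_finsetSum _ fun n _ =>
        ((Real.continuous_exp.tendsto _).comp (hcont n).neg).mul_const _) ?_
    filter_upwards [hu.eventually hev] with k hk
    have hd1 : HasDerivAt (fun s : ℝ => ∑ n, Real.exp (-q n (u k + s • (-v))))
        (inner ℝ (gradient (fun θ => ∑ n, Real.exp (-q n θ)) (u k)) (-v)) 0 :=
      hasDerivAt_comp_of_differentiableAt (f := fun θ => ∑ n, Real.exp (-q n θ))
        (by simpa using ((hasDerivAt_id (0 : ℝ)).smul_const (-v)).const_add (u k)) (by simp) (hd k)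
    have hd2 : HasDerivAt (fun s : ℝ => ∑ n, Real.exp (-q n (u k)) *
        Real.exp (s * -(inner ℝ (h n) (-v) - ε)))
        (∑ n, Real.exp (-q n (u k)) * -(inner ℝ (h n) (-v) - ε)) 0 := by
      refine HasDerivAt.fun_sum fun n _ => HasDerivAt.const_mul _ ?_
      have := ((hasDerivAt_id (0 : ℝ)).mul_const (-(inner ℝ (h n) (-v) - ε))).exp
      simpa using this
    refine le_of_hasDerivAt_of_eventually_le hd1 hd2 (by simp) ?_
    filter_upwards [eventually_all.mpr hk] with s hs
    refine Finset.sum_le_sum fun n _ => ?_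
    rw [← Real.exp_add, Real.exp_le_exp]
    have := hs n
    linarith
  have hle : inner ℝ g (-v) ≤ ∑ n, Real.exp (-q n x) * -inner ℝ (h n) (-v) := by
    have hlim0 : Tendsto (fun ε : ℝ => ∑ n, Real.exp (-q n x) * -(inner ℝ (h n) (-v) - ε))
        (𝓝[>] 0) (𝓝 (∑ n, Real.exp (-q n x) * -(inner ℝ (h n) (-v) - 0))) :=
      Tendsto.mono_left (Continuous.tendsto (by fun_prop) 0) nhdsWithin_le_nhds
    simp only [sub_zero] at hlim0
    exact ge_of_tendsto hlim0 (by filter_upwards [self_mem_nhdsWithin] with ε hε using hbound ε hε)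
  simp only [hT, inner_neg_right, neg_neg, inner_sum, real_inner_smul_right] at hTh hle
  have : ∑ n, Real.exp (-q n x) * inner ℝ (h n) v = ∑ n, Real.exp (-q n x) * inner ℝ v (h n) := by
    simp_rw [real_inner_comm]
  rw [real_inner_comm] at hle
  linarith

end ClarkeCalculus

/-! ### Subgradients of homogeneous functions. -/

section Homogeneous

variable {d : ℕ} {f : EuclideanSpace ℝ (Fin d) → ℝ} {x : EuclideanSpace ℝ (Fin d)} {L : ℝ}

theorem hasGradientAt_smul_of_homogeneous (hf : ∀ θ α, 0 < α → f (α • θ) = α ^ L * f θ) {α : ℝ}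
    (hα : 0 < α) (hx : DifferentiableAt ℝ f x) :
    HasGradientAt f (α ^ (L - 1) • gradient f x) (α • x) := by
  have h1 : f = fun w => α ^ L * f (α⁻¹ • w) := by
    ext w
    rw [← hf _ _ hα, smul_smul, mul_inv_cancel₀ hα.ne', one_smul]
  have h2 : HasFDerivAt (fun w : EuclideanSpace ℝ (Fin d) => α⁻¹ • w)
      (α⁻¹ • ContinuousLinearMap.id ℝ _) (α • x) := (hasFDerivAt_id _).const_smul α⁻¹
  have h3 : HasFDerivAt f (InnerProductSpace.toDual ℝ _ (gradient f x)) (α⁻¹ • α • x) := by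
    rw [smul_smul, inv_mul_cancel₀ hα.ne', one_smul]
    exact hx.hasGradientAt.hasFDerivAt
  have h4 := (h3.comp (α • x) h2).const_mul (α ^ L)
  rw [hasGradientAt_iff_hasFDerivAt]
  refine (h4.congr_fderiv ?_).congr_of_eventuallyEq (Eventually.of_forall fun w => congrFun h1 w)
  ext w
  simp [Real.rpow_sub_one hα.ne']
  ring

open Pointwise in
theorem smul_mem_clarkeSubdifferential_of_homogeneous
    (hf : ∀ θ α, 0 < α → f (α • θ) = α ^ L * f θ) {α : ℝ} (hα : 0 < α)
    {h : EuclideanSpace ℝ (Fin d)} (hh : h ∈ clarkeSubdifferential f x) :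
    α ^ (L - 1) • h ∈ clarkeSubdifferential f (α • x) := by
  have hsub : α ^ (L - 1) • limitingGradients f x ⊆ limitingGradients f (α • x) := by
    rintro _ ⟨g, ⟨u, hu, hd, hg⟩, rfl⟩
    refine ⟨fun k => α • u k, hu.const_smul α, fun k =>
      (hasGradientAt_smul_of_homogeneous hf hα (hd k)).differentiableAt, ?_⟩
    simp_rw [fun k => (hasGradientAt_smul_of_homogeneous hf hα (hd k)).gradient]
    exact hg.const_smul _
  have := convexHull_mono (𝕜 := ℝ) hsub
  rw [convexHull_smul] at this
  exact this (smul_mem_smul_set hh)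

/-- Euler's identity for the Clarke subdifferential of a homogeneous function. -/
theorem inner_self_of_mem_clarkeSubdifferential (hf : ∀ θ α, 0 < α → f (α • θ) = α ^ L * f θ)
    (hx : ContinuousAt f x) {h : EuclideanSpace ℝ (Fin d)} (hh : h ∈ clarkeSubdifferential f x) :
    inner ℝ h x = L * f x := by
  have euler : ∀ u, DifferentiableAt ℝ f u → inner ℝ (gradient f u) u = L * f u := by
    intro u hu
    have h1 : HasDerivAt (fun s : ℝ => f (s • u)) (inner ℝ (gradient f u) u) 1 :=
      hasDerivAt_comp_of_differentiableAt (by simpa using (hasDerivAt_id (1 : ℝ)).smul_const u)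
        (by simp) hu
    have h2 : HasDerivAt (fun s : ℝ => s ^ L * f u) (L * f u) 1 := by
      simpa using (Real.hasDerivAt_rpow_const (x := 1) (p := L) (Or.inl one_ne_zero)).mul_const
        (f u)
    refine h1.unique (h2.congr_of_eventuallyEq ?_)
    filter_upwards [eventually_gt_nhds (zero_lt_one (α := ℝ))] with s hs using hf u s hs
  have hconv : Convex ℝ {h : EuclideanSpace ℝ (Fin d) | inner ℝ h x = L * f x} := by
    intro p hp q hq s t hs ht hst
    simp only [mem_ofPred_eq, inner_add_left, real_inner_smul_left] at hp hq ⊢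
    rw [hp, hq, ← add_mul, hst, one_mul]
  refine convexHull_min ?_ hconv hh
  rintro g ⟨u, hu, hd, hg⟩
  have h1 : Tendsto _ _ (𝓝 (inner ℝ g x)) := hg.inner hu
  simp_rw [fun k => euler _ (hd k)] at h1
  exact tendsto_nhds_unique h1 ((hx.tendsto.comp hu).const_mul L)

open Pointwise in
theorem neg_mem_clarkeSubdifferential_const_sub {c : ℝ} {h : EuclideanSpace ℝ (Fin d)}
    (hh : h ∈ clarkeSubdifferential f x) : -h ∈ clarkeSubdifferential (fun w => c - f w) x := by
  have hsub : -limitingGradients f x ⊆ limitingGradients (fun w => c - f w) x := by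
    intro g hg
    obtain ⟨u, hu, hd, hlim⟩ := hg
    refine ⟨u, hu, fun k => (hd k).const_sub c, ?_⟩
    have : ∀ k, gradient (fun w => c - f w) (u k) = -gradient f (u k) := fun k => by
      simp [gradient, fderiv_const_sub]
    simp_rw [this]
    simpa using hlim.neg
  have := convexHull_mono (𝕜 := ℝ) hsub
  rw [convexHull_neg] at this
  exact this (Set.neg_mem_neg.mpr hh)

theorem self_mem_clarkeSubdifferential_half_norm_sq :
    x ∈ clarkeSubdifferential (fun w : EuclideanSpace ℝ (Fin d) => (1 / 2 : ℝ) * ‖w‖ ^ 2) x := by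
  have h : HasGradientAt (fun w : EuclideanSpace ℝ (Fin d) => (1 / 2 : ℝ) * ‖w‖ ^ 2) x x := by
    rw [hasGradientAt_iff_hasFDerivAt]
    have := (hasStrictFDerivAt_norm_sq x).hasFDerivAt.const_mul (1 / 2 : ℝ)
    refine this.congr_fderiv ?_
    ext w
    simp
  have := gradient_mem_clarkeSubdifferential h.differentiableAt
  rwa [h.gradient] at this

end Homogeneous

theorem LipschitzNear.continuousAt {E F : Type*} [PseudoEMetricSpace E] [PseudoEMetricSpace F]
    {f : E → F} {x : E} (hf : LipschitzNear f x) : ContinuousAt f x := by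
  obtain ⟨K, s, hs, hK⟩ := hf
  exact hK.continuousOn.continuousAt hs

/-- With `b` the cosine of the angle, the hypothesis reads `1 ≤ (1 + c) b²`. As `b² ≤ b ≤ 1`, this
gives `1 - b ≤ c`, and the squared distance of the unit vectors is `2 - 2b`. -/
theorem norm_normalize_sub_sq_le {E : Type*} [NormedAddCommGroup E] [InnerProductSpace ℝ E]
    {v w : E} {c : ℝ} (hc : 0 ≤ c) (hpos : 0 < inner ℝ v w)
    (h : ‖v‖ ^ 2 * ‖w‖ ^ 2 ≤ (1 + c) * inner ℝ v w ^ 2) :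
    ‖‖v‖⁻¹ • v - ‖w‖⁻¹ • w‖ ^ 2 ≤ 2 * c := by
  have hv : 0 < ‖v‖ := norm_pos_iff.mpr (by rintro rfl; simp at hpos)
  have hw : 0 < ‖w‖ := norm_pos_iff.mpr (by rintro rfl; simp at hpos)
  set b : ℝ := inner ℝ v w / (‖v‖ * ‖w‖) with hb
  have hb0 : 0 < b := by positivity
  have hb1 : b ≤ 1 := (div_le_one (by positivity)).mpr (real_inner_le_norm v w)
  have hbc : 1 ≤ (1 + c) * b ^ 2 := by
    rw [hb, div_pow, mul_div_assoc', le_div_iff₀ (by positivity)]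
    linarith
  have hn1 : ‖‖v‖⁻¹ • v‖ = 1 := by rw [norm_smul, norm_inv, norm_norm, inv_mul_cancel₀ hv.ne']
  have hn2 : ‖‖w‖⁻¹ • w‖ = 1 := by rw [norm_smul, norm_inv, norm_norm, inv_mul_cancel₀ hw.ne']
  have hin : inner ℝ (‖v‖⁻¹ • v) (‖w‖⁻¹ • w) = b := by
    rw [real_inner_smul_left, real_inner_smul_right, hb]
    field_simp
  have h1 : b ^ 2 ≤ b := by nlinarith
  have h2 : 1 ≤ b + c * b := by nlinarith [mul_le_mul_of_nonneg_left h1 (by linarith : 0 ≤ 1 + c)]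
  have h3 : c * b ≤ c := mul_le_of_le_one_right hc hb1
  rw [norm_sub_sq_real, hn1, hn2, hin]
  linarith

/-! ### From almost radial gradients to KKT points. -/

section KKT

variable {d N : ℕ} {q : Fin N → EuclideanSpace ℝ (Fin d) → ℝ} {L : ℝ}

theorem inner_sum_exp_smul {w : EuclideanSpace ℝ (Fin d)}
    {h : Fin N → EuclideanSpace ℝ (Fin d)} (hh : ∀ n, inner ℝ (h n) w = L * q n w) :
    inner ℝ (∑ n, Real.exp (-q n w) • h n) w = L * ∑ n, Real.exp (-q n w) * q n w := by
  simp_rw [sum_inner, real_inner_smul_left, hh, Finset.mul_sum]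
  exact Finset.sum_congr rfl fun n _ => by ring

theorem mul_exp_neg_mul_le_inner (hL : 0 < L) {w : EuclideanSpace ℝ (Fin d)}
    (hq : ∀ n, 0 ≤ q n w) {h : Fin N → EuclideanSpace ℝ (Fin d)}
    (hh : ∀ n, inner ℝ (h n) w = L * q n w) (m : Fin N) :
    L * (Real.exp (-q m w) * q m w) ≤ inner ℝ (∑ n, Real.exp (-q n w) • h n) w := by
  rw [inner_sum_exp_smul hh]
  gcongr
  exact Finset.single_le_sum (f := fun n => Real.exp (-q n w) * q n w)
    (fun n _ => mul_nonneg (Real.exp_pos _).le (hq n)) (Finset.mem_univ m)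

/-- If the normalized iterates and the normalized negative loss gradients share the limit `θ`
while all margins diverge at the rate of the norm, then `θ` is along a KKT direction. -/
theorem exists_isKKTPoint_smul_of_tendsto (hN : 0 < N) (hL : 0 < L)
    (hom : ∀ n θ α, 0 < α → q n (α • θ) = α ^ L * q n θ)
    (hlip : ∀ n x, x ≠ 0 → LipschitzNear (q n) x) {γ : ℝ} (hγ : 0 < γ)
    {w v : ℕ → EuclideanSpace ℝ (Fin d)} {h : ℕ → Fin N → EuclideanSpace ℝ (Fin d)}
    {θ : EuclideanSpace ℝ (Fin d)} (hw : ∀ k, w k ≠ 0)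
    (hh : ∀ k n, h k n ∈ clarkeSubdifferential (q n) (w k))
    (hv : ∀ k, v k = ∑ n, Real.exp (-q n (w k)) • h k n)
    (hmargin : ∀ k n, γ * ‖w k‖ ^ L ≤ q n (w k))
    (hinf : ∀ n, Tendsto (fun k => q n (w k)) atTop atTop)
    (hdir : Tendsto (fun k => ‖w k‖⁻¹ • w k) atTop (𝓝 θ))
    (hgrad : Tendsto (fun k => ‖v k‖⁻¹ • v k) atTop (𝓝 θ)) :
    ∃ α : ℝ, 0 < α ∧
      IsKKTPoint (fun w => (1 / 2 : ℝ) * ‖w‖ ^ 2) (fun n w => 1 - q n w) (α • θ) := by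
  have hr : ∀ k, 0 < ‖w k‖ := fun k => norm_pos_iff.mpr (hw k)
  have hθ : θ ≠ 0 := by
    have h1 : Tendsto (fun k => ‖‖w k‖⁻¹ • w k‖) atTop (𝓝 ‖θ‖) := hdir.norm
    have h2 : ∀ k, ‖‖w k‖⁻¹ • w k‖ = 1 := fun k => by
      rw [norm_smul, norm_inv, norm_norm, inv_mul_cancel₀ (hr k).ne']
    simp_rw [h2] at h1
    have := tendsto_nhds_unique h1 tendsto_const_nhds
    exact norm_pos_iff.mp (by rw [this]; exact one_pos)
  have hqpos : ∀ k n, 0 < q n (w k) := fun k n =>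
    lt_of_lt_of_le (mul_pos hγ (Real.rpow_pos_of_pos (hr k) _)) (hmargin k n)
  have heuler : ∀ k n, inner ℝ (h k n) (w k) = L * q n (w k) := fun k n =>
    inner_self_of_mem_clarkeSubdifferential (hom n) (hlip n _ (hw k)).continuousAt (hh k n)
  have hvw : ∀ k m, L * (Real.exp (-q m (w k)) * q m (w k)) ≤ ‖w k‖ * ‖v k‖ := fun k m => by
    refine (mul_exp_neg_mul_le_inner hL (fun n => (hqpos k n).le) (heuler k) m).trans ?_
    rw [← hv, mul_comm]
    exact real_inner_le_norm _ _
  have hvpos : ∀ k, 0 < ‖v k‖ := fun k => by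
    have h1 := hvw k ⟨0, hN⟩
    have h2 : 0 < L * (Real.exp (-q ⟨0, hN⟩ (w k)) * q ⟨0, hN⟩ (w k)) := by
      have := hqpos k ⟨0, hN⟩
      positivity
    exact pos_of_mul_pos_right (h2.trans_le h1) (hr k).le
  -- `hat` moves the subgradients to the unit sphere, using homogeneity of degree `L - 1`; the
  -- weights `σ` are chosen so that `∑ σ • hat` is the normalized gradient.
  set hat : ℕ → Fin N → EuclideanSpace ℝ (Fin d) :=
    fun k n => (‖w k‖⁻¹) ^ (L - 1) • h k n with hhat
  set σ : ℕ → Fin N → ℝ :=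
    fun k n => Real.exp (-q n (w k)) * ‖w k‖ ^ (L - 1) / ‖v k‖ with hσ
  have hhat_mem : ∀ k n, hat k n ∈ clarkeSubdifferential (q n) (‖w k‖⁻¹ • w k) := fun k n =>
    smul_mem_clarkeSubdifferential_of_homogeneous (hom n) (inv_pos.mpr (hr k)) (hh k n)
  have hσ0 : ∀ k n, 0 ≤ σ k n := fun k n => by positivity
  have hσq : ∀ k n m, σ k n * q m (‖w k‖⁻¹ • w k) =
      Real.exp (-q n (w k)) * q m (w k) / (‖w k‖ * ‖v k‖) := fun k n m => by
    rw [hom m _ _ (inv_pos.mpr (hr k)), hσ]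
    simp only
    rw [Real.inv_rpow (hr k).le, Real.rpow_sub_one (hr k).ne']
    have := (Real.rpow_pos_of_pos (hr k) L).ne'
    have := (hr k).ne'
    have := (hvpos k).ne'
    field_simp
  -- By Euler and Cauchy–Schwarz, `L e^{-q_n} q_n ≤ ‖w‖ ‖v‖`, so `σ_n` times the normalized margin
  -- is at most `1/L`; that margin is at least `γ`.
  have hσbd : ∀ k n, σ k n ≤ (L * γ)⁻¹ := fun k n => by
    have h1 : γ ≤ q n (‖w k‖⁻¹ • w k) := by
      rw [hom n _ _ (inv_pos.mpr (hr k)), Real.inv_rpow (hr k).le, inv_mul_eq_div,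
        le_div_iff₀ (Real.rpow_pos_of_pos (hr k) _)]
      exact hmargin k n
    have h2 : σ k n * γ ≤ L⁻¹ := by
      refine (mul_le_mul_of_nonneg_left h1 (hσ0 k n)).trans ?_
      rw [hσq, div_le_iff₀ (mul_pos (hr k) (hvpos k)), inv_mul_eq_div, le_div_iff₀ hL]
      linarith [hvw k n]
    rw [mul_inv, ← div_eq_mul_inv, le_div_iff₀ hγ]
    exact h2
  -- Approximate complementary slackness: `1 + x ≤ e^x` gives `e^{-q_n} (q_n - q_m) ≤ e^{-q_m}`, and
  -- dividing by `‖w‖ ‖v‖ ≥ L e^{-q_m} q_m` leaves a bound that vanishes as `q_m → ∞`.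
  have hslack : ∀ k n m, σ k n * (q n (‖w k‖⁻¹ • w k) - q m (‖w k‖⁻¹ • w k)) ≤
      (L * q m (w k))⁻¹ := fun k n m => by
    rw [mul_sub, hσq, hσq, ← sub_div, ← mul_sub]
    have h1 : Real.exp (-q n (w k)) * (q n (w k) - q m (w k)) ≤ Real.exp (-q m (w k)) := by
      have h3 : Real.exp (-q m (w k)) =
          Real.exp (-q n (w k)) * Real.exp (q n (w k) - q m (w k)) := by
        rw [← Real.exp_add]; ring_nf
      rw [h3]
      gcongr
      linarith [Real.add_one_le_exp (q n (w k) - q m (w k))]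
    have h2 := hvw k m
    have hqm := hqpos k m
    rw [div_le_iff₀ (mul_pos (hr k) (hvpos k)), inv_mul_eq_div, le_div_iff₀ (by positivity)]
    nlinarith [mul_le_mul_of_nonneg_right h1 (by positivity : 0 ≤ L * q m (w k))]
  have hsum : ∀ k, ∑ n, σ k n • hat k n = ‖v k‖⁻¹ • v k := fun k => by
    conv_rhs => rw [hv k, Finset.smul_sum]
    refine Finset.sum_congr rfl fun n _ => ?_
    rw [← hv k, hhat, hσ]
    simp only [smul_smul]
    congr 1
    rw [Real.inv_rpow (hr k).le]
    have := (Real.rpow_pos_of_pos (hr k) (L - 1)).ne'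
    field_simp
  -- extract convergent multipliers and subgradients
  choose K s hs hK using fun n => hlip n θ hθ
  have hcompact : IsCompact ((Set.pi univ fun _ : Fin N => Icc (0 : ℝ) (L * γ)⁻¹) ×ˢ
      (Set.pi univ fun n : Fin N => Metric.closedBall (0 : EuclideanSpace ℝ (Fin d)) (K n))) :=
    (isCompact_univ_pi fun _ => isCompact_Icc).prod
      (isCompact_univ_pi fun n => isCompact_closedBall _ _)
  have hev : ∀ᶠ k in atTop, (σ k, hat k) ∈ ((Set.pi univ fun _ : Fin N => Icc (0 : ℝ) (L * γ)⁻¹) ×ˢ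
      (Set.pi univ fun n : Fin N => Metric.closedBall (0 : EuclideanSpace ℝ (Fin d)) (K n))) := by
    have h1 : ∀ᶠ k in atTop, ∀ n, s n ∈ 𝓝 (‖w k‖⁻¹ • w k) := eventually_all.mpr fun n =>
      hdir.eventually (eventually_mem_nhds_iff.mpr (hs n))
    filter_upwards [h1] with k hk
    exact ⟨fun n _ => ⟨hσ0 k n, hσbd k n⟩, fun n _ => mem_closedBall_zero_iff.mpr
      (norm_le_of_mem_clarkeSubdifferential (hk n) (hK n) (hhat_mem k n))⟩
  obtain ⟨⟨τ, g⟩, hτg, φ, hφ, hlim⟩ := hcompact.tendsto_subseq' hev.frequently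
  have hφt := hφ.tendsto_atTop
  rw [nhds_prod_eq, tendsto_prod_iff'] at hlim
  have hτlim : ∀ n, Tendsto (fun k => σ (φ k) n) atTop (𝓝 (τ n)) :=
    tendsto_pi_nhds.mp hlim.1
  have hglim : ∀ n, Tendsto (fun k => hat (φ k) n) atTop (𝓝 (g n)) :=
    tendsto_pi_nhds.mp hlim.2
  have hdirφ : Tendsto (fun k => ‖w (φ k)‖⁻¹ • w (φ k)) atTop (𝓝 θ) := hdir.comp hφt
  have hgmem : ∀ n, g n ∈ clarkeSubdifferential (q n) θ := fun n =>
    mem_clarkeSubdifferential_of_tendsto (hlip n θ hθ) hdirφ (fun k => hhat_mem (φ k) n) (hglim n)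
  have hτ0 : ∀ n, 0 ≤ τ n := fun n => (hτg.1 n (mem_univ n)).1
  have hτsum : ∑ n, τ n • g n = θ := by
    have h1 : Tendsto (fun k => ∑ n, σ (φ k) n • hat (φ k) n) atTop (𝓝 (∑ n, τ n • g n)) :=
      tendsto_finsetSum _ fun n _ => (hτlim n).smul (hglim n)
    simp_rw [hsum] at h1
    exact tendsto_nhds_unique h1 (hgrad.comp hφt)
  have hqlim : ∀ n, Tendsto (fun k => q n (‖w (φ k)‖⁻¹ • w (φ k))) atTop (𝓝 (q n θ)) := fun n =>
    (hlip n θ hθ).continuousAt.tendsto.comp hdirφ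
  have hτslack : ∀ n m, τ n * (q n θ - q m θ) ≤ 0 := fun n m => by
    have h1 : Tendsto (fun k => (L * q m (w (φ k)))⁻¹) atTop (𝓝 0) :=
      (((hinf m).comp hφt).const_mul_atTop hL).inv_tendsto_atTop
    exact le_of_tendsto_of_tendsto ((hτlim n).mul ((hqlim n).sub (hqlim m))) h1
      (Eventually.of_forall fun k => hslack (φ k) n m)
  have hqθ : ∀ n, γ ≤ q n θ := fun n => by
    refine ge_of_tendsto (hqlim n) (Eventually.of_forall fun k => ?_)
    rw [hom n _ _ (inv_pos.mpr (hr _)), Real.inv_rpow (hr _).le, inv_mul_eq_div,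
      le_div_iff₀ (Real.rpow_pos_of_pos (hr _) _)]
    exact hmargin _ n
  have : Nonempty (Fin N) := ⟨⟨0, hN⟩⟩
  obtain ⟨m, hm⟩ := Finite.exists_min fun n => q n θ
  have hp : 0 < q m θ := hγ.trans_le (hqθ m)
  -- This scale makes the smallest margin equal to `1`. The multipliers carry `α ^ (2 - L)` because
  -- subgradients at `α • θ` scale by `α ^ (L - 1)` and the sum must be `α • θ`.
  set α : ℝ := q m θ ^ (-L⁻¹) with hα
  have hα0 : 0 < α := Real.rpow_pos_of_pos hp _
  have hαL : α ^ L = (q m θ)⁻¹ := by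
    rw [hα, ← Real.rpow_mul hp.le, neg_mul, inv_mul_cancel₀ hL.ne', Real.rpow_neg_one]
  have hqα : ∀ n, q n (α • θ) = q n θ / q m θ := fun n => by
    rw [hom n _ _ hα0, hαL, inv_mul_eq_div]
  refine ⟨α, hα0, fun n => ?_, fun n => α ^ (2 - L) * τ n,
    fun n => mul_nonneg (Real.rpow_nonneg hα0.le _) (hτ0 n),
    ⟨α • θ, self_mem_clarkeSubdifferential_half_norm_sq, fun n => -(α ^ (L - 1) • g n),
      fun n => neg_mem_clarkeSubdifferential_const_sub
        (smul_mem_clarkeSubdifferential_of_homogeneous (hom n) hα0 (hgmem n)), ?_⟩, fun n => ?_⟩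
  · simp only [hqα, sub_nonpos]
    exact (one_le_div hp).mpr (hm n)
  · have hpow : α ^ (2 - L) * α ^ (L - 1) = α := by
      rw [← Real.rpow_add hα0]; norm_num
    have : ∀ n, (α ^ (2 - L) * τ n) • -(α ^ (L - 1) • g n) = -(α • (τ n • g n)) := fun n => by
      rw [smul_neg, smul_smul, smul_smul]
      congr 2
      rw [mul_right_comm, hpow]
    simp_rw [this, Finset.sum_neg_distrib, ← Finset.smul_sum, hτsum, add_neg_cancel]
  · have h1 : τ n * (q n θ - q m θ) = 0 :=
      le_antisymm (hτslack n m) (mul_nonneg (hτ0 n) (sub_nonneg.mpr (hm n)))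
    simp only [hqα]
    have h2 : α ^ (2 - L) * τ n * (1 - q n θ / q m θ) =
        -(α ^ (2 - L) * (τ n * (q n θ - q m θ)) / q m θ) := by
      field_simp
      ring
    rw [h2, h1]; simp

end KKT

/-! ### Pointwise estimates for the loss and its negative subgradients. -/

section Pointwise

variable {d N : ℕ} {q : Fin N → EuclideanSpace ℝ (Fin d) → ℝ} {L : ℝ}

/-- The exponential loss of a family of margins. -/
noncomputable def expSum (q : Fin N → EuclideanSpace ℝ (Fin d) → ℝ) (w : EuclideanSpace ℝ (Fin d)) : ℝ :=
  ∑ n, Real.exp (-q n w)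

/-- `v` is the negative of a subgradient of `expSum q` at `w` built from Clarke subgradients of the
margins. -/
def IsNegLossGradient (q : Fin N → EuclideanSpace ℝ (Fin d) → ℝ)
    (w v : EuclideanSpace ℝ (Fin d)) : Prop :=
  ∃ h : Fin N → EuclideanSpace ℝ (Fin d), (∀ n, h n ∈ clarkeSubdifferential (q n) w) ∧
    v = ∑ n, Real.exp (-q n w) • h n

theorem expSum_pos (hN : 0 < N) (w : EuclideanSpace ℝ (Fin d)) : 0 < expSum q w :=
  Finset.sum_pos (fun _ _ => Real.exp_pos _) ⟨⟨0, hN⟩, Finset.mem_univ _⟩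

/-- A single term is at most the whole sum. This is the soft-minimum property behind every lower
bound on the margins. -/
theorem neg_log_expSum_le (hN : 0 < N) (w : EuclideanSpace ℝ (Fin d)) (m : Fin N) :
    -Real.log (expSum q w) ≤ q m w := by
  have h1 : Real.exp (-q m w) ≤ expSum q w :=
    Finset.single_le_sum (f := fun n => Real.exp (-q n w)) (fun n _ => (Real.exp_pos _).le)
      (Finset.mem_univ m)
  have h2 := (Real.le_log_iff_exp_le (expSum_pos hN w)).mpr h1
  linarith

theorem neg_log_expSum_pos (hN : 0 < N) {w : EuclideanSpace ℝ (Fin d)} (hw : expSum q w < 1) :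
    0 < -Real.log (expSum q w) :=
  neg_pos.mpr (Real.log_neg (expSum_pos hN w) hw)

/-- Homogeneity with `α = 2` forces `q_n(0) = 2^L q_n(0)`, impossible for a positive margin. -/
theorem ne_zero_of_expSum_lt_one (hN : 0 < N) (hL : 0 < L)
    (hom : ∀ n θ α, 0 < α → q n (α • θ) = α ^ L * q n θ)
    {w : EuclideanSpace ℝ (Fin d)} (hw : expSum q w < 1) : w ≠ 0 := by
  rintro rfl
  have h1 := hom ⟨0, hN⟩ 0 2 two_pos
  have h2 := (neg_log_expSum_pos hN hw).trans_le (neg_log_expSum_le hN 0 ⟨0, hN⟩)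
  rw [smul_zero] at h1
  have h3 : (1 : ℝ) < 2 ^ L := Real.one_lt_rpow one_lt_two hL
  nlinarith

theorem mul_neg_log_expSum_le (hN : 0 < N) (w : EuclideanSpace ℝ (Fin d)) :
    expSum q w * -Real.log (expSum q w) ≤ ∑ n, Real.exp (-q n w) * q n w := by
  conv_lhs => rw [expSum, Finset.sum_mul]
  refine Finset.sum_le_sum fun n _ => mul_le_mul_of_nonneg_left ?_ (Real.exp_pos _).le
  exact neg_log_expSum_le hN w n

theorem IsNegLossGradient.inner_self {w v : EuclideanSpace ℝ (Fin d)}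
    (hom : ∀ n θ α, 0 < α → q n (α • θ) = α ^ L * q n θ) (hc : ∀ n, ContinuousAt (q n) w)
    (hv : IsNegLossGradient q w v) :
    inner ℝ v w = L * ∑ n, Real.exp (-q n w) * q n w := by
  obtain ⟨h, hh, rfl⟩ := hv
  exact inner_sum_exp_smul fun n => inner_self_of_mem_clarkeSubdifferential (hom n) (hc n) (hh n)

/-- Euler's identity bounds the radial component of the negative gradient from below; this drives
both the decay of the loss and the growth of the norm. -/
theorem IsNegLossGradient.le_inner (hN : 0 < N) (hL : 0 < L) {w v : EuclideanSpace ℝ (Fin d)}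
    (hom : ∀ n θ α, 0 < α → q n (α • θ) = α ^ L * q n θ) (hc : ∀ n, ContinuousAt (q n) w)
    (hv : IsNegLossGradient q w v) :
    L * (expSum q w * -Real.log (expSum q w)) ≤ inner ℝ v w := by
  rw [hv.inner_self hom hc]
  exact mul_le_mul_of_nonneg_left (mul_neg_log_expSum_le hN w) hL.le

theorem IsNegLossGradient.inner_pos (hN : 0 < N) (hL : 0 < L) {w v : EuclideanSpace ℝ (Fin d)}
    (hom : ∀ n θ α, 0 < α → q n (α • θ) = α ^ L * q n θ) (hc : ∀ n, ContinuousAt (q n) w)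
    (hw : expSum q w < 1) (hv : IsNegLossGradient q w v) : 0 < inner ℝ v w :=
  (mul_pos hL (mul_pos (expSum_pos hN w) (neg_log_expSum_pos hN hw))).trans_le
    (hv.le_inner hN hL hom hc)

theorem norm_le_of_mem_clarkeSubdifferential_of_homogeneous {B : ℝ}
    {f : EuclideanSpace ℝ (Fin d) → ℝ} (hom : ∀ θ α, 0 < α → f (α • θ) = α ^ L * f θ)
    (hB : ∀ u, ‖u‖ = 1 → ∀ h ∈ clarkeSubdifferential f u, ‖h‖ ≤ B)
    {w h : EuclideanSpace ℝ (Fin d)} (hw : w ≠ 0) (hh : h ∈ clarkeSubdifferential f w) :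
    ‖h‖ ≤ B * ‖w‖ ^ (L - 1) := by
  have hr : 0 < ‖w‖ := norm_pos_iff.mpr hw
  have h1 := hB (‖w‖⁻¹ • w) (by rw [norm_smul, norm_inv, norm_norm, inv_mul_cancel₀ hr.ne']) _
    (smul_mem_clarkeSubdifferential_of_homogeneous hom (inv_pos.mpr hr) hh)
  rw [norm_smul, Real.norm_of_nonneg (Real.rpow_nonneg (inv_pos.mpr hr).le _),
    Real.inv_rpow hr.le, inv_mul_eq_div, div_le_iff₀ (Real.rpow_pos_of_pos hr _)] at h1
  exact h1

theorem IsNegLossGradient.norm_le {B : ℝ}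
    (hom : ∀ n θ α, 0 < α → q n (α • θ) = α ^ L * q n θ)
    (hB : ∀ n u, ‖u‖ = 1 → ∀ h ∈ clarkeSubdifferential (q n) u, ‖h‖ ≤ B)
    {w v : EuclideanSpace ℝ (Fin d)} (hw : w ≠ 0) (hv : IsNegLossGradient q w v) :
    ‖v‖ ≤ expSum q w * (B * ‖w‖ ^ (L - 1)) := by
  obtain ⟨h, hh, rfl⟩ := hv
  refine (norm_sum_le _ _).trans ?_
  rw [expSum, Finset.sum_mul]
  refine Finset.sum_le_sum fun n _ => ?_
  rw [norm_smul, Real.norm_of_nonneg (Real.exp_pos _).le]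
  exact mul_le_mul_of_nonneg_left
    (norm_le_of_mem_clarkeSubdifferential_of_homogeneous (hom n) (hB n) hw (hh n))
    (Real.exp_pos _).le

theorem le_mul_norm_rpow_of_homogeneous {B : ℝ} {f : EuclideanSpace ℝ (Fin d) → ℝ}
    (hom : ∀ θ α, 0 < α → f (α • θ) = α ^ L * f θ) (hB : ∀ u, ‖u‖ = 1 → f u ≤ B)
    {w : EuclideanSpace ℝ (Fin d)} (hw : w ≠ 0) : f w ≤ B * ‖w‖ ^ L := by
  have hr : 0 < ‖w‖ := norm_pos_iff.mpr hw
  have h1 := hB (‖w‖⁻¹ • w) (by rw [norm_smul, norm_inv, norm_norm, inv_mul_cancel₀ hr.ne'])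
  rwa [hom _ _ (inv_pos.mpr hr), Real.inv_rpow hr.le, inv_mul_eq_div,
    div_le_iff₀ (Real.rpow_pos_of_pos hr _)] at h1

/-- A criterion for all limit directions to be along KKT directions: near each late iterate there
is, up to scaling, a point with large margins whose loss gradient is almost radial. -/
theorem exists_isKKTPoint_smul_of_mapClusterPt {ι : Type*} {l : Filter ι} (hN : 0 < N) (hL : 0 < L)
    (hom : ∀ n θ α, 0 < α → q n (α • θ) = α ^ L * q n θ)
    (hlip : ∀ n x, x ≠ 0 → LipschitzNear (q n) x) {γ : ℝ} (hγ : 0 < γ)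
    {z : ι → EuclideanSpace ℝ (Fin d)}
    (H : ∀ ε > 0, ∀ᶠ t in l, ∃ w v, w ≠ 0 ∧ IsNegLossGradient q w v ∧
      (∀ n, γ * ‖w‖ ^ L ≤ q n w) ∧ (∀ n, ε⁻¹ ≤ q n w) ∧
      ‖‖w‖⁻¹ • w - ‖z t‖⁻¹ • z t‖ ≤ ε ∧ ‖‖v‖⁻¹ • v - ‖w‖⁻¹ • w‖ ≤ ε)
    {θ : EuclideanSpace ℝ (Fin d)} (hθ : MapClusterPt θ l fun t => ‖z t‖⁻¹ • z t) :
    ∃ α : ℝ, 0 < α ∧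
      IsKKTPoint (fun w => (1 / 2 : ℝ) * ‖w‖ ^ 2) (fun n w => 1 - q n w) (α • θ) := by
  have hex : ∀ k : ℕ, ∃ w v, w ≠ 0 ∧ IsNegLossGradient q w v ∧
      (∀ n, γ * ‖w‖ ^ L ≤ q n w) ∧ (∀ n, (k : ℝ) + 1 ≤ q n w) ∧
      ‖‖w‖⁻¹ • w - θ‖ ≤ 2 * ((k : ℝ) + 1)⁻¹ ∧ ‖‖v‖⁻¹ • v - ‖w‖⁻¹ • w‖ ≤ ((k : ℝ) + 1)⁻¹ := by
    intro k
    have hk : (0 : ℝ) < ((k : ℝ) + 1)⁻¹ := by positivity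
    obtain ⟨t, ht, w, v, hw, hv, h1, h2, h3, h4⟩ :=
      ((hθ.frequently (Metric.ball_mem_nhds θ hk)).and_eventually (H _ hk)).exists
    refine ⟨w, v, hw, hv, h1, by simpa using h2, ?_, h4⟩
    rw [dist_eq_norm] at ht
    calc ‖‖w‖⁻¹ • w - θ‖ = ‖(‖w‖⁻¹ • w - ‖z t‖⁻¹ • z t) + (‖z t‖⁻¹ • z t - θ)‖ := by
          rw [sub_add_sub_cancel]
      _ ≤ _ := (norm_add_le _ _).trans (by linarith)
  choose w v hw hv h1 h2 h3 h4 using hex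
  choose h hh hvh using hv
  have hlim : Tendsto (fun k : ℕ => ((k : ℝ) + 1)⁻¹) atTop (𝓝 0) := by
    simpa [one_div] using tendsto_one_div_add_atTop_nhds_zero_nat (𝕜 := ℝ)
  have hdir : Tendsto (fun k => ‖w k‖⁻¹ • w k) atTop (𝓝 θ) := by
    rw [tendsto_iff_norm_sub_tendsto_zero]
    exact squeeze_zero (fun _ => norm_nonneg _) h3 (by simpa using hlim.const_mul 2)
  have hgrad : Tendsto (fun k => ‖v k‖⁻¹ • v k) atTop (𝓝 θ) := by
    have hd : Tendsto (fun k => ‖v k‖⁻¹ • v k - ‖w k‖⁻¹ • w k) atTop (𝓝 0) :=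
      squeeze_zero_norm h4 hlim
    simpa using hd.add hdir
  refine exists_isKKTPoint_smul_of_tendsto hN hL hom hlip hγ hw hh hvh h1 (fun n => ?_) hdir hgrad
  refine tendsto_atTop_mono (fun k => h2 k n) ?_
  exact tendsto_atTop_add_const_right _ _ tendsto_natCast_atTop_atTop

/-- Increments of a bounded monotone function are eventually small. -/
theorem exists_forall_sub_lt_of_monotoneOn_Ici {ι : Type*} [LinearOrder ι] {g : ι → ℝ} {a : ι}
    {M : ℝ} (hg : MonotoneOn g (Ici a)) (hM : ∀ t, a ≤ t → g t ≤ M) {ε : ℝ} (hε : 0 < ε) :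
    ∃ T, a ≤ T ∧ ∀ t s, T ≤ t → t ≤ s → g s - g t < ε := by
  have hbdd : BddAbove (g '' Ici a) := ⟨M, by rintro _ ⟨t, ht, rfl⟩; exact hM t ht⟩
  obtain ⟨_, ⟨T, hT, rfl⟩, hlt⟩ := exists_lt_of_lt_csSup ((nonempty_Ici (a := a)).image g)
    (sub_lt_self (sSup (g '' Ici a)) hε)
  refine ⟨T, hT, fun t s ht hs => ?_⟩
  have h1 : g T ≤ g t := hg hT (le_trans hT ht) ht
  have h2 : g s ≤ sSup (g '' Ici a) :=
    le_csSup hbdd (mem_image_of_mem g (le_trans (le_trans hT ht) hs : a ≤ s))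
  linarith

/-- The growth of the logarithm of the smoothed margin dominates that of the parameter norm. -/
theorem mul_div_le_div_of_le {S l p V R c : ℝ} (hL : 0 < L) (hS : 0 < S) (hl : 0 < l) (hR : 0 < R)
    (hp : L * (S * l) ≤ p) (hc : (1 + c) * p ^ 2 ≤ V * R) (hc0 : 0 ≤ c) :
    L * ((1 + c) * (p / R)) ≤ V / (S * l) := by
  -- Here `S` is the loss, `l = -log S`, `p = ⟨v, w⟩`, `V = ‖v‖²` and `R = ‖w‖²`. One factor `p` in
  -- `p²` is replaced by its lower bound `L S l`.
  have hp0 : 0 < p := (by positivity : 0 < L * (S * l)).trans_le hp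
  rw [le_div_iff₀ (mul_pos hS hl)]
  have h1 : (1 + c) * (p / R) * p ≤ V := by
    rw [mul_div_assoc', div_mul_eq_mul_div, div_le_iff₀ hR]
    linarith
  have h2 : 0 ≤ (1 + c) * (p / R) := by positivity
  nlinarith [mul_le_mul_of_nonneg_left hp h2]

end Pointwise

/-! ### Gradient flow -/

theorem AbsolutelyContinuousOnInterval.finset_sum {ι : Type*} {F : Type*} [NormedAddCommGroup F]
    (s : Finset ι) {f : ι → ℝ → F} {a b : ℝ}
    (hf : ∀ i ∈ s, AbsolutelyContinuousOnInterval (f i) a b) :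
    AbsolutelyContinuousOnInterval (fun t => ∑ i ∈ s, f i t) a b := by
  classical
  induction s using Finset.induction_on with
  | empty =>
    simpa using ((LipschitzWith.const (0 : F)).lipschitzOnWith
      (s := uIcc a b)).absolutelyContinuousOnInterval
  | insert i s hi ih =>
    simp_rw [Finset.sum_insert hi]
    exact (hf i (Finset.mem_insert_self i s)).fun_add
      (ih fun j hj => hf j (Finset.mem_insert_of_mem hj))

theorem locallyLipschitzOn_of_contDiffAt {E F : Type*} [NormedAddCommGroup E] [NormedSpace ℝ E]
    [NormedAddCommGroup F] [NormedSpace ℝ F] {f : E → F} {U : Set E}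
    (hf : ∀ x ∈ U, ContDiffAt ℝ 1 f x) : LocallyLipschitzOn U f := by
  intro x hx
  obtain ⟨K, t, ht, hK⟩ := (hf x hx).exists_lipschitzOnWith
  exact ⟨K, t, nhdsWithin_le_nhds ht, hK⟩

theorem AdmitsChainRule.neg {d : ℕ} {f : EuclideanSpace ℝ (Fin d) → ℝ} (hf : AdmitsChainRule f) :
    AdmitsChainRule (fun θ => -f θ) := by
  intro z hz
  filter_upwards [hf z hz] with t ht
  obtain ⟨v, hv, h⟩ := ht
  refine ⟨v, hv, fun g hg => ?_⟩
  have h1 := neg_mem_clarkeSubdifferential_const_sub (c := 0) hg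
  simp only [zero_sub, neg_neg] at h1
  have h2 := (h _ h1).fun_neg
  rwa [inner_neg_left, neg_neg] at h2

section GradientFlow

variable {d N : ℕ} {q : Fin N → EuclideanSpace ℝ (Fin d) → ℝ} {L : ℝ}
  {z : ℝ → EuclideanSpace ℝ (Fin d)}

/-- The times at which the flow has a velocity made of subgradients that satisfy the chain rule. -/
def IsRegularTime (q : Fin N → EuclideanSpace ℝ (Fin d) → ℝ) (z : ℝ → EuclideanSpace ℝ (Fin d))
    (t : ℝ) (v : EuclideanSpace ℝ (Fin d)) : Prop :=
  HasDerivAt z v t ∧ IsNegLossGradient q (z t) v ∧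
    HasDerivAt (fun s => expSum q (z s)) (-‖v‖ ^ 2) t

/-- The chain rule holds for all subgradients at once, so it applies to the very `h n` that make up
the velocity `v`. Summing gives the derivative `-∑ e^{-q_n} ⟨h_n, v⟩ = -‖v‖²` of the loss. -/
theorem ae_isRegularTime (hq : ∀ n, LocallyLipschitz (q n)) (hc : ∀ n, AdmitsChainRule (q n))
    (hz : IsGradientFlow (expSum q) z) : ∀ᵐ t, 0 < t → ∃ v, IsRegularTime q z t v := by
  have h1 := hz.2
  rw [ae_restrict_iff' measurableSet_Ici] at h1
  have h2 : ∀ᵐ t, ∀ n, t ∈ Ioi (0 : ℝ) → ∃ v, HasDerivAt z v t ∧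
      ∀ h ∈ clarkeSubdifferential (q n) (z t), HasDerivAt (fun s => q n (z s)) (inner ℝ h v) t :=
    ae_all_iff.mpr fun n => (ae_restrict_iff' measurableSet_Ioi).mp (hc n z hz.1)
  filter_upwards [h1, h2] with t ht1 ht2 ht
  obtain ⟨v, hv, hmem⟩ := ht1 ht.le
  obtain ⟨h, hh, hsum⟩ := exists_eq_neg_sum_exp_smul_of_mem_clarkeSubdifferential hq hmem
  rw [neg_inj] at hsum
  refine ⟨v, hv, ⟨h, hh, hsum⟩, ?_⟩
  have hd : ∀ n, HasDerivAt (fun s => q n (z s)) (inner ℝ (h n) v) t := fun n => by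
    obtain ⟨v', hv', hall⟩ := ht2 n ht
    rw [hv.unique hv']
    exact hall _ (hh n)
  have h3 : HasDerivAt (fun s => expSum q (z s))
      (∑ n, Real.exp (-q n (z t)) * -inner ℝ (h n) v) t :=
    HasDerivAt.fun_sum fun n _ => (hd n).neg.exp
  convert h3 using 1
  rw [← real_inner_self_eq_norm_sq]
  conv_lhs => rw [hsum, sum_inner, ← hsum]
  simp_rw [real_inner_smul_left, mul_neg, Finset.sum_neg_distrib]

theorem absolutelyContinuousOnInterval_expSum (hq : ∀ n, LocallyLipschitz (q n)) (hz : IsArc z)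
    {a b : ℝ} (ha : 0 ≤ a) (hab : a ≤ b) :
    AbsolutelyContinuousOnInterval (fun t => expSum q (z t)) a b := by
  refine AbsolutelyContinuousOnInterval.finset_sum _ fun n _ => ?_
  have h1 : AbsolutelyContinuousOnInterval (fun t => q n (z t)) a b :=
    (hz a b ha hab).locallyLipschitzOn_comp (U := univ) (hq n).locallyLipschitzOn
      fun _ _ => mem_univ _
  exact h1.locallyLipschitzOn_comp (U := univ) (F := fun s => Real.exp (-s))
    (locallyLipschitzOn_of_contDiffAt fun s _ => by fun_prop) fun _ _ => mem_univ _

theorem antitoneOn_expSum (hq : ∀ n, LocallyLipschitz (q n)) (hc : ∀ n, AdmitsChainRule (q n))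
    (hz : IsGradientFlow (expSum q) z) : AntitoneOn (fun t => expSum q (z t)) (Ici 0) := by
  intro a ha b hb hab
  have h1 := AbsolutelyContinuousOnInterval.le_of_ae_hasDerivAt_nonneg hab
    (absolutelyContinuousOnInterval_expSum hq hz.1 ha hab).fun_neg (by
      filter_upwards [ae_isRegularTime hq hc hz] with t ht htm
      obtain ⟨v, hv⟩ := ht (lt_of_le_of_lt ha htm.1)
      exact ⟨_, by simp only [neg_neg]; positivity, hv.2.2.fun_neg⟩)
  simpa using h1

/-- The logarithm of the norm. -/
noncomputable def logNorm (w : EuclideanSpace ℝ (Fin d)) : ℝ := Real.log (‖w‖ ^ 2) / 2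

/-- The definition uses the squared norm because that is smooth. -/
theorem logNorm_eq (w : EuclideanSpace ℝ (Fin d)) : logNorm w = Real.log ‖w‖ := by
  rw [logNorm, Real.log_pow]; push_cast; ring

theorem hasDerivAt_logNorm {t : ℝ} {v : EuclideanSpace ℝ (Fin d)} (hv : HasDerivAt z v t)
    (hzt : z t ≠ 0) : HasDerivAt (fun s => logNorm (z s)) (inner ℝ v (z t) / ‖z t‖ ^ 2) t := by
  have h := (hv.norm_sq.log (by simpa using hzt)).div_const 2
  refine h.congr_deriv ?_
  rw [real_inner_comm]
  ring

theorem locallyLipschitzOn_logNorm :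
    LocallyLipschitzOn {0}ᶜ (logNorm : EuclideanSpace ℝ (Fin d) → ℝ) :=
  locallyLipschitzOn_of_contDiffAt fun w hw =>
    (((contDiff_norm_sq ℝ).contDiffAt).log (by simpa using hw)).div_const 2

/-- The direction turns at speed at most `2 ‖v‖ / ‖z‖`. Testing against a fixed `e` keeps the later
integration scalar. -/
theorem hasDerivAt_inner_normalize {t : ℝ} {v e : EuclideanSpace ℝ (Fin d)}
    (hv : HasDerivAt z v t) (hzt : z t ≠ 0) :
    ∃ y : ℝ, |y| ≤ ‖e‖ * (2 * (‖v‖ / ‖z t‖)) ∧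
      HasDerivAt (fun s => inner ℝ e (‖z s‖⁻¹ • z s)) y t := by
  have hr : 0 < ‖z t‖ := norm_pos_iff.mpr hzt
  have h1 : HasDerivAt (fun s => ‖z s‖) (inner ℝ (z t) v / ‖z t‖) t := by
    have h := hv.norm_sq.sqrt (by simpa using hzt)
    simp only [Real.sqrt_sq (norm_nonneg _)] at h
    convert h using 1
    field_simp
  have h2 := (HasDerivAt.fun_smul (h1.fun_inv hr.ne') hv)
  have h3 := (hasDerivAt_const t e).inner ℝ h2
  refine ⟨_, ?_, h3⟩
  rw [inner_zero_left, add_zero]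
  refine (abs_real_inner_le_norm _ _).trans
    (mul_le_mul_of_nonneg_left ((norm_add_le _ _).trans ?_) (norm_nonneg _))
  have h4 : |inner ℝ (z t) v| ≤ ‖z t‖ * ‖v‖ := abs_real_inner_le_norm _ _
  rw [norm_smul, norm_smul, norm_inv, norm_norm, Real.norm_eq_abs, abs_div, abs_neg, abs_div,
    abs_of_pos hr, abs_of_pos (pow_pos hr 2)]
  have h5 : |inner ℝ (z t) v| / ‖z t‖ / ‖z t‖ ^ 2 * ‖z t‖ ≤ ‖v‖ / ‖z t‖ := by
    rw [div_div, div_mul_eq_mul_div, div_le_div_iff₀ (by positivity) hr]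
    nlinarith [mul_le_mul_of_nonneg_right h4 (by positivity : 0 ≤ ‖z t‖ * ‖z t‖)]
  have h6 : ‖z t‖⁻¹ * ‖v‖ = ‖v‖ / ‖z t‖ := inv_mul_eq_div _ _
  rw [h6]
  linarith

theorem locallyLipschitzOn_inner_normalize (e : EuclideanSpace ℝ (Fin d)) :
    LocallyLipschitzOn {0}ᶜ (fun w : EuclideanSpace ℝ (Fin d) => (inner ℝ e (‖w‖⁻¹ • w) : ℝ)) :=
  locallyLipschitzOn_of_contDiffAt fun w hw => by
    have hw' : w ≠ 0 := hw
    exact contDiffAt_const.inner ℝ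
      (((contDiffAt_norm ℝ hw').inv (norm_ne_zero_iff.mpr hw')).smul contDiffAt_id)

/-- A Lipschitz constant near a point bounds all subgradients near it; compactness of the sphere
makes this uniform. -/
theorem exists_norm_bound_clarkeSubdifferential_sphere
    (hlip : ∀ n x, x ≠ 0 → LipschitzNear (q n) x) :
    ∃ B : ℝ, 0 ≤ B ∧ ∀ n u, ‖u‖ = 1 → ∀ h ∈ clarkeSubdifferential (q n) u, ‖h‖ ≤ B := by
  have h1 : ∀ n, ∃ B : ℝ, ∀ u ∈ Metric.sphere (0 : EuclideanSpace ℝ (Fin d)) 1,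
      ∀ h ∈ clarkeSubdifferential (q n) u, ‖h‖ ≤ B := by
    intro n
    refine (isCompact_sphere (0 : EuclideanSpace ℝ (Fin d)) 1).induction_on
      (p := fun s => ∃ B : ℝ, ∀ u ∈ s, ∀ h ∈ clarkeSubdifferential (q n) u, ‖h‖ ≤ B)
      ⟨0, by simp⟩ (fun s t hst ⟨B, hB⟩ => ⟨B, fun u hu => hB u (hst hu)⟩) ?_ ?_
    · rintro s t ⟨B, hB⟩ ⟨C, hC⟩
      refine ⟨max B C, fun u hu h hh => ?_⟩
      rcases hu with hu | hu
      · exact (hB u hu h hh).trans (le_max_left _ _)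
      · exact (hC u hu h hh).trans (le_max_right _ _)
    · intro x hx
      obtain ⟨K, s, hs, hK⟩ := hlip n x (ne_zero_of_mem_unit_sphere (⟨x, hx⟩ : Metric.sphere _ _))
      refine ⟨{u | s ∈ 𝓝 u}, nhdsWithin_le_nhds (eventually_mem_nhds_iff.mpr hs), K, ?_⟩
      exact fun u hu h hh => norm_le_of_mem_clarkeSubdifferential hu hK hh
  choose B hB using h1
  refine ⟨∑ n, |B n|, Finset.sum_nonneg fun _ _ => abs_nonneg _, fun n u hu h hh => ?_⟩
  refine (hB n u (mem_sphere_zero_iff_norm.mpr hu) h hh).trans ((le_abs_self _).trans ?_)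
  exact Finset.single_le_sum (f := fun n => |B n|) (fun _ _ => abs_nonneg _) (Finset.mem_univ n)

theorem exists_bound_sphere (hcont : ∀ n, ContinuousOn (q n) {0}ᶜ) :
    ∃ B : ℝ, 0 < B ∧ ∀ n u, ‖u‖ = 1 → q n u ≤ B := by
  have h1 : ∀ n, ∃ B : ℝ, ∀ u ∈ Metric.sphere (0 : EuclideanSpace ℝ (Fin d)) 1, ‖q n u‖ ≤ B :=
    fun n => (isCompact_sphere _ _).exists_bound_of_continuousOn ((hcont n).mono fun u hu =>
      ne_zero_of_mem_unit_sphere (⟨u, hu⟩ : Metric.sphere _ _))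
  choose B hB using h1
  have h0 : (0 : ℝ) ≤ ∑ n, |B n| := Finset.sum_nonneg fun _ _ => abs_nonneg _
  refine ⟨1 + ∑ n, |B n|, by positivity, fun n u hu => ?_⟩
  have h2 := (le_abs_self _).trans ((hB n u (mem_sphere_zero_iff_norm.mpr hu)).trans
    (le_abs_self _))
  have h3 := Finset.single_le_sum (f := fun n => |B n|) (fun _ _ => abs_nonneg _)
    (Finset.mem_univ n)
  linarith

/-- The full gradient is at most `B S ‖w‖^(L-1)`, while its inner product with `w` is at least `L γ
S ‖w‖^L`. So total motion is controlled by radial motion, that is, by the growth of `log ‖w‖`. -/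
theorem IsNegLossGradient.norm_div_le {B γ : ℝ} (hN : 0 < N) (hL : 0 < L)
    (hom : ∀ n θ α, 0 < α → q n (α • θ) = α ^ L * q n θ)
    {w v : EuclideanSpace ℝ (Fin d)} (hc : ∀ n, ContinuousAt (q n) w) (hB0 : 0 ≤ B)
    (hB : ∀ n u, ‖u‖ = 1 → ∀ h ∈ clarkeSubdifferential (q n) u, ‖h‖ ≤ B) (hγ : 0 < γ)
    (hw : w ≠ 0) (hγl : γ * ‖w‖ ^ L ≤ -Real.log (expSum q w)) (hv : IsNegLossGradient q w v) :
    ‖v‖ / ‖w‖ ≤ B / (L * γ) * (inner ℝ v w / ‖w‖ ^ 2) := by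
  have hr : 0 < ‖w‖ := norm_pos_iff.mpr hw
  have hS0 : 0 < expSum q w := expSum_pos hN w
  have hvn := hv.norm_le hom hB hw
  have h2 : L * γ * (expSum q w * ‖w‖ ^ L) ≤ inner ℝ v w := by
    refine le_trans ?_ (hv.le_inner hN hL hom hc)
    have := mul_le_mul_of_nonneg_left hγl (mul_pos hL hS0).le
    linarith
  rw [div_mul_div_comm, div_le_div_iff₀ hr (by positivity)]
  rw [Real.rpow_sub_one hr.ne'] at hvn
  have h3 : ‖v‖ * ‖w‖ ≤ B * (expSum q w * ‖w‖ ^ L) := by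
    have := mul_le_mul_of_nonneg_right hvn hr.le
    have h4 : expSum q w * (B * (‖w‖ ^ L / ‖w‖)) * ‖w‖ = B * (expSum q w * ‖w‖ ^ L) := by
      field_simp
    rwa [h4] at this
  have h7 := mul_le_mul_of_nonneg_right (mul_le_mul_of_nonneg_left h2 hB0) hr.le
  have h6 := mul_le_mul_of_nonneg_left h3 (by positivity : 0 ≤ L * γ * ‖w‖)
  calc ‖v‖ * (L * γ * ‖w‖ ^ 2) = L * γ * ‖w‖ * (‖v‖ * ‖w‖) := by ring
    _ ≤ _ := h6
    _ = B * (L * γ * (expSum q w * ‖w‖ ^ L)) * ‖w‖ := by ring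
    _ ≤ _ := h7

/-- The logarithm of the smoothed normalized margin. -/
noncomputable def logSmoothedMargin (q : Fin N → EuclideanSpace ℝ (Fin d) → ℝ) (L : ℝ)
    (w : EuclideanSpace ℝ (Fin d)) : ℝ :=
  Real.log (-Real.log (expSum q w)) - L * logNorm w

theorem exp_logSmoothedMargin (hN : 0 < N) {w : EuclideanSpace ℝ (Fin d)} (hw : w ≠ 0)
    (h1 : expSum q w < 1) :
    Real.exp (logSmoothedMargin q L w) * ‖w‖ ^ L = -Real.log (expSum q w) := by
  have hr : 0 < ‖w‖ := norm_pos_iff.mpr hw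
  rw [logSmoothedMargin, Real.exp_sub, Real.exp_log (neg_log_expSum_pos hN h1), logNorm_eq,
    mul_comm L, Real.exp_mul, Real.exp_log hr, div_mul_cancel₀]
  exact (Real.rpow_pos_of_pos hr L).ne'

variable (hN : 0 < N) (hL : 0 < L) (hom : ∀ n θ α, 0 < α → q n (α • θ) = α ^ L * q n θ)
  (hq : ∀ n, LocallyLipschitz (q n)) (hc : ∀ n, AdmitsChainRule (q n))
  (hz : IsGradientFlow (expSum q) z) {t₀ : ℝ} (ht₀ : 0 ≤ t₀) (hlt : expSum q (z t₀) < 1)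

include hq hc hz ht₀ hlt in
theorem expSum_lt_one_of_le {t : ℝ} (ht : t₀ ≤ t) : expSum q (z t) < 1 :=
  (antitoneOn_expSum hq hc hz ht₀ (ht₀.trans ht) ht).trans_lt hlt

include hN hL hom hq hc hz ht₀ hlt in
theorem flow_ne_zero {t : ℝ} (ht : t₀ ≤ t) : z t ≠ 0 :=
  ne_zero_of_expSum_lt_one hN hL hom (expSum_lt_one_of_le hq hc hz ht₀ hlt ht)

-- The constant `c` measures how far `v` is from radial. With `c = 0` the hypothesis is
-- Cauchy–Schwarz and the smoothed margin is monotone; with `c > 0` there is a surplus proportional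
-- to the growth of the norm.
include hN hL hom hq hc hz ht₀ hlt in
theorem logSmoothedMargin_sub_le {c a b : ℝ} (hc0 : 0 ≤ c) (ha : t₀ ≤ a) (hab : a ≤ b)
    (h : ∀ᵐ t, t ∈ Ioc a b → ∀ v, IsRegularTime q z t v →
      (1 + c) * inner ℝ v (z t) ^ 2 ≤ ‖v‖ ^ 2 * ‖z t‖ ^ 2) :
    logSmoothedMargin q L (z a) - L * c * logNorm (z a) ≤
      logSmoothedMargin q L (z b) - L * c * logNorm (z b) := by
  have hu : ∀ t ∈ uIcc a b, t₀ ≤ t := fun t ht => by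
    rw [uIcc_of_le hab] at ht; exact ha.trans ht.1
  have hac1 := absolutelyContinuousOnInterval_expSum hq hz.1 (ht₀.trans ha) hab
  have hac2 : AbsolutelyContinuousOnInterval
      (fun t => Real.log (-Real.log (expSum q (z t)))) a b :=
    hac1.locallyLipschitzOn_comp (U := Ioo 0 1) (F := fun s => Real.log (-Real.log s))
      (locallyLipschitzOn_of_contDiffAt fun s hs =>
        ((contDiffAt_id.log hs.1.ne').neg).log (neg_pos.mpr (Real.log_neg hs.1 hs.2)).ne')
      fun t ht => ⟨expSum_pos hN _, expSum_lt_one_of_le hq hc hz ht₀ hlt (hu t ht)⟩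
  have hac3 : AbsolutelyContinuousOnInterval (fun t => logNorm (z t)) a b :=
    (hz.1 a b (ht₀.trans ha) hab).locallyLipschitzOn_comp locallyLipschitzOn_logNorm
      fun t ht => flow_ne_zero hN hL hom hq hc hz ht₀ hlt (hu t ht)
  refine AbsolutelyContinuousOnInterval.le_of_ae_hasDerivAt_nonneg hab
    ((hac2.fun_sub (hac3.const_mul L)).fun_sub (hac3.const_mul (L * c))) ?_
  filter_upwards [ae_isRegularTime hq hc hz, h] with t ht1 ht2 htm
  have htt : t₀ ≤ t := ha.trans htm.1.le
  obtain ⟨v, hv⟩ := ht1 (ht₀.trans_lt (ha.trans_lt htm.1))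
  have hineq := ht2 htm v hv
  have hzt := flow_ne_zero hN hL hom hq hc hz ht₀ hlt htt
  have hS1 := expSum_lt_one_of_le hq hc hz ht₀ hlt htt
  have hS0 : 0 < expSum q (z t) := expSum_pos hN _
  have hl := neg_log_expSum_pos hN hS1
  have hR : 0 < ‖z t‖ ^ 2 := pow_pos (norm_pos_iff.mpr hzt) 2
  have hp := hv.2.1.le_inner hN hL hom fun n => (hq n).continuous.continuousAt
  have key := mul_div_le_div_of_le hL hS0 hl hR hp hineq hc0
  have hd1 := ((hv.2.2.log hS0.ne').fun_neg).log hl.ne'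
  have hd2 := hasDerivAt_logNorm hv.1 hzt
  refine ⟨_, ?_, (hd1.sub (hd2.const_mul L)).sub (hd2.const_mul (L * c))⟩
  have h3 : -(-‖v‖ ^ 2 / expSum q (z t)) / -Real.log (expSum q (z t)) =
      ‖v‖ ^ 2 / (expSum q (z t) * -Real.log (expSum q (z t))) := by
    rw [neg_div (expSum q (z t)), neg_neg, div_div]
  rw [h3]
  linarith

include hN hL hom hq hc hz ht₀ hlt in
theorem monotoneOn_logSmoothedMargin :
    MonotoneOn (fun t => logSmoothedMargin q L (z t)) (Ici t₀) := by
  intro a ha b hb hab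
  have := logSmoothedMargin_sub_le hN hL hom hq hc hz ht₀ hlt le_rfl ha hab
    (Eventually.of_forall fun t _ v _ => by
      have := abs_real_inner_le_norm v (z t)
      rw [add_zero, one_mul, ← mul_pow, ← sq_abs]
      gcongr)
  simpa using this

include hN hL hom hq hc hz ht₀ hlt in
theorem absolutelyContinuousOnInterval_logNorm {a b : ℝ} (ha : t₀ ≤ a) (hab : a ≤ b) :
    AbsolutelyContinuousOnInterval (fun t => logNorm (z t)) a b :=
  (hz.1 a b (ht₀.trans ha) hab).locallyLipschitzOn_comp locallyLipschitzOn_logNorm fun t ht =>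
    flow_ne_zero hN hL hom hq hc hz ht₀ hlt (by rw [uIcc_of_le hab] at ht; exact ha.trans ht.1)

include hN hL hom hq hc hz ht₀ hlt in
theorem monotoneOn_logNorm : MonotoneOn (fun t => logNorm (z t)) (Ici t₀) := by
  intro a ha b hb hab
  refine AbsolutelyContinuousOnInterval.le_of_ae_hasDerivAt_nonneg hab
    (absolutelyContinuousOnInterval_logNorm hN hL hom hq hc hz ht₀ hlt ha hab) ?_
  filter_upwards [ae_isRegularTime hq hc hz] with t ht1 htm
  have htt : t₀ ≤ t := le_trans ha htm.1.le
  obtain ⟨v, hv⟩ := ht1 (ht₀.trans_lt (lt_of_le_of_lt ha htm.1))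
  have hpos := hv.2.1.inner_pos hN hL hom (fun n => (hq n).continuous.continuousAt)
    (expSum_lt_one_of_le hq hc hz ht₀ hlt htt)
  exact ⟨_, by positivity, hasDerivAt_logNorm hv.1
    (flow_ne_zero hN hL hom hq hc hz ht₀ hlt htt)⟩

include hN hL hom hq hc hz ht₀ hlt in
theorem exp_mul_norm_rpow_le {t : ℝ} (ht : t₀ ≤ t) :
    Real.exp (logSmoothedMargin q L (z t₀)) * ‖z t‖ ^ L ≤ -Real.log (expSum q (z t)) := by
  have hmono : logSmoothedMargin q L (z t₀) ≤ logSmoothedMargin q L (z t) :=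
    monotoneOn_logSmoothedMargin hN hL hom hq hc hz ht₀ hlt (le_refl t₀) ht ht
  rw [← exp_logSmoothedMargin (L := L) hN (flow_ne_zero hN hL hom hq hc hz ht₀ hlt ht)
    (expSum_lt_one_of_le hq hc hz ht₀ hlt ht)]
  gcongr

include hN hL hom hq hc hz ht₀ hlt in
theorem inner_normalize_sub_le {B : ℝ} (hB0 : 0 ≤ B)
    (hB : ∀ n u, ‖u‖ = 1 → ∀ h ∈ clarkeSubdifferential (q n) u, ‖h‖ ≤ B)
    (e : EuclideanSpace ℝ (Fin d)) {a b : ℝ} (ha : t₀ ≤ a) (hab : a ≤ b) :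
    inner ℝ e (‖z b‖⁻¹ • z b) - inner ℝ e (‖z a‖⁻¹ • z a) ≤
      ‖e‖ * (2 * (B / (L * Real.exp (logSmoothedMargin q L (z t₀))))) *
        (logNorm (z b) - logNorm (z a)) := by
  have hac1 := absolutelyContinuousOnInterval_logNorm hN hL hom hq hc hz ht₀ hlt ha hab
  have hne : ∀ t ∈ uIcc a b, z t ∈ ({0}ᶜ : Set (EuclideanSpace ℝ (Fin d))) := fun t ht =>
    flow_ne_zero hN hL hom hq hc hz ht₀ hlt (by rw [uIcc_of_le hab] at ht; exact ha.trans ht.1)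
  have hac2 := (hz.1 a b (ht₀.trans ha) hab).locallyLipschitzOn_comp
    (locallyLipschitzOn_inner_normalize e) hne
  have hγ0 : 0 < Real.exp (logSmoothedMargin q L (z t₀)) := Real.exp_pos _
  have hγl := fun t ht => exp_mul_norm_rpow_le hN hL hom hq hc hz ht₀ hlt (t := t) ht
  generalize Real.exp (logSmoothedMargin q L (z t₀)) = γ at *
  have hae : ∀ᵐ t, t ∈ Ioc a b → ∃ y, 0 ≤ y ∧ HasDerivAt (fun t =>
      ‖e‖ * (2 * (B / (L * γ))) * logNorm (z t) - (inner ℝ e (‖z t‖⁻¹ • z t) : ℝ)) y t := by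
    filter_upwards [ae_isRegularTime hq hc hz] with t ht1 htm
    have htt : t₀ ≤ t := ha.trans htm.1.le
    obtain ⟨v, hv⟩ := ht1 (ht₀.trans_lt (ha.trans_lt htm.1))
    have hzt := flow_ne_zero hN hL hom hq hc hz ht₀ hlt htt
    obtain ⟨y, hy, hyd⟩ := hasDerivAt_inner_normalize (e := e) hv.1 hzt
    refine ⟨_, ?_, ((hasDerivAt_logNorm hv.1 hzt).const_mul (‖e‖ * (2 * (B / (L * γ))))).sub hyd⟩
    have h1 := hv.2.1.norm_div_le hN hL hom (fun n => (hq n).continuous.continuousAt) hB0 hB hγ0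
      hzt (hγl t htt)
    have h8 := (le_abs_self y).trans hy
    have h9 : ‖e‖ * (2 * (‖v‖ / ‖z t‖)) ≤
        ‖e‖ * (2 * (B / (L * γ))) * (inner ℝ v (z t) / ‖z t‖ ^ 2) := by
      rw [mul_assoc, mul_assoc]
      gcongr
    linarith
  have hle := AbsolutelyContinuousOnInterval.le_of_ae_hasDerivAt_nonneg hab
    ((hac1.const_mul _).fun_sub hac2) hae
  linarith

include hN hL hom hq hc hz ht₀ hlt in
/-- The flow direction moves no faster than the logarithm of its norm. -/
theorem exists_norm_normalize_sub_le : ∃ C : ℝ, 0 ≤ C ∧ ∀ a b, t₀ ≤ a → a ≤ b →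
    ‖‖z b‖⁻¹ • z b - ‖z a‖⁻¹ • z a‖ ≤ C * (logNorm (z b) - logNorm (z a)) := by
  obtain ⟨B, hB0, hB⟩ := exists_norm_bound_clarkeSubdifferential_sphere fun n x _ => hq n x
  refine ⟨2 * (B / (L * Real.exp (logSmoothedMargin q L (z t₀)))), by positivity,
    fun a b ha hab => ?_⟩
  -- Taking the displacement itself as the test vector turns the scalar bound into a norm bound
  -- after cancelling one factor.
  have hle := inner_normalize_sub_le hN hL hom hq hc hz ht₀ hlt hB0 hB
    (‖z b‖⁻¹ • z b - ‖z a‖⁻¹ • z a) ha hab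
  rw [← inner_sub_right, real_inner_self_eq_norm_sq, mul_assoc, sq] at hle
  rcases (norm_nonneg (‖z b‖⁻¹ • z b - ‖z a‖⁻¹ • z a)).eq_or_lt with h0 | h0
  · rw [← h0]
    exact mul_nonneg (by positivity)
      (sub_nonneg.mpr (monotoneOn_logNorm hN hL hom hq hc hz ht₀ hlt ha (ha.trans hab) hab))
  · exact le_of_mul_le_mul_left hle h0

end GradientFlow

/-! ### Convergence of the loss and limit directions of gradient flow. -/

section GradientFlowLimit

variable {d N : ℕ} {q : Fin N → EuclideanSpace ℝ (Fin d) → ℝ} {L : ℝ}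
  {z : ℝ → EuclideanSpace ℝ (Fin d)}

theorem logSmoothedMargin_le {B : ℝ} (hN : 0 < N)
    (hom : ∀ n θ α, 0 < α → q n (α • θ) = α ^ L * q n θ) (hB0 : 0 < B)
    (hB : ∀ n u, ‖u‖ = 1 → q n u ≤ B) {w : EuclideanSpace ℝ (Fin d)} (hw : w ≠ 0)
    (h1 : expSum q w < 1) : logSmoothedMargin q L w ≤ Real.log B := by
  have hr : 0 < ‖w‖ := norm_pos_iff.mpr hw
  rw [Real.le_log_iff_exp_le hB0]
  have h2 := exp_logSmoothedMargin (L := L) hN hw h1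
  have h3 := (neg_log_expSum_le hN w ⟨0, hN⟩).trans
    (le_mul_norm_rpow_of_homogeneous (hom ⟨0, hN⟩) (hB ⟨0, hN⟩) hw)
  rw [← h2] at h3
  exact le_of_mul_le_mul_right h3 (Real.rpow_pos_of_pos hr L)

variable (hN : 0 < N) (hL : 0 < L) (hom : ∀ n θ α, 0 < α → q n (α • θ) = α ^ L * q n θ)
  (hq : ∀ n, LocallyLipschitz (q n)) (hc : ∀ n, AdmitsChainRule (q n))
  (hz : IsGradientFlow (expSum q) z) {t₀ : ℝ} (ht₀ : 0 ≤ t₀) (hlt : expSum q (z t₀) < 1)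

include hN hL hom hq hc hz ht₀ hlt in
/-- The loss tends to zero along the flow. -/
theorem exists_expSum_lt {ε : ℝ} (hε : 0 < ε) : ∃ T, t₀ ≤ T ∧ expSum q (z T) < ε := by
  by_contra! hcon
  set ℓ₀ := -Real.log (expSum q (z t₀)) with hℓ₀
  have hℓ₀pos : 0 < ℓ₀ := neg_log_expSum_pos hN hlt
  -- If the loss stays above `ε`, then `ℓ` is bounded, and monotonicity of the smoothed margin
  -- bounds the norm.
  obtain ⟨M, hM0, hM⟩ : ∃ M : ℝ, 0 < M ∧ ∀ t, t₀ ≤ t → ‖z t‖ ^ 2 ≤ M := by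
    set K := (Real.log (-Real.log ε) - logSmoothedMargin q L (z t₀)) / L with hK
    refine ⟨Real.exp (2 * K), Real.exp_pos _, fun t ht => ?_⟩
    have hzt := flow_ne_zero hN hL hom hq hc hz ht₀ hlt ht
    have h1 : logSmoothedMargin q L (z t₀) ≤ logSmoothedMargin q L (z t) :=
      monotoneOn_logSmoothedMargin hN hL hom hq hc hz ht₀ hlt (le_refl t₀) ht ht
    have h2 : Real.log (-Real.log (expSum q (z t))) ≤ Real.log (-Real.log ε) := by
      refine Real.log_le_log (neg_log_expSum_pos hN (expSum_lt_one_of_le hq hc hz ht₀ hlt ht)) ?_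
      have := Real.log_le_log hε (hcon t ht)
      linarith
    have h3 : logNorm (z t) ≤ K := by
      rw [hK, le_div_iff₀ hL]
      have h4 : logSmoothedMargin q L (z t) =
        Real.log (-Real.log (expSum q (z t))) - L * logNorm (z t) := rfl
      linarith
    rw [logNorm] at h3
    rw [← Real.log_le_iff_le_exp (by positivity)]
    linarith
  -- By Euler and Cauchy–Schwarz `δ` bounds `‖v‖²` from below, so the loss falls at least linearly
  -- and would become nonpositive.
  set δ := (L * (ε * ℓ₀)) ^ 2 / M with hδ
  have hδ0 : 0 < δ := by positivity
  have hdec : ∀ b, t₀ ≤ b → expSum q (z b) + δ * (b - t₀) ≤ expSum q (z t₀) := by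
    intro b hb
    have hid : AbsolutelyContinuousOnInterval (fun t : ℝ => δ * t) t₀ b :=
      (LipschitzWith.id.lipschitzOnWith.absolutelyContinuousOnInterval).const_mul δ
    have hae : ∀ᵐ t, t ∈ Ioc t₀ b → ∃ y, 0 ≤ y ∧
        HasDerivAt (fun t => -expSum q (z t) - δ * t) y t := by
      filter_upwards [ae_isRegularTime hq hc hz] with t ht1 htm
      have htt : t₀ ≤ t := htm.1.le
      obtain ⟨v, hv⟩ := ht1 (ht₀.trans_lt htm.1)
      have hzt := flow_ne_zero hN hL hom hq hc hz ht₀ hlt htt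
      refine ⟨_, ?_, hv.2.2.fun_neg.sub ((hasDerivAt_id t).const_mul δ)⟩
      have hp := hv.2.1.le_inner hN hL hom fun n => (hq n).continuous.continuousAt
      have hcs := real_inner_le_norm v (z t)
      have hS := hcon t htt
      have hℓ : ℓ₀ ≤ -Real.log (expSum q (z t)) := by
        have := Real.log_le_log (expSum_pos hN _)
          (antitoneOn_expSum hq hc hz ht₀ (ht₀.trans htt) htt)
        simp only at this
        linarith
      have h1 : L * (ε * ℓ₀) ≤ ‖v‖ * ‖z t‖ := by
        refine le_trans ?_ (hp.trans hcs)
        have := (expSum_pos (q := q) hN (z t)).le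
        gcongr
      have h2 : (L * (ε * ℓ₀)) ^ 2 ≤ ‖v‖ ^ 2 * ‖z t‖ ^ 2 := by
        rw [← mul_pow]
        gcongr
      have h3 : δ ≤ ‖v‖ ^ 2 := by
        rw [hδ, div_le_iff₀ hM0]
        exact h2.trans (mul_le_mul_of_nonneg_left (hM t htt) (by positivity))
      linarith
    have hle := AbsolutelyContinuousOnInterval.le_of_ae_hasDerivAt_nonneg hb
      ((absolutelyContinuousOnInterval_expSum hq hz.1 ht₀ hb).fun_neg.fun_sub hid) hae
    linarith
  have h1 := hdec (t₀ + expSum q (z t₀) / δ) (by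
    have := (expSum_pos (q := q) hN (z t₀)).le
    have : 0 ≤ expSum q (z t₀) / δ := by positivity
    linarith)
  rw [add_sub_cancel_left, mul_div_cancel₀ _ hδ0.ne'] at h1
  have := expSum_pos (q := q) hN (z (t₀ + expSum q (z t₀) / δ))
  linarith

include hN hL hom hq hc hz ht₀ hlt in
theorem exists_forall_le_neg_log_expSum (M : ℝ) :
    ∃ T, t₀ ≤ T ∧ ∀ t, T ≤ t → M ≤ -Real.log (expSum q (z t)) := by
  obtain ⟨T, hT, hS⟩ := exists_expSum_lt hN hL hom hq hc hz ht₀ hlt (Real.exp_pos (-M))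
  refine ⟨T, hT, fun t ht => ?_⟩
  have h1 : expSum q (z t) ≤ Real.exp (-M) :=
    (antitoneOn_expSum hq hc hz (ht₀.trans hT) (ht₀.trans (hT.trans ht)) ht).trans hS.le
  have := (Real.log_le_iff_le_exp (expSum_pos hN _)).mpr h1
  linarith

include hN hL hom hq hc hz ht₀ hlt in
theorem exists_le_logNorm (M : ℝ) : ∃ T, t₀ ≤ T ∧ ∀ t, T ≤ t → M ≤ logNorm (z t) := by
  obtain ⟨B, hB0, hB⟩ := exists_bound_sphere fun n => (hq n).continuous.continuousOn (s := {0}ᶜ)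
  obtain ⟨T, hT, h⟩ := exists_forall_le_neg_log_expSum hN hL hom hq hc hz ht₀ hlt
    (Real.exp (Real.log B + L * M))
  refine ⟨T, hT, fun t ht => ?_⟩
  have htt := hT.trans ht
  have hS1 := expSum_lt_one_of_le hq hc hz ht₀ hlt htt
  have h1 := logSmoothedMargin_le hN hom hB0 hB
    (flow_ne_zero hN hL hom hq hc hz ht₀ hlt htt) hS1
  have h2 := (Real.le_log_iff_exp_le (neg_log_expSum_pos hN hS1)).mpr (h t ht)
  rw [logSmoothedMargin] at h1
  have h3 : L * M ≤ L * logNorm (z t) := by linarith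
  exact le_of_mul_le_mul_left h3 hL

include hN hL hom hq hc hz ht₀ hlt in
/-- Shortly (in terms of the logarithm of the norm) after each late time there is a time at which
the velocity is almost radial. -/
theorem exists_regularTime_of_late {c Δ : ℝ} (hc0 : 0 < c) (hΔ : 0 < Δ) :
    ∃ T, t₀ ≤ T ∧ ∀ t, T ≤ t → ∃ s v, t ≤ s ∧ logNorm (z s) - logNorm (z t) ≤ Δ ∧
      IsRegularTime q z s v ∧ ‖v‖ ^ 2 * ‖z s‖ ^ 2 ≤ (1 + c) * inner ℝ v (z s) ^ 2 := by
  obtain ⟨B, hB0, hB⟩ := exists_bound_sphere fun n => (hq n).continuous.continuousOn (s := {0}ᶜ)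
  obtain ⟨T, hT, hsmall⟩ := exists_forall_sub_lt_of_monotoneOn_Ici
    (monotoneOn_logSmoothedMargin hN hL hom hq hc hz ht₀ hlt) (fun t ht =>
      logSmoothedMargin_le hN hom hB0 hB (flow_ne_zero hN hL hom hq hc hz ht₀ hlt ht)
        (expSum_lt_one_of_le hq hc hz ht₀ hlt ht)) (by positivity : 0 < L * c * Δ)
  refine ⟨T, hT, fun t ht => ?_⟩
  have htt := hT.trans ht
  obtain ⟨T', hT', hlarge⟩ := exists_le_logNorm hN hL hom hq hc hz ht₀ hlt (logNorm (z t) + Δ)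
  have htT : t ≤ max t T' := le_max_left _ _
  have hcont : ContinuousOn (fun s => logNorm (z s)) (Icc t (max t T')) := by
    have := (absolutelyContinuousOnInterval_logNorm hN hL hom hq hc hz ht₀ hlt htt htT).continuousOn
    rwa [uIcc_of_le htT] at this
  -- At `t'` the log-norm has grown by exactly `Δ`. If no time in the window were almost radial, the
  -- smoothed margin would gain `L c Δ`, more than is left after `T`.
  obtain ⟨t', ht', heq⟩ := intermediate_value_Icc htT hcont
    (⟨by linarith, hlarge _ (le_max_right _ _)⟩ :
      logNorm (z t) + Δ ∈ Icc (logNorm (z t)) (logNorm (z (max t T'))))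
  simp only at heq
  by_contra! hcon
  have hle := logSmoothedMargin_sub_le hN hL hom hq hc hz ht₀ hlt hc0.le htt ht'.1
    (Eventually.of_forall fun s hs v hv => (hcon s v hs.1.le (by
      have : logNorm (z s) ≤ logNorm (z t') := monotoneOn_logNorm hN hL hom hq hc hz ht₀ hlt
        (htt.trans hs.1.le) (htt.trans ht'.1) hs.2
      linarith) hv).le)
  have h1 := hsmall t t' ht ht'.1
  rw [heq] at hle
  linarith

include hN hL hom hq hc hz ht₀ hlt in
/-- Limit directions of gradient flow are along KKT directions. -/
theorem exists_isKKTPoint_smul_of_gradientFlow {θ : EuclideanSpace ℝ (Fin d)}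
    (hθ : MapClusterPt θ atTop fun t : ℝ => ‖z t‖⁻¹ • z t) :
    ∃ α : ℝ, 0 < α ∧
      IsKKTPoint (fun w => (1 / 2 : ℝ) * ‖w‖ ^ 2) (fun n w => 1 - q n w) (α • θ) := by
  refine exists_isKKTPoint_smul_of_mapClusterPt hN hL hom (fun n x _ => hq n x)
    (Real.exp_pos (logSmoothedMargin q L (z t₀))) (fun ε hε => ?_) hθ
  obtain ⟨C, hC0, hC⟩ := exists_norm_normalize_sub_le hN hL hom hq hc hz ht₀ hlt
  obtain ⟨T₁, hT₁, h₁⟩ := exists_forall_le_neg_log_expSum hN hL hom hq hc hz ht₀ hlt ε⁻¹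
  -- `c = ε² / 2` makes the angular defect `√(2c) = ε`; `Δ = ε / (C + 1)` keeps the change of
  -- direction `C Δ` below `ε`.
  obtain ⟨T₂, hT₂, h₂⟩ := exists_regularTime_of_late hN hL hom hq hc hz ht₀ hlt
    (by positivity : 0 < ε ^ 2 / 2) (by positivity : 0 < ε / (C + 1))
  filter_upwards [eventually_ge_atTop T₁, eventually_ge_atTop T₂] with t ht1 ht2
  obtain ⟨s, v, hts, hΔ, hv, hrad⟩ := h₂ t ht2
  have hss := (hT₂.trans ht2).trans hts
  refine ⟨z s, v, flow_ne_zero hN hL hom hq hc hz ht₀ hlt hss, hv.2.1, fun n => ?_, fun n => ?_,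
    ?_, ?_⟩
  · exact (exp_mul_norm_rpow_le hN hL hom hq hc hz ht₀ hlt hss).trans (neg_log_expSum_le hN _ n)
  · exact (h₁ s (ht1.trans hts)).trans (neg_log_expSum_le hN _ n)
  · refine (hC t s (hT₂.trans ht2) hts).trans ((mul_le_mul_of_nonneg_left hΔ hC0).trans ?_)
    rw [mul_div_assoc', div_le_iff₀ (by positivity)]
    nlinarith
  · have h3 := norm_normalize_sub_sq_le (by positivity) (hv.2.1.inner_pos hN hL hom
      (fun n => (hq n).continuous.continuousAt) (expSum_lt_one_of_le hq hc hz ht₀ hlt hss)) hrad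
    rw [mul_div_cancel₀ _ two_ne_zero] at h3
    exact (pow_le_pow_iff_left₀ (norm_nonneg _) hε.le two_ne_zero).mp h3

end GradientFlowLimit

/-! ### The convex function `φ` of the learning rate condition. -/

section LearningRate

/-- The quantity whose running supremum is `-φ'`. -/
noncomputable def lrRate (L ℓ₀ w : ℝ) : ℝ :=
  (1 + 2 * (1 + (Real.log (1 / w))⁻¹ / L) * lrMu ℓ₀ w) / (w * Real.log (1 / w))

theorem lrPhiDeriv_eq (L ℓ₀ u : ℝ) : lrPhiDeriv L ℓ₀ u = -sSup (lrRate L ℓ₀ '' Icc u ℓ₀) := rfl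

/-- With `s = log (1/w)` and `s + x = log (1/u)` the factor `e^{-x}` is `u / w`. Exponential decay
in `x` beats the polynomial change from `s` to `s + x`, so the rate at any `w ≥ u` exceeds the
leading term at `u` only by an integrable amount. -/
theorem exp_neg_mul_le (a D : ℝ) (ha : 0 < a) (hD : 0 ≤ D) : ∃ C : ℝ, 0 ≤ C ∧
    ∀ s x : ℝ, a ≤ s → 0 ≤ x → Real.exp (-x) * (1 / s + D / s ^ 2) ≤
      1 / (s + x) + C / (s + x) ^ 2 := by
  refine ⟨(1 + 2 / a) + D * (2 + 4 / a ^ 2), by positivity, fun s x hs hx => ?_⟩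
  have hs0 : 0 < s := ha.trans_le hs
  have he0 : 0 < Real.exp (-x) := Real.exp_pos _
  have he1 : Real.exp (-x) ≤ 1 := Real.exp_le_one_iff.mpr (by linarith)
  have hxx : Real.exp (-x) * Real.exp x = 1 := by rw [← Real.exp_add]; simp
  have h1 : Real.exp (-x) * x ≤ 1 := by
    have := Real.add_one_le_exp x
    nlinarith [mul_le_mul_of_nonneg_left this he0.le]
  have h2 : Real.exp (-x) * x ^ 2 ≤ 2 := by
    have := Real.quadratic_le_exp_of_nonneg hx
    nlinarith [mul_le_mul_of_nonneg_left this he0.le, mul_nonneg he0.le hx]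
  have hsa : 1 ≤ s / a := (one_le_div ha).mpr hs
  have hpos : 0 < (s + x) ^ 2 := by positivity
  have e1 : Real.exp (-x) * (1 / s) ≤ 1 / (s + x) + (1 + 2 / a) / (s + x) ^ 2 := by
    rw [mul_one_div, div_add_div _ _ (by positivity) (by positivity), div_le_div_iff₀ hs0
      (by positivity)]
    have h3 : Real.exp (-x) * (s + x) ^ 2 ≤ (s + x) * s + (1 + 2 / a) * s := by
      have e3 : (1 + 2 / a) * s = s + 2 * (s / a) := by ring
      rw [e3]
      nlinarith [mul_le_mul_of_nonneg_right h1 hs0.le,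
        mul_le_mul_of_nonneg_right he1 (by positivity : 0 ≤ s * (s + x))]
    nlinarith [mul_le_mul_of_nonneg_right h3 (by positivity : 0 ≤ s + x)]
  have e2 : Real.exp (-x) * (D / s ^ 2) ≤ D * (2 + 4 / a ^ 2) / (s + x) ^ 2 := by
    rw [mul_div_assoc', div_le_div_iff₀ (by positivity) hpos]
    have h3 : Real.exp (-x) * (s + x) ^ 2 ≤ (2 + 4 / a ^ 2) * s ^ 2 := by
      have e3 : (2 + 4 / a ^ 2) * s ^ 2 = 2 * s ^ 2 + 4 * (s / a) ^ 2 := by ring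
      rw [e3]
      have h4 : 1 ≤ (s / a) ^ 2 := one_le_pow₀ hsa
      nlinarith [mul_le_mul_of_nonneg_right he1 (by positivity : 0 ≤ s ^ 2),
        mul_nonneg he0.le (sq_nonneg (s - x))]
    nlinarith [mul_le_mul_of_nonneg_left h3 hD]
  rw [mul_add, add_div]
  linarith

variable {L ℓ₀ : ℝ} (hL : 0 < L) (h0 : 0 < ℓ₀) (h1 : ℓ₀ < 1)

theorem log_one_div_pos {u : ℝ} (hu0 : 0 < u) (hu1 : u < 1) : 0 < Real.log (1 / u) :=
  Real.log_pos (by rw [lt_div_iff₀ hu0]; linarith)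

theorem log_one_div_anti {u w : ℝ} (hu0 : 0 < u) (huw : u ≤ w) :
    Real.log (1 / w) ≤ Real.log (1 / u) :=
  Real.log_le_log (by have := hu0.trans_le huw; positivity) (one_div_le_one_div_of_le hu0 huw)

include h0 h1 in
theorem lrMu_pos {u : ℝ} (hu0 : 0 < u) (hu : u ≤ ℓ₀) : 0 < lrMu ℓ₀ u :=
  div_pos (log_one_div_pos h0 h1) (by have := log_one_div_pos hu0 (hu.trans_lt h1); positivity)

include h1 in
theorem lrMu_le_half {u : ℝ} (hu0 : 0 < u) (hu : u ≤ ℓ₀) : lrMu ℓ₀ u ≤ 1 / 2 := by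
  have := log_one_div_pos hu0 (hu.trans_lt h1)
  have h3 := log_one_div_anti hu0 hu
  rw [lrMu, div_le_div_iff₀ (by positivity) two_pos]
  linarith

include hL h0 h1 in
theorem one_div_le_lrRate {u : ℝ} (hu0 : 0 < u) (hu : u ≤ ℓ₀) :
    1 / (u * Real.log (1 / u)) ≤ lrRate L ℓ₀ u := by
  have h2 := log_one_div_pos hu0 (hu.trans_lt h1)
  have h3 := lrMu_pos h0 h1 hu0 hu
  rw [lrRate]
  gcongr
  have : 0 ≤ 2 * (1 + (Real.log (1 / u))⁻¹ / L) * lrMu ℓ₀ u := by positivity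
  linarith

include hL h0 h1 in
theorem exists_lrRate_le : ∃ C : ℝ, 0 ≤ C ∧ ∀ u w : ℝ, 0 < u → u ≤ w → w ≤ ℓ₀ →
    lrRate L ℓ₀ w ≤ 1 / (u * Real.log (1 / u)) + C * (1 / (u * Real.log (1 / u) ^ 2)) := by
  set a := Real.log (1 / ℓ₀) with ha
  have ha0 : 0 < a := log_one_div_pos h0 h1
  obtain ⟨C, hC0, hC⟩ := exp_neg_mul_le a (a + 1 / L) ha0 (by positivity)
  refine ⟨C, hC0, fun u w hu0 huw hw => ?_⟩
  have hw0 : 0 < w := hu0.trans_le huw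
  set s := Real.log (1 / w) with hs
  set S := Real.log (1 / u) with hS
  have has : a ≤ s := log_one_div_anti hw0 hw
  have hsS : s ≤ S := log_one_div_anti hu0 huw
  have hs0 : 0 < s := ha0.trans_le has
  have h2 := hC s (S - s) has (sub_nonneg.mpr hsS)
  rw [add_sub_cancel, neg_sub, hs, hS, Real.exp_sub, Real.exp_log (by positivity),
    Real.exp_log (by positivity), ← hs, ← hS] at h2
  have h3 : w * lrRate L ℓ₀ w ≤ 1 / s + (a + 1 / L) / s ^ 2 := by
    have e1 : w * lrRate L ℓ₀ w = 1 / s + (a + 1 / L * (a / s)) / s ^ 2 := by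
      rw [lrRate, lrMu, ← hs, ← ha]
      field_simp
    rw [e1]
    have : a / s ≤ 1 := (div_le_one hs0).mpr has
    gcongr
    exact mul_le_of_le_one_right (by positivity) this
  have h4 : u * lrRate L ℓ₀ w ≤ 1 / S + C / S ^ 2 := by
    refine le_trans ?_ h2
    have e1 : u * lrRate L ℓ₀ w = 1 / w / (1 / u) * (w * lrRate L ℓ₀ w) := by field_simp
    rw [e1]
    gcongr
  have e2 : 1 / (u * S) + C * (1 / (u * S ^ 2)) = (1 / S + C / S ^ 2) / u := by
    field_simp
  rw [e2, le_div_iff₀ hu0, mul_comm]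
  exact h4

include hL h0 h1 in
theorem bddAbove_lrRate {u : ℝ} (hu0 : 0 < u) : BddAbove (lrRate L ℓ₀ '' Icc u ℓ₀) := by
  obtain ⟨C, -, hC⟩ := exists_lrRate_le hL h0 h1
  exact ⟨_, by rintro _ ⟨w, hw, rfl⟩; exact hC u w hu0 hw.1 hw.2⟩

include hL h0 h1 in
theorem lrPhiDeriv_le {u : ℝ} (hu0 : 0 < u) (hu : u ≤ ℓ₀) :
    lrPhiDeriv L ℓ₀ u ≤ -lrRate L ℓ₀ u := by
  rw [lrPhiDeriv_eq, neg_le_neg_iff]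
  exact le_csSup (bddAbove_lrRate hL h0 h1 hu0) ⟨u, ⟨le_rfl, hu⟩, rfl⟩

-- The running supremum serves this purpose: it makes `φ` convex without any monotonicity of the
-- rate itself.
include hL h0 h1 in
theorem monotoneOn_lrPhiDeriv : MonotoneOn (lrPhiDeriv L ℓ₀) (Ioc 0 ℓ₀) := by
  intro u hu w hw huw
  rw [lrPhiDeriv_eq, lrPhiDeriv_eq, neg_le_neg_iff]
  exact csSup_le_csSup (bddAbove_lrRate hL h0 h1 hu.1) ((nonempty_Icc.mpr hw.2).image _)
    (image_mono (Icc_subset_Icc_left huw))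

include hL h0 h1 in
theorem exists_abs_lrPhiDeriv_add_le : ∃ C : ℝ, ∀ u ∈ Ioc 0 ℓ₀,
    |lrPhiDeriv L ℓ₀ u + 1 / (u * Real.log (1 / u))| ≤ C * (1 / (u * Real.log (1 / u) ^ 2)) := by
  obtain ⟨C, hC0, hC⟩ := exists_lrRate_le hL h0 h1
  refine ⟨C, fun u hu => ?_⟩
  have h2 := lrPhiDeriv_le hL h0 h1 hu.1 hu.2
  have h3 := one_div_le_lrRate hL h0 h1 hu.1 hu.2
  rw [abs_of_nonpos (by linarith), lrPhiDeriv_eq]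
  have h4 : sSup (lrRate L ℓ₀ '' Icc u ℓ₀) ≤
      1 / (u * Real.log (1 / u)) + C * (1 / (u * Real.log (1 / u) ^ 2)) :=
    csSup_le ((nonempty_Icc.mpr hu.2).image _)
      (by rintro _ ⟨w, hw, rfl⟩; exact hC u w hu.1 hw.1 hw.2)
  linarith

theorem hasDerivAt_log_one_div {u : ℝ} (hu : 0 < u) :
    HasDerivAt (fun w : ℝ => Real.log (1 / w)) (-(1 / u)) u := by
  have h : (fun w : ℝ => Real.log (1 / w)) = fun w => -Real.log w := by
    ext w; rw [one_div, Real.log_inv]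
  rw [h, one_div]
  exact (Real.hasDerivAt_log hu.ne').fun_neg

include h1 in
theorem integrableOn_one_div_mul_log_sq :
    IntegrableOn (fun u : ℝ => 1 / (u * Real.log (1 / u) ^ 2)) (Ioc 0 ℓ₀) := by
  refine intervalIntegral.integrableOn_deriv_of_nonneg (g := fun u => (Real.log (1 / u))⁻¹) ?_ ?_ ?_
  · intro u hu
    rcases hu.1.eq_or_lt with rfl | hu0
    · have hlim : Tendsto (fun u : ℝ => (Real.log (1 / u))⁻¹) (𝓝[>] 0) (𝓝 0) := by
        have h3 : Tendsto (fun u : ℝ => 1 / u) (𝓝[>] 0) atTop := by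
          simpa only [one_div] using tendsto_inv_nhdsGT_zero
        exact (Real.tendsto_log_atTop.comp h3).inv_tendsto_atTop
      -- At `0` the conventions for division and logarithm give the function the value `0`, which is
      -- also its limit.
      have h2 : ContinuousWithinAt (fun u : ℝ => (Real.log (1 / u))⁻¹) (Ioi 0) 0 := by
        simpa [ContinuousWithinAt] using hlim
      exact (continuousWithinAt_insert_self.mpr h2).mono fun v hv => by
        rcases hv.1.eq_or_lt with h | h
        · exact Or.inl h.symm
        · exact Or.inr h
    · exact ((hasDerivAt_log_one_div hu0).continuousAt.inv₀
        (log_one_div_pos hu0 (hu.2.trans_lt h1)).ne').continuousWithinAt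
  · intro u hu
    have h2 := log_one_div_pos hu.1 (hu.2.trans h1)
    refine ((hasDerivAt_log_one_div hu.1).fun_inv h2.ne').congr_deriv ?_
    rw [neg_neg, div_div]
  · intro u hu
    have := hu.1
    positivity

include hL h0 h1 in
theorem integrableOn_lrPhiDeriv_add :
    IntegrableOn (fun w => lrPhiDeriv L ℓ₀ w + 1 / (w * Real.log (1 / w))) (Ioc 0 ℓ₀) := by
  obtain ⟨C, hC⟩ := exists_abs_lrPhiDeriv_add_le hL h0 h1
  refine ((integrableOn_one_div_mul_log_sq h1).const_mul C).mono' ?_ ?_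
  · have hm : AEMeasurable (lrPhiDeriv L ℓ₀) (volume.restrict (Ioc 0 ℓ₀)) :=
      aemeasurable_restrict_of_monotoneOn measurableSet_Ioc (monotoneOn_lrPhiDeriv hL h0 h1)
    have hm2 : Measurable fun w : ℝ => 1 / (w * Real.log (1 / w)) := by fun_prop
    exact (hm.add hm2.aemeasurable).aestronglyMeasurable
  · rw [ae_restrict_iff' measurableSet_Ioc]
    exact Eventually.of_forall hC

-- The integrand in `φ` is nonpositive. Lower bounds on `φ` along the iterates are therefore lower
-- bounds on the soft-minimum margin.
include hL h0 h1 in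
theorem lrPhi_le {u : ℝ} (hu0 : 0 < u) (hu : u ≤ ℓ₀) :
    lrPhi L ℓ₀ u ≤ Real.log (Real.log (1 / u)) := by
  rw [lrPhi, intervalIntegral.integral_of_le hu0.le]
  have : ∫ w in Ioc 0 u, (lrPhiDeriv L ℓ₀ w + 1 / (w * Real.log (1 / w))) ≤ 0 := by
    refine setIntegral_nonpos measurableSet_Ioc fun w hw => ?_
    have h2 := lrPhiDeriv_le hL h0 h1 hw.1 (hw.2.trans hu)
    have h3 := one_div_le_lrRate hL h0 h1 hw.1 (hw.2.trans hu)
    linarith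
  linarith

include hL h0 h1 in
/-- The convexity inequality for `φ`. -/
theorem lrRate_mul_sub_le {u w : ℝ} (hu0 : 0 < u) (huw : u ≤ w) (hw : w ≤ ℓ₀) :
    lrRate L ℓ₀ w * (w - u) ≤ lrPhi L ℓ₀ u - lrPhi L ℓ₀ w := by
  have hw0 := hu0.trans_le huw
  have hint := integrableOn_lrPhiDeriv_add hL h0 h1
  have hi : ∀ a b : ℝ, 0 ≤ a → a ≤ b → b ≤ ℓ₀ → IntervalIntegrable
      (fun w => lrPhiDeriv L ℓ₀ w + 1 / (w * Real.log (1 / w))) volume a b := fun a b ha hab hb =>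
    (intervalIntegrable_iff_integrableOn_Ioc_of_le hab).mpr
      (hint.mono_set (Ioc_subset_Ioc ha hb))
  have hadd := intervalIntegral.integral_add_adjacent_intervals
    (hi 0 u le_rfl hu0.le (huw.trans hw)) (hi u w hu0.le huw hw)
  have hderiv : ∀ v ∈ uIcc u w, HasDerivAt (fun v => -Real.log (Real.log (1 / v)))
      (1 / (v * Real.log (1 / v))) v := fun v hv => by
    rw [uIcc_of_le huw] at hv
    have hv0 := hu0.trans_le hv.1
    have h2 := log_one_div_pos hv0 ((hv.2.trans hw).trans_lt h1)
    refine ((hasDerivAt_log_one_div hv0).log h2.ne').fun_neg.congr_deriv ?_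
    rw [neg_div, neg_neg, div_div]
  have hcont : ContinuousOn (fun v : ℝ => 1 / (v * Real.log (1 / v))) (uIcc u w) := fun v hv => by
    rw [uIcc_of_le huw] at hv
    have hv0 := hu0.trans_le hv.1
    have h2 := log_one_div_pos hv0 ((hv.2.trans hw).trans_lt h1)
    exact (continuousAt_const.div
      (continuousAt_id.mul (hasDerivAt_log_one_div hv0).continuousAt)
      (mul_pos hv0 h2).ne').continuousWithinAt
  have hftc := intervalIntegral.integral_eq_sub_of_hasDerivAt hderiv hcont.intervalIntegrable
  -- Since `φ'` is monotone and `φ'(w) ≤ -lrRate w`, it is at most `-lrRate w` on all of `[u, w]`.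
  -- The integral of `1 / (v log (1/v))` then cancels the double logarithms.
  have hle : ∫ v in u..w, (lrPhiDeriv L ℓ₀ v + 1 / (v * Real.log (1 / v))) ≤
      ∫ v in u..w, (-lrRate L ℓ₀ w + 1 / (v * Real.log (1 / v))) := by
    refine intervalIntegral.integral_mono_on huw (hi u w hu0.le huw hw)
      (intervalIntegrable_const.add hcont.intervalIntegrable) fun v hv => ?_
    have hv0 := hu0.trans_le hv.1
    have h2 := monotoneOn_lrPhiDeriv hL h0 h1 ⟨hv0, hv.2.trans hw⟩ ⟨hw0, hw⟩ hv.2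
    have h3 := lrPhiDeriv_le hL h0 h1 hw0 hw
    linarith
  rw [intervalIntegral.integral_add intervalIntegrable_const hcont.intervalIntegrable, hftc,
    intervalIntegral.integral_const, smul_eq_mul] at hle
  rw [lrPhi, lrPhi]
  linarith

end LearningRate

/-! ### First and second derivatives of the loss for smooth margins. -/

section Smooth

variable {d N : ℕ} {q : Fin N → EuclideanSpace ℝ (Fin d) → ℝ} {L : ℝ}

theorem contDiffAt_gradient {f : EuclideanSpace ℝ (Fin d) → ℝ} {w : EuclideanSpace ℝ (Fin d)}
    (hf : ContDiffAt ℝ 2 f w) : ContDiffAt ℝ 1 (gradient f) w :=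
  (InnerProductSpace.toDual ℝ (EuclideanSpace ℝ (Fin d))).symm.contDiff.contDiffAt.comp w
    (hf.fderiv_right (m := 1) (by norm_num))

theorem ContDiffOn.contDiffAt_of_ne_zero {f : EuclideanSpace ℝ (Fin d) → ℝ}
    (hf : ContDiffOn ℝ 2 f {0}ᶜ) {w : EuclideanSpace ℝ (Fin d)} (hw : w ≠ 0) :
    ContDiffAt ℝ 2 f w :=
  hf.contDiffAt (isOpen_compl_singleton.mem_nhds hw)

theorem ContDiffAt.lipschitzNear {f : EuclideanSpace ℝ (Fin d) → ℝ} {w : EuclideanSpace ℝ (Fin d)}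
    (hf : ContDiffAt ℝ 2 f w) : LipschitzNear f w :=
  (hf.of_le (by norm_num : (1 : WithTop ℕ∞) ≤ 2)).exists_lipschitzOnWith

theorem eq_gradient_of_mem_clarkeSubdifferential {f : EuclideanSpace ℝ (Fin d) → ℝ}
    {w h : EuclideanSpace ℝ (Fin d)} (hf : ContDiffAt ℝ 2 f w)
    (hh : h ∈ clarkeSubdifferential f w) : h = gradient f w := by
  have hsub : limitingGradients f w ⊆ {gradient f w} := by
    rintro g ⟨u, hu, -, hg⟩
    exact tendsto_nhds_unique hg ((contDiffAt_gradient hf).continuousAt.tendsto.comp hu)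
  exact convexHull_min hsub (convex_singleton _) hh

theorem hasGradientAt_expSum {w : EuclideanSpace ℝ (Fin d)}
    (hq : ∀ n, DifferentiableAt ℝ (q n) w) :
    HasGradientAt (expSum q) (-∑ n, Real.exp (-q n w) • gradient (q n) w) w := by
  rw [hasGradientAt_iff_hasFDerivAt]
  have h : HasFDerivAt (expSum q) _ w :=
    HasFDerivAt.fun_sum fun n (_ : n ∈ Finset.univ) => (hq n).hasGradientAt.hasFDerivAt.fun_neg.exp
  refine h.congr_fderiv ?_
  ext v
  simp

theorem isNegLossGradient_neg_gradient {w : EuclideanSpace ℝ (Fin d)}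
    (hq : ∀ n, DifferentiableAt ℝ (q n) w) :
    IsNegLossGradient q w (-gradient (expSum q) w) := by
  refine ⟨fun n => gradient (q n) w, fun n => gradient_mem_clarkeSubdifferential (hq n), ?_⟩
  rw [(hasGradientAt_expSum hq).gradient, neg_neg]

theorem bddAbove_sphere {g : Fin N → EuclideanSpace ℝ (Fin d) → ℝ}
    (hg : ∀ n u, u ≠ 0 → ContinuousAt (g n) u) :
    BddAbove {r | ∃ n, ∃ θ, ‖θ‖ = 1 ∧ r = g n θ} := by
  have h : {r | ∃ n, ∃ θ, ‖θ‖ = 1 ∧ r = g n θ} =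
      ⋃ n ∈ (Set.univ : Set (Fin N)), g n '' Metric.sphere (0 : EuclideanSpace ℝ (Fin d)) 1 := by
    ext r
    simp only [mem_ofPred_eq, mem_iUnion, mem_image, mem_sphere_zero_iff_norm]
    exact ⟨fun ⟨n, θ, h1, h2⟩ => ⟨n, mem_univ n, θ, h1, h2.symm⟩,
      fun ⟨n, _, θ, h1, h2⟩ => ⟨n, θ, h1, h2.symm⟩⟩
  rw [h, Set.finite_univ.bddAbove_biUnion]
  intro n _
  refine (isCompact_sphere _ _).bddAbove_image fun u hu => (hg n u ?_).continuousWithinAt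
  exact ne_zero_of_mem_unit_sphere (⟨u, hu⟩ : Metric.sphere _ _)

theorem le_lrB0 (hC : ∀ n, ContDiffOn ℝ 2 (q n) {0}ᶜ) (n : Fin N) {u : EuclideanSpace ℝ (Fin d)}
    (hu : ‖u‖ = 1) : q n u ≤ lrB0 q :=
  le_csSup (bddAbove_sphere fun n _ hw => ((hC n).contDiffAt_of_ne_zero hw).continuousAt)
    ⟨n, u, hu, rfl⟩

theorem norm_gradient_le_lrB1 (hC : ∀ n, ContDiffOn ℝ 2 (q n) {0}ᶜ) (n : Fin N)
    {u : EuclideanSpace ℝ (Fin d)} (hu : ‖u‖ = 1) : ‖gradient (q n) u‖ ≤ lrB1 q :=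
  le_csSup (bddAbove_sphere fun n _ hw =>
    (contDiffAt_gradient ((hC n).contDiffAt_of_ne_zero hw)).continuousAt.norm) ⟨n, u, hu, rfl⟩

theorem norm_fderiv_gradient_le_lrB2 (hC : ∀ n, ContDiffOn ℝ 2 (q n) {0}ᶜ) (n : Fin N)
    {u : EuclideanSpace ℝ (Fin d)} (hu : ‖u‖ = 1) :
    ‖fderiv ℝ (gradient (q n)) u‖ ≤ lrB2 q :=
  le_csSup (bddAbove_sphere (g := fun n θ => ‖fderiv ℝ (gradient (q n)) θ‖) fun n _ hw =>
    ((contDiffAt_gradient ((hC n).contDiffAt_of_ne_zero hw)).fderiv_right (m := 0)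
      (by norm_num)).continuousAt.norm) ⟨n, u, hu, rfl⟩

/-- The derivative of a positively homogeneous map of degree `p` grows with degree `p - 1`. -/
theorem norm_fderiv_le_of_homogeneous {E F : Type*} [NormedAddCommGroup E] [NormedSpace ℝ E]
    [NormedAddCommGroup F] [NormedSpace ℝ F] {G : E → F} {p B : ℝ}
    (hG : ∀ (u : E) (α : ℝ), u ≠ 0 → 0 < α → G (α • u) = α ^ p • G u)
    (hB : ∀ u, ‖u‖ = 1 → ‖fderiv ℝ G u‖ ≤ B) {w : E} (hw : w ≠ 0) :
    ‖fderiv ℝ G w‖ ≤ B * ‖w‖ ^ (p - 1) := by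
  have hr : 0 < ‖w‖ := norm_pos_iff.mpr hw
  have h1 : G =ᶠ[𝓝 w] (‖w‖ ^ p • fun x => G (‖w‖⁻¹ • x)) := by
    filter_upwards [isOpen_compl_singleton.mem_nhds hw] with x hx
    rw [Pi.smul_apply, ← hG _ _ (smul_ne_zero (inv_ne_zero hr.ne') hx) hr, smul_smul,
      mul_inv_cancel₀ hr.ne', one_smul]
  rw [h1.fderiv_eq, fderiv_const_smul_field, Pi.smul_apply, fderiv_comp_smul, norm_smul, norm_smul,
    Real.norm_of_nonneg (Real.rpow_nonneg hr.le _), norm_inv, norm_norm,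
    Real.rpow_sub_one hr.ne']
  have h2 := hB (‖w‖⁻¹ • w) (by rw [norm_smul, norm_inv, norm_norm, inv_mul_cancel₀ hr.ne'])
  have h3 : B * (‖w‖ ^ p / ‖w‖) = ‖w‖ ^ p * (‖w‖⁻¹ * B) := by field_simp
  rw [h3]
  gcongr

theorem norm_fderiv_gradient_le {f : EuclideanSpace ℝ (Fin d) → ℝ} {B : ℝ}
    (hom : ∀ θ α, 0 < α → f (α • θ) = α ^ L * f θ) (hC : ContDiffOn ℝ 2 f {0}ᶜ)
    (hB : ∀ u, ‖u‖ = 1 → ‖fderiv ℝ (gradient f) u‖ ≤ B) {w : EuclideanSpace ℝ (Fin d)}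
    (hw : w ≠ 0) : ‖fderiv ℝ (gradient f) w‖ ≤ B * ‖w‖ ^ (L - 2) := by
  have h := norm_fderiv_le_of_homogeneous (p := L - 1) (fun u α hu hα =>
    (hasGradientAt_smul_of_homogeneous hom hα ((hC.contDiffAt_of_ne_zero hu).differentiableAt
      (by norm_num))).gradient) hB hw
  rwa [sub_sub, one_add_one_eq_two] at h

/-- The derivative of `s ↦ expSum q (w + s • e)`. -/
noncomputable def expSumDeriv (q : Fin N → EuclideanSpace ℝ (Fin d) → ℝ)
    (w e : EuclideanSpace ℝ (Fin d)) (s : ℝ) : ℝ :=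
  ∑ n, Real.exp (-q n (w + s • e)) * -inner ℝ (gradient (q n) (w + s • e)) e

/-- The second derivative of `s ↦ expSum q (w + s • e)`. -/
noncomputable def expSumDeriv2 (q : Fin N → EuclideanSpace ℝ (Fin d) → ℝ)
    (w e : EuclideanSpace ℝ (Fin d)) (s : ℝ) : ℝ :=
  ∑ n, Real.exp (-q n (w + s • e)) * (inner ℝ (gradient (q n) (w + s • e)) e ^ 2 -
    inner ℝ (fderiv ℝ (gradient (q n)) (w + s • e) e) e)

theorem hasDerivAt_expSum_line (hC : ∀ n, ContDiffOn ℝ 2 (q n) {0}ᶜ)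
    {w e : EuclideanSpace ℝ (Fin d)} {s : ℝ} (hs : w + s • e ≠ 0) :
    HasDerivAt (fun s => expSum q (w + s • e)) (expSumDeriv q w e s) s :=
  HasDerivAt.fun_sum fun n _ => (hasDerivAt_comp_line
    (((hC n).contDiffAt_of_ne_zero hs).differentiableAt (by norm_num))).fun_neg.exp

theorem hasDerivAt_expSumDeriv (hC : ∀ n, ContDiffOn ℝ 2 (q n) {0}ᶜ)
    {w e : EuclideanSpace ℝ (Fin d)} {s : ℝ} (hs : w + s • e ≠ 0) :
    HasDerivAt (expSumDeriv q w e) (expSumDeriv2 q w e s) s := by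
  refine HasDerivAt.fun_sum fun n _ => ?_
  have hcd := (hC n).contDiffAt_of_ne_zero hs
  have h1 := (hasDerivAt_comp_line (hcd.differentiableAt (by norm_num))).fun_neg.exp
  have hz : HasDerivAt (fun s : ℝ => w + s • e) e s := by
    simpa using ((hasDerivAt_id s).smul_const e).const_add w
  have h2 : HasDerivAt (fun s : ℝ => gradient (q n) (w + s • e))
      (fderiv ℝ (gradient (q n)) (w + s • e) e) s :=
    HasFDerivAt.comp_hasDerivAt (l := gradient (q n)) (f := fun s : ℝ => w + s • e) s
      ((contDiffAt_gradient hcd).differentiableAt (by norm_num)).hasFDerivAt hz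
  have h3 := (h2.inner ℝ (hasDerivAt_const s e)).fun_neg
  refine (h1.mul h3).congr_deriv ?_
  rw [inner_zero_right, zero_add]
  ring

/-- Gradients of the margins are homogeneous of degree `L - 1` and Hessians of degree `L - 2`, so
sphere bounds suffice. -/
theorem expSumDeriv2_le {B₁ B₂ : ℝ} (hom : ∀ n θ α, 0 < α → q n (α • θ) = α ^ L * q n θ)
    (hC : ∀ n, ContDiffOn ℝ 2 (q n) {0}ᶜ)
    (hB₁ : ∀ n u, ‖u‖ = 1 → ‖gradient (q n) u‖ ≤ B₁)
    (hB₂ : ∀ n u, ‖u‖ = 1 → ‖fderiv ℝ (gradient (q n)) u‖ ≤ B₂)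
    {w e : EuclideanSpace ℝ (Fin d)} {s : ℝ} (hs : w + s • e ≠ 0) :
    expSumDeriv2 q w e s ≤ expSum q (w + s • e) * (B₁ ^ 2 * ‖w + s • e‖ ^ (2 * L - 2) +
      B₂ * ‖w + s • e‖ ^ (L - 2)) * ‖e‖ ^ 2 := by
  rw [expSumDeriv2]
  generalize w + s • e = z at *
  have hr : 0 < ‖z‖ := norm_pos_iff.mpr hs
  rw [expSum, Finset.sum_mul, Finset.sum_mul]
  refine Finset.sum_le_sum fun n _ => ?_
  rw [mul_assoc]
  refine mul_le_mul_of_nonneg_left ?_ (Real.exp_pos _).le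
  have h1 : ‖gradient (q n) z‖ ≤ B₁ * ‖z‖ ^ (L - 1) := by
    refine norm_le_of_mem_clarkeSubdifferential_of_homogeneous (hom n) (fun u hu h hh => ?_) hs
      (gradient_mem_clarkeSubdifferential (((hC n).contDiffAt_of_ne_zero hs).differentiableAt
        (by norm_num)))
    rw [eq_gradient_of_mem_clarkeSubdifferential ((hC n).contDiffAt_of_ne_zero
      (norm_pos_iff.mp (by rw [hu]; exact one_pos))) hh]
    exact hB₁ n u hu
  have h2 := norm_fderiv_gradient_le (hom n) (hC n) (hB₂ n) hs
  have h3 : inner ℝ (gradient (q n) z) e ^ 2 ≤ B₁ ^ 2 * ‖z‖ ^ (2 * L - 2) * ‖e‖ ^ 2 := by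
    have h4 : |inner ℝ (gradient (q n) z) e| ≤ B₁ * ‖z‖ ^ (L - 1) * ‖e‖ :=
      (abs_real_inner_le_norm _ _).trans (by gcongr)
    have h5 : ‖z‖ ^ (2 * L - 2) = (‖z‖ ^ (L - 1)) ^ 2 := by
      rw [← Real.rpow_natCast, ← Real.rpow_mul hr.le]
      congr 1
      push_cast
      ring
    rw [h5, ← mul_pow, ← mul_pow, ← sq_abs]
    gcongr
  have h6 : -inner ℝ (fderiv ℝ (gradient (q n)) z e) e ≤ B₂ * ‖z‖ ^ (L - 2) * ‖e‖ ^ 2 := by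
    refine (neg_le_abs _).trans ((abs_real_inner_le_norm _ _).trans ?_)
    rw [sq, ← mul_assoc]
    gcongr
    exact (ContinuousLinearMap.le_opNorm _ _).trans (by gcongr)
  linarith

end Smooth

/-! ### The function `κ` and the curvature of the loss. -/

section Kappa

variable {L : ℝ}

/-- The function `τ ↦ e^{-τ} τ^p` peaks at `τ = p` and decreases afterwards. The two alternatives
are comparison to the right of `σ ≥ p` and comparison with the peak; both follow from `log x ≤ x -
1` at `x = τ / σ`. -/
theorem exp_neg_mul_rpow_le {p σ τ : ℝ} (hp : 0 ≤ p) (hσ : 0 < σ) (hpσ : p ≤ σ) (hτ : 0 < τ)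
    (h : (σ ≤ τ) ∨ p = σ) : Real.exp (-τ) * τ ^ p ≤ Real.exp (-σ) * σ ^ p := by
  rw [Real.rpow_def_of_pos hτ, Real.rpow_def_of_pos hσ, ← Real.exp_add, ← Real.exp_add,
    Real.exp_le_exp]
  have h1 := Real.log_le_sub_one_of_pos (div_pos hτ hσ)
  rw [Real.log_div hτ.ne' hσ.ne'] at h1
  have h2 : p * (τ / σ - 1) ≤ τ - σ := by
    rcases h with h | rfl
    · have h3 : p * (τ / σ - 1) = p / σ * (τ - σ) := by field_simp
      rw [h3]
      exact mul_le_of_le_one_left (sub_nonneg.mpr h) ((div_le_one hσ).mpr hpσ)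
    · rw [mul_sub, mul_div_cancel₀ _ hσ.ne', mul_one]
  nlinarith [mul_le_mul_of_nonneg_left h1 hp]

theorem lrKappa_pos {u : ℝ} (hu0 : 0 < u) (hu1 : u < 1) : 0 < lrKappa L u := by
  rw [lrKappa]
  split_ifs
  · exact mul_pos hu0 (Real.rpow_pos_of_pos (log_one_div_pos hu0 hu1) _)
  · exact Real.exp_pos _

/-- `κ` is an increasing envelope of `s (log (1/s))^(2-2/L)`. It allows the loss at the start of a
step to control all points of the step, where the loss is smaller. -/
theorem mul_log_rpow_le_lrKappa (hL : 0 < L) {s u : ℝ} (hs : 0 < s) (hsu : s ≤ u) (hu : u < 1) :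
    s * Real.log (1 / s) ^ (2 - 2 / L) ≤ lrKappa L u := by
  have hu0 := hs.trans_le hsu
  have hls := log_one_div_pos hs (hsu.trans_lt hu)
  have hlu := log_one_div_pos hu0 hu
  have hlsu := log_one_div_anti hs hsu
  have es : ∀ x : ℝ, 0 < x → x = Real.exp (-Real.log (1 / x)) := fun x hx => by
    rw [one_div, Real.log_inv, neg_neg, Real.exp_log hx]
  rw [lrKappa]
  rcases le_or_gt L 1 with h1 | h1
  · rw [if_pos (Or.inl h1)]
    have hp : 2 - 2 / L ≤ 0 := by
      rw [sub_nonpos, le_div_iff₀ hL]; linarith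
    exact mul_le_mul hsu (Real.rpow_le_rpow_of_nonpos hlu hlsu hp)
      (Real.rpow_nonneg hls.le _) hu0.le
  · have hp : 0 < 2 - 2 / L := by
      rw [sub_pos, div_lt_iff₀ hL]; linarith
    split_ifs with h2
    · have h3 : u ≤ Real.exp (2 / L - 2) := h2.resolve_left (not_le.mpr h1)
      have h4 : 2 - 2 / L ≤ Real.log (1 / u) := by
        have := (Real.log_le_iff_le_exp hu0).mpr h3
        rw [one_div, Real.log_inv]
        linarith
      have := exp_neg_mul_rpow_le hp.le hlu h4 hls (Or.inl hlsu)
      rwa [← es s hs, ← es u hu0] at this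
    · have := exp_neg_mul_rpow_le hp.le hp le_rfl hls (Or.inr rfl)
      rw [← es s hs] at this
      refine this.trans_eq ?_
      rw [Real.rpow_def_of_pos hp, ← Real.exp_add]
      congr 1
      ring

/-- The bound on the curvature of the loss behind the learning rate condition. -/
theorem mul_rpow_le_two_mul_lrKappa (hL : 0 < L) {s u r ρ₀ γ₀ B₀ B₁ B₂ : ℝ} (hs : 0 < s)
    (hsu : s ≤ u) (hu : u < 1) (hρ₀ : 0 < ρ₀) (hr : ρ₀ ≤ r) (hγ₀ : 0 < γ₀) (hB₀ : 0 < B₀)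
    (hB₂ : 0 ≤ B₂) (h1 : γ₀ * r ^ L ≤ Real.log (1 / s)) (h2 : Real.log (1 / s) ≤ B₀ * r ^ L) :
    s * (B₁ ^ 2 * r ^ (2 * L - 2) + B₂ * r ^ (L - 2)) ≤
      2 * ((1 / 2 * (B₁ ^ 2 + ρ₀ ^ (-L) * B₂) *
        max (γ₀ ^ (-2 + 2 / L)) (B₀ ^ (-2 + 2 / L))) * lrKappa L u) := by
  have hr0 : 0 < r := hρ₀.trans_le hr
  have hls := log_one_div_pos hs (hsu.trans_lt hu)
  set ℓ := Real.log (1 / s) with hℓ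
  have hrL : 0 < r ^ L := Real.rpow_pos_of_pos hr0 L
  have e0 : ∀ x : ℝ, 0 < x → (ℓ / x) ^ (2 - 2 / L) = ℓ ^ (2 - 2 / L) * x ^ (-2 + 2 / L) :=
    fun x hx => by
      rw [Real.div_rpow hls.le hx.le, div_eq_mul_inv, ← Real.rpow_neg hx.le]
      congr 2
      ring
  have e1 : r ^ (2 * L - 2) = (r ^ L) ^ (2 - 2 / L) := by
    rw [← Real.rpow_mul hr0.le]
    congr 1
    field_simp
  have e2 : r ^ (L - 2) = r ^ (-L) * r ^ (2 * L - 2) := by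
    rw [← Real.rpow_add hr0]
    congr 1
    ring
  have h3 : r ^ (2 * L - 2) ≤
      ℓ ^ (2 - 2 / L) * max (γ₀ ^ (-2 + 2 / L)) (B₀ ^ (-2 + 2 / L)) := by
    rw [e1]
    have hℓp : 0 ≤ ℓ ^ (2 - 2 / L) := Real.rpow_nonneg hls.le _
    -- The sign of the exponent decides whether the lower bound `γ₀` or the upper bound `B₀` on the
    -- normalized margin is needed; hence the maximum in `C_η`.
    rcases le_total 0 (2 - 2 / L) with hp | hp
    · refine le_trans ?_ (mul_le_mul_of_nonneg_left (le_max_left _ _) hℓp)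
      rw [← e0 γ₀ hγ₀]
      exact Real.rpow_le_rpow hrL.le ((le_div_iff₀ hγ₀).mpr (by linarith)) hp
    · refine le_trans ?_ (mul_le_mul_of_nonneg_left (le_max_right _ _) hℓp)
      rw [← e0 B₀ hB₀]
      exact Real.rpow_le_rpow_of_nonpos (div_pos hls hB₀)
        ((div_le_iff₀ hB₀).mpr (by linarith)) hp
  have h4 : r ^ (-L) ≤ ρ₀ ^ (-L) := Real.rpow_le_rpow_of_nonpos hρ₀ hr (by linarith)
  have h5 := mul_log_rpow_le_lrKappa hL hs hsu hu
  have hA : 0 ≤ B₁ ^ 2 + ρ₀ ^ (-L) * B₂ := by positivity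
  have hr2 : 0 ≤ r ^ (2 * L - 2) := Real.rpow_nonneg hr0.le _
  set m := max (γ₀ ^ (-2 + 2 / L)) (B₀ ^ (-2 + 2 / L)) with hm
  have hm0 : 0 ≤ m := (Real.rpow_nonneg hγ₀.le _).trans (le_max_left _ _)
  calc s * (B₁ ^ 2 * r ^ (2 * L - 2) + B₂ * r ^ (L - 2))
      = s * ((B₁ ^ 2 + r ^ (-L) * B₂) * r ^ (2 * L - 2)) := by rw [e2]; ring
    _ ≤ s * ((B₁ ^ 2 + ρ₀ ^ (-L) * B₂) * (ℓ ^ (2 - 2 / L) * m)) := by gcongr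
    _ = (B₁ ^ 2 + ρ₀ ^ (-L) * B₂) * m * (s * ℓ ^ (2 - 2 / L)) := by ring
    _ ≤ (B₁ ^ 2 + ρ₀ ^ (-L) * B₂) * m * lrKappa L u := by gcongr
    _ = _ := by ring

end Kappa

/-! ### Sufficient decrease along a segment by a continuity argument. -/

section OneDimensional

theorem le_add_of_deriv2_le {f f' f'' : ℝ → ℝ} {a M : ℝ} (ha : 0 ≤ a)
    (hf : ∀ s ∈ Icc 0 a, HasDerivAt f (f' s) s) (hf' : ∀ s ∈ Icc 0 a, HasDerivAt f' (f'' s) s)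
    (hM : ∀ s ∈ Icc 0 a, f'' s ≤ M) : f a ≤ f 0 + a * f' 0 + M * a ^ 2 / 2 := by
  have h1 : ∀ s ∈ Icc 0 a, f' s ≤ f' 0 + M * s := by
    have hd : ∀ s ∈ Icc 0 a, HasDerivAt (fun s => f' s - M * s) (f'' s - M) s := fun s hs => by
      simpa using (hf' s hs).fun_sub ((hasDerivAt_id s).const_mul M)
    have hanti := antitoneOn_of_hasDerivWithinAt_nonpos (convex_Icc 0 a)
      (fun s hs => (hd s hs).continuousAt.continuousWithinAt)
      (fun s hs => (hd s (interior_subset hs)).hasDerivWithinAt)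
      (fun s hs => sub_nonpos.mpr (hM s (interior_subset hs)))
    intro s hs
    have := hanti (left_mem_Icc.mpr ha) hs hs.1
    simp only [mul_zero, sub_zero] at this
    linarith
  have hd : ∀ s ∈ Icc 0 a, HasDerivAt (fun s => f s - (s * f' 0 + M * s ^ 2 / 2))
      (f' s - (f' 0 + M * s)) s := fun s hs => by
    refine (hf s hs).fun_sub ((((hasDerivAt_id s).mul_const (f' 0)).fun_add
      ((((hasDerivAt_id s).fun_pow 2).const_mul M).div_const 2)).congr_deriv ?_)
    simp
    ring
  have hanti := antitoneOn_of_hasDerivWithinAt_nonpos (convex_Icc 0 a)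
    (fun s hs => (hd s hs).continuousAt.continuousWithinAt)
    (fun s hs => (hd s (interior_subset hs)).hasDerivWithinAt)
    (fun s hs => sub_nonpos.mpr (h1 s (interior_subset hs)))
  have := hanti (left_mem_Icc.mpr ha) (right_mem_Icc.mpr ha) ha
  simp only [zero_mul, ne_eq, OfNat.ofNat_ne_zero, not_false_eq_true, zero_pow, mul_zero,
    zero_div, add_zero, sub_zero] at this
  linarith

/-- Sufficient decrease along a segment, when the curvature bound is only known at the points where
sufficient decrease holds. -/
theorem forall_le_sub_of_deriv2_le {f f' f'' : ℝ → ℝ} {D m : ℝ} (hD : 0 < D) (hm : 0 < m)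
    (hf : ∀ s ∈ Icc (0 : ℝ) 1, HasDerivAt f (f' s) s)
    (hf' : ∀ s ∈ Icc (0 : ℝ) 1, HasDerivAt f' (f'' s) s) (h0 : f' 0 = -D)
    (hbd : ∀ s ∈ Icc (0 : ℝ) 1, f s ≤ f 0 - s * (1 - m) * D → f'' s ≤ 2 * m * D) :
    ∀ s ∈ Icc (0 : ℝ) 1, f s ≤ f 0 - s * (1 - m) * D := by
  by_contra! hcon
  set g : ℝ → ℝ := fun s => f s - f 0 + s * ((1 - m) * D) with hg
  have hgd : ∀ s ∈ Icc (0 : ℝ) 1, HasDerivAt g (f' s + (1 - m) * D) s := fun s hs => by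
    simpa using ((hf s hs).sub_const (f 0)).fun_add ((hasDerivAt_id s).mul_const ((1 - m) * D))
  have hT : ∀ s, g s ≤ 0 ↔ f s ≤ f 0 - s * (1 - m) * D := fun s => by
    rw [hg]; constructor <;> intro h <;> linarith
  -- `a` is the first time at which sufficient decrease is about to fail. The plan is to show `g <
  -- 0` just to the right of `a`, contradicting the infimum.
  set A := {s | s ∈ Icc (0 : ℝ) 1 ∧ 0 < g s} with hA
  obtain ⟨s₁, hs₁, hs₁A⟩ := hcon
  have hs₁A : s₁ ∈ A := ⟨hs₁, by rw [← not_le, hT, not_le]; exact hs₁A⟩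
  have hbdd : BddBelow A := ⟨0, fun s hs => hs.1.1⟩
  set a := sInf A with ha
  have ha0 : 0 ≤ a := le_csInf ⟨s₁, hs₁A⟩ fun s hs => hs.1.1
  have has₁ : a ≤ s₁ := csInf_le hbdd hs₁A
  have ha1 : a ∈ Icc (0 : ℝ) 1 := ⟨ha0, has₁.trans hs₁.2⟩
  have hlt : ∀ s, 0 ≤ s → s < a → g s ≤ 0 := fun s hs hsa => by
    by_contra hpos
    exact notMem_of_lt_csInf hsa hbdd ⟨⟨hs, hsa.le.trans ha1.2⟩, not_le.mp hpos⟩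
  have hg0 : g 0 = 0 := by simp [hg]
  have hga : g a ≤ 0 := by
    rcases ha0.eq_or_lt with h | h
    · rw [← h, hg0]
    · refine le_of_tendsto ((hgd a ha1).continuousAt.tendsto.mono_left
        (nhdsWithin_le_nhds (s := Iio a))) ?_
      filter_upwards [Ioo_mem_nhdsLT h] with s hs using hlt s hs.1.le hs.2
  have ha_lt : a < 1 := lt_of_lt_of_le (has₁.lt_of_ne fun h => by
    have := hs₁A.2
    rw [← h] at this
    exact hga.not_gt this) hs₁.2
  have hright : ∀ᶠ s in 𝓝[>] a, g s < 0 := by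
    rcases ha0.eq_or_lt with h | h
    · have h1 := (hgd a ha1).tendsto_slope_zero_right
      rw [← h, hg0, h0] at h1
      simp only [zero_add, sub_zero, smul_eq_mul] at h1
      have h2 := h1.eventually_lt_const (u := 0) (by nlinarith)
      rw [← h]
      filter_upwards [h2, self_mem_nhdsWithin] with s hs hs0
      have : (0 : ℝ) < s := hs0
      exact (pos_iff_neg_of_mul_neg hs).mp (inv_pos.mpr this)
    · have hsub : Icc 0 a ⊆ Icc (0 : ℝ) 1 := Icc_subset_Icc_right ha1.2
      have h1 := le_add_of_deriv2_le ha0 (fun s hs => hf s (hsub hs)) (fun s hs => hf' s (hsub hs))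
        (M := 2 * m * D) (fun s hs => hbd s (hsub hs) ((hT s).mp (by
          rcases hs.2.eq_or_lt with h | h
          · rw [h]; exact hga
          · exact hlt s hs.1 h)))
      -- Taylor's bound gives `g a ≤ -m D a (1 - a)`, strictly negative because `0 < a < 1`. The
      -- case `a = 0` used the slope `-m D` of `g` instead.
      have h2 : g a < 0 := by
        have h3 : 0 < m * D * a * (1 - a) := by
          have := sub_pos.mpr ha_lt
          positivity
        rw [h0] at h1
        simp only [hg]
        nlinarith
      exact nhdsWithin_le_nhds ((hgd a ha1).continuousAt.eventually_lt_const h2)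
  obtain ⟨δ, hδ, hsub⟩ := mem_nhdsGT_iff_exists_Ioo_subset.mp hright
  obtain ⟨s, hsA, hsδ⟩ := exists_lt_of_csInf_lt ⟨s₁, hs₁A⟩ (show sInf A < δ from hδ)
  have has : a ≤ s := csInf_le hbdd hsA
  rcases has.eq_or_lt with h | h
  · exact hga.not_gt (h ▸ hsA.2)
  · have h1 : g s < 0 := hsub ⟨h, hsδ⟩
    exact h1.not_gt hsA.2

end OneDimensional

/-! ### Invariants and sufficient decrease for one step of gradient descent. -/

section GradientDescentStep

variable {d N : ℕ} {q : Fin N → EuclideanSpace ℝ (Fin d) → ℝ} {L ℓ₀ ρ₀ Γ₀ : ℝ}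

/-- The standing assumptions on the margins and the reference quantities of gradient descent. -/
structure DescentSetup (q : Fin N → EuclideanSpace ℝ (Fin d) → ℝ) (L ℓ₀ ρ₀ : ℝ) : Prop where
  card_pos : 0 < N
  L_pos : 0 < L
  hom : ∀ n θ α, 0 < α → q n (α • θ) = α ^ L * q n θ
  contDiffOn : ∀ n, ContDiffOn ℝ 2 (q n) {0}ᶜ
  loss_pos : 0 < ℓ₀
  loss_lt : ℓ₀ < 1
  norm_pos : 0 < ρ₀

/-- The invariants of gradient descent: `Γ₀` is a lower bound on the logarithm of the smoothed
normalized margin. -/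
structure IsDescentPoint (q : Fin N → EuclideanSpace ℝ (Fin d) → ℝ) (L ℓ₀ ρ₀ Γ₀ : ℝ)
    (w : EuclideanSpace ℝ (Fin d)) : Prop where
  loss_le : expSum q w ≤ ℓ₀
  norm_ge : ρ₀ ≤ ‖w‖
  margin_ge : Γ₀ + L * logNorm w ≤ lrPhi L ℓ₀ (expSum q w)

/-- The constant `C_η` for a given lower bound on the logarithm of the smoothed margin. -/
noncomputable def descentConst (q : Fin N → EuclideanSpace ℝ (Fin d) → ℝ) (L ρ₀ Γ₀ : ℝ) : ℝ :=
  1 / 2 * (lrB1 q ^ 2 + ρ₀ ^ (-L) * lrB2 q) *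
    max (Real.exp Γ₀ ^ (-2 + 2 / L)) (lrB0 q ^ (-2 + 2 / L))

theorem lrB1_nonneg : 0 ≤ lrB1 q :=
  Real.sSup_nonneg (by rintro _ ⟨n, θ, -, rfl⟩; exact norm_nonneg _)

theorem lrB2_nonneg : 0 ≤ lrB2 q :=
  Real.sSup_nonneg (by rintro _ ⟨n, θ, -, rfl⟩; exact norm_nonneg _)

namespace DescentSetup

variable (hS : DescentSetup q L ℓ₀ ρ₀) {w : EuclideanSpace ℝ (Fin d)}
  (hw : IsDescentPoint q L ℓ₀ ρ₀ Γ₀ w)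
include hS

theorem descentConst_nonneg : 0 ≤ descentConst q L ρ₀ Γ₀ := by
  have h1 := lrB1_nonneg (q := q)
  have h2 := lrB2_nonneg (q := q)
  have h3 := Real.rpow_nonneg hS.norm_pos.le (-L)
  have h4 : 0 ≤ max (Real.exp Γ₀ ^ (-2 + 2 / L)) (lrB0 q ^ (-2 + 2 / L)) :=
    (Real.rpow_nonneg (Real.exp_pos _).le _).trans (le_max_left _ _)
  rw [descentConst]
  positivity

theorem continuousAt (hw0 : w ≠ 0) (n : Fin N) : ContinuousAt (q n) w :=
  ((hS.contDiffOn n).contDiffAt_of_ne_zero hw0).continuousAt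

theorem differentiableAt (hw0 : w ≠ 0) (n : Fin N) : DifferentiableAt ℝ (q n) w :=
  ((hS.contDiffOn n).contDiffAt_of_ne_zero hw0).differentiableAt (by norm_num)

theorem norm_le_lrB1 (n : Fin N) (u : EuclideanSpace ℝ (Fin d)) (hu : ‖u‖ = 1)
    (h : EuclideanSpace ℝ (Fin d)) (hh : h ∈ clarkeSubdifferential (q n) u) : ‖h‖ ≤ lrB1 q := by
  rw [eq_gradient_of_mem_clarkeSubdifferential ((hS.contDiffOn n).contDiffAt_of_ne_zero
    (norm_pos_iff.mp (by rw [hu]; exact one_pos))) hh]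
  exact norm_gradient_le_lrB1 hS.contDiffOn n hu

theorem isNegLossGradient (hw0 : w ≠ 0) : IsNegLossGradient q w (-gradient (expSum q) w) :=
  isNegLossGradient_neg_gradient (hS.differentiableAt hw0)

theorem expSum_pos (w : EuclideanSpace ℝ (Fin d)) : 0 < expSum q w :=
  _root_.expSum_pos hS.card_pos w

include hw

theorem ne_zero : w ≠ 0 := norm_pos_iff.mp (hS.norm_pos.trans_le hw.norm_ge)

theorem expSum_lt_one : expSum q w < 1 := hw.loss_le.trans_lt hS.loss_lt

theorem log_pos : 0 < Real.log (1 / expSum q w) :=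
  log_one_div_pos (hS.expSum_pos w) (hS.expSum_lt_one hw)

theorem exp_mul_norm_rpow_le : Real.exp Γ₀ * ‖w‖ ^ L ≤ Real.log (1 / expSum q w) := by
  have hr : 0 < ‖w‖ := norm_pos_iff.mpr (hS.ne_zero hw)
  rw [Real.rpow_def_of_pos hr, ← Real.exp_add, ← Real.le_log_iff_exp_le (hS.log_pos hw),
    ← logNorm_eq, mul_comm _ L]
  exact hw.margin_ge.trans (lrPhi_le hS.L_pos hS.loss_pos hS.loss_lt (hS.expSum_pos w) hw.loss_le)

theorem log_le : Real.log (1 / expSum q w) ≤ lrB0 q * ‖w‖ ^ L := by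
  rw [one_div, Real.log_inv]
  exact (neg_log_expSum_le hS.card_pos w ⟨0, hS.card_pos⟩).trans
    (le_mul_norm_rpow_of_homogeneous (hS.hom _) (fun u hu => le_lrB0 hS.contDiffOn _ hu)
      (hS.ne_zero hw))

theorem lrB0_pos : 0 < lrB0 q :=
  pos_of_mul_pos_left ((hS.log_pos hw).trans_le (hS.log_le hw)) (Real.rpow_nonneg (norm_nonneg _) _)

/-- `u` will be the loss at the start of a step and `w` any point on its segment, so one learning
rate bound covers the whole segment. -/
theorem curvature_le {u : ℝ} (hu : expSum q w ≤ u) (hu1 : u < 1) :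
    expSum q w * (lrB1 q ^ 2 * ‖w‖ ^ (2 * L - 2) + lrB2 q * ‖w‖ ^ (L - 2)) ≤
      2 * (descentConst q L ρ₀ Γ₀ * lrKappa L u) :=
  mul_rpow_le_two_mul_lrKappa hS.L_pos (hS.expSum_pos w) hu hu1 hS.norm_pos hw.norm_ge
    (Real.exp_pos _) (hS.lrB0_pos hw) lrB2_nonneg (hS.exp_mul_norm_rpow_le hw) (hS.log_le hw)

theorem le_inner : L * (expSum q w * Real.log (1 / expSum q w)) ≤
    inner ℝ (-gradient (expSum q) w) w := by
  rw [one_div, Real.log_inv]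
  exact (hS.isNegLossGradient (hS.ne_zero hw)).le_inner hS.card_pos hS.L_pos hS.hom
    (hS.continuousAt (hS.ne_zero hw))

theorem inner_pos : 0 < inner ℝ (-gradient (expSum q) w) w :=
  (mul_pos hS.L_pos (mul_pos (hS.expSum_pos w) (hS.log_pos hw))).trans_le (hS.le_inner hw)

/-- The squared gradient is at most the loss times the `B₁` part of the curvature bound. The
estimate makes the second-order growth of the norm a small multiple of the radial growth. -/
theorem mul_norm_sq_le {η : ℝ} (hη0 : 0 ≤ η)
    (hη : η * (descentConst q L ρ₀ Γ₀ * lrKappa L (expSum q w)) ≤ lrMu ℓ₀ (expSum q w)) :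
    η * ‖gradient (expSum q) w‖ ^ 2 ≤ 2 * lrMu ℓ₀ (expSum q w) * expSum q w := by
  have hr : 0 < ‖w‖ := norm_pos_iff.mpr (hS.ne_zero hw)
  have h1 := (hS.isNegLossGradient (hS.ne_zero hw)).norm_le hS.hom hS.norm_le_lrB1 (hS.ne_zero hw)
  rw [norm_neg] at h1
  have h2 := hS.curvature_le hw le_rfl (hS.expSum_lt_one hw)
  have hs := hS.expSum_pos w
  have h3 : ‖w‖ ^ (2 * L - 2) = (‖w‖ ^ (L - 1)) ^ 2 := by
    rw [← Real.rpow_natCast, ← Real.rpow_mul hr.le]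
    congr 1
    push_cast
    ring
  have h4 : 0 ≤ lrB2 q * ‖w‖ ^ (L - 2) := mul_nonneg lrB2_nonneg (Real.rpow_nonneg hr.le _)
  have h5 : ‖gradient (expSum q) w‖ ^ 2 ≤
      expSum q w * (expSum q w * (lrB1 q ^ 2 * ‖w‖ ^ (2 * L - 2))) := by
    rw [h3]
    calc ‖gradient (expSum q) w‖ ^ 2 ≤ (expSum q w * (lrB1 q * ‖w‖ ^ (L - 1))) ^ 2 := by gcongr
      _ = _ := by ring
  have h6 : expSum q w * (lrB1 q ^ 2 * ‖w‖ ^ (2 * L - 2)) ≤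
      2 * (descentConst q L ρ₀ Γ₀ * lrKappa L (expSum q w)) := by
    refine le_trans ?_ h2
    gcongr
    linarith
  calc η * ‖gradient (expSum q) w‖ ^ 2
      ≤ η * (expSum q w * (2 * (descentConst q L ρ₀ Γ₀ * lrKappa L (expSum q w)))) :=
        mul_le_mul_of_nonneg_left (h5.trans (mul_le_mul_of_nonneg_left h6 hs.le)) hη0
    _ = 2 * (η * (descentConst q L ρ₀ Γ₀ * lrKappa L (expSum q w))) * expSum q w := by ring
    _ ≤ _ := by gcongr

/-- Discrete counterpart of the growth of the smoothed margin, valid at every point of the segment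
where sufficient decrease holds. Convexity of `φ` converts the decrease of the loss into an increase
of `φ`. -/
theorem mul_logNorm_sub_le {η s c : ℝ} (hη0 : 0 ≤ η)
    (hη : η * (descentConst q L ρ₀ Γ₀ * lrKappa L (expSum q w)) ≤ lrMu ℓ₀ (expSum q w))
    (hs : s ∈ Icc (0 : ℝ) 1) {z v : EuclideanSpace ℝ (Fin d)} (hv : v = -gradient (expSum q) w)
    (hz : z = w + s • (η • v))
    (hT : expSum q z ≤ expSum q w - s * (1 - lrMu ℓ₀ (expSum q w)) * (η * ‖v‖ ^ 2))
    (hc0 : 0 ≤ c) (hc : (1 + c) * inner ℝ v w ^ 2 ≤ ‖v‖ ^ 2 * ‖w‖ ^ 2) :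
    ‖w‖ ^ 2 + 2 * (s * (η * inner ℝ v w)) ≤ ‖z‖ ^ 2 ∧
      L * ((1 + c) * (logNorm z - logNorm w)) ≤
        lrPhi L ℓ₀ (expSum q z) - lrPhi L ℓ₀ (expSum q w) := by
  have hL := hS.L_pos
  have hR : 0 < ‖w‖ ^ 2 := pow_pos (norm_pos_iff.mpr (hS.ne_zero hw)) 2
  have hp := hS.le_inner hw
  have hp0 := hS.inner_pos hw
  have hV := hS.mul_norm_sq_le hw hη0 hη
  rw [← norm_neg (gradient (expSum q) w)] at hV
  rw [← hv] at hp hp0 hV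
  have hu0 := hS.expSum_pos w
  have hz0 := hS.expSum_pos z
  have hℓ := hS.log_pos hw
  have hμ0 := lrMu_pos hS.loss_pos hS.loss_lt hu0 hw.loss_le
  have hμ1 := lrMu_le_half hS.loss_lt hu0 hw.loss_le
  have hZ : ‖z‖ ^ 2 = ‖w‖ ^ 2 + 2 * (s * (η * inner ℝ v w)) + s ^ 2 * (η ^ 2 * ‖v‖ ^ 2) := by
    rw [hz, norm_add_sq_real, norm_smul, norm_smul, real_inner_smul_right, real_inner_smul_right,
      mul_pow, mul_pow, Real.norm_eq_abs, Real.norm_eq_abs, sq_abs, sq_abs, real_inner_comm]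
  have hs0 := hs.1
  refine ⟨by rw [hZ]; linarith [show 0 ≤ s ^ 2 * (η ^ 2 * ‖v‖ ^ 2) by positivity], ?_⟩
  have hconv : lrRate L ℓ₀ (expSum q w) * (expSum q w - expSum q z) ≤
      lrPhi L ℓ₀ (expSum q z) - lrPhi L ℓ₀ (expSum q w) := by
    refine lrRate_mul_sub_le hL hS.loss_pos hS.loss_lt hz0 (hT.trans ?_) hw.loss_le
    have : 0 ≤ s * (1 - lrMu ℓ₀ (expSum q w)) * (η * ‖v‖ ^ 2) :=
      mul_nonneg (mul_nonneg hs0 (by linarith)) (by positivity)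
    linarith
  refine le_trans ?_ hconv
  have hlog : logNorm z - logNorm w ≤
      (s * (η * inner ℝ v w) + s ^ 2 * (η ^ 2 * ‖v‖ ^ 2) / 2) / ‖w‖ ^ 2 := by
    have hZ0 : 0 < ‖z‖ ^ 2 := by rw [hZ]; positivity
    have h1 := Real.log_le_sub_one_of_pos (div_pos hZ0 hR)
    rw [Real.log_div hZ0.ne' hR.ne'] at h1
    have h2 : ‖z‖ ^ 2 / ‖w‖ ^ 2 - 1 =
        2 * ((s * (η * inner ℝ v w) + s ^ 2 * (η ^ 2 * ‖v‖ ^ 2) / 2) / ‖w‖ ^ 2) := by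
      rw [hZ, add_assoc, add_div, div_self hR.ne']
      ring
    rw [h2] at h1
    simp only [logNorm]
    linarith
  have hrate : lrRate L ℓ₀ (expSum q w) = (1 + 2 * (1 + (Real.log (1 / expSum q w))⁻¹ / L) *
      lrMu ℓ₀ (expSum q w)) / (expSum q w * Real.log (1 / expSum q w)) := rfl
  generalize lrMu ℓ₀ (expSum q w) = μ at *
  generalize Real.log (1 / expSum q w) = ℓ at *
  generalize (inner ℝ v w : ℝ) = p at *
  have key := mul_div_le_div_of_le hL hu0 hℓ hR hp hc hc0
  -- `t` is the relative cost of the quadratic term in `‖z‖²`, since `η ‖v‖² / 2 ≤ μ S ≤ t p`.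
  set t := ℓ⁻¹ / L * μ with ht
  have ht0 : 0 ≤ t := by positivity
  have h1 : logNorm z - logNorm w ≤ s * η * (1 + t) * (p / ‖w‖ ^ 2) := by
    refine hlog.trans ?_
    rw [mul_div_assoc', div_le_div_iff_of_pos_right hR]
    have h2 : η * ‖v‖ ^ 2 / 2 ≤ t * p := by
      have h3 : μ * expSum q w ≤ t * p := by
        have h4 := mul_le_mul_of_nonneg_left hp ht0
        have h5 : t * (L * (expSum q w * ℓ)) = μ * expSum q w := by rw [ht]; field_simp
        linarith
      linarith
    have h6 : s ^ 2 * (η ^ 2 * ‖v‖ ^ 2) / 2 ≤ s * η * (t * p) := by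
      have h7 : s ^ 2 * (η ^ 2 * ‖v‖ ^ 2) / 2 = s * (s * η * (η * ‖v‖ ^ 2 / 2)) := by ring
      rw [h7]
      refine (mul_le_of_le_one_left (by positivity) hs.2).trans ?_
      gcongr
    linarith
  -- The numerator `1 + 2μ + 2t` of the rate pays for both losses, the factor `1 - μ` in the
  -- decrease and the factor `1 + t` in the growth, because `μ ≤ 1/2`.
  have h2 : 1 + t ≤ (1 + 2 * (1 + ℓ⁻¹ / L) * μ) * (1 - μ) := by
    have h3 : (1 + 2 * (1 + ℓ⁻¹ / L) * μ) = 1 + 2 * μ + 2 * t := by rw [ht]; ring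
    rw [h3]
    nlinarith [mul_nonneg ht0 (by linarith : 0 ≤ 1 - 2 * μ), mul_nonneg hμ0.le
      (by linarith : 0 ≤ 1 - 2 * μ)]
  calc L * ((1 + c) * (logNorm z - logNorm w))
      ≤ L * ((1 + c) * (s * η * (1 + t) * (p / ‖w‖ ^ 2))) := by gcongr
    _ = s * η * (1 + t) * (L * ((1 + c) * (p / ‖w‖ ^ 2))) := by ring
    _ ≤ s * η * (1 + t) * (‖v‖ ^ 2 / (expSum q w * ℓ)) := by gcongr
    _ ≤ s * η * ((1 + 2 * (1 + ℓ⁻¹ / L) * μ) * (1 - μ)) * (‖v‖ ^ 2 / (expSum q w * ℓ)) := by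
        gcongr
    _ = lrRate L ℓ₀ (expSum q w) * (s * (1 - μ) * (η * ‖v‖ ^ 2)) := by rw [hrate]; ring
    _ ≤ lrRate L ℓ₀ (expSum q w) * (expSum q w - expSum q z) := by
        have h3 : 0 ≤ lrRate L ℓ₀ (expSum q w) := by rw [hrate]; positivity
        exact mul_le_mul_of_nonneg_left (by linarith) h3

/-- Sufficient decrease at a point of the segment carries the invariants there, which is half of the
circular dependence resolved by the continuity argument. -/
theorem isDescentPoint_of_le {η s : ℝ} (hη0 : 0 ≤ η)
    (hη : η * (descentConst q L ρ₀ Γ₀ * lrKappa L (expSum q w)) ≤ lrMu ℓ₀ (expSum q w))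
    (hs : s ∈ Icc (0 : ℝ) 1) {z v : EuclideanSpace ℝ (Fin d)} (hv : v = -gradient (expSum q) w)
    (hz : z = w + s • (η • v))
    (hT : expSum q z ≤ expSum q w - s * (1 - lrMu ℓ₀ (expSum q w)) * (η * ‖v‖ ^ 2)) :
    expSum q z ≤ expSum q w ∧ IsDescentPoint q L ℓ₀ ρ₀ Γ₀ z := by
  have h1 := hS.mul_logNorm_sub_le hw hη0 hη hs hv hz hT le_rfl (by
    have := abs_real_inner_le_norm v w
    rw [add_zero, one_mul, ← mul_pow, ← sq_abs]
    gcongr)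
  have hμ1 := lrMu_le_half hS.loss_lt (hS.expSum_pos w) hw.loss_le
  have hle : expSum q z ≤ expSum q w := by
    have : 0 ≤ s * (1 - lrMu ℓ₀ (expSum q w)) * (η * ‖v‖ ^ 2) :=
      mul_nonneg (mul_nonneg hs.1 (by linarith)) (by positivity)
    linarith
  have hp0 := hS.inner_pos hw
  rw [← hv] at hp0
  refine ⟨hle, hle.trans hw.loss_le, ?_, ?_⟩
  · have h2 : ‖w‖ ^ 2 ≤ ‖z‖ ^ 2 := by
      have := hs.1
      linarith [h1.1, show 0 ≤ 2 * (s * (η * inner ℝ v w)) by positivity]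
    exact hw.norm_ge.trans ((pow_le_pow_iff_left₀ (norm_nonneg _) (norm_nonneg _) two_ne_zero).mp h2)
  · have h2 := h1.2
    have h3 := hw.margin_ge
    rw [add_zero, one_mul] at h2
    linarith

/-- Sufficient decrease in one step of gradient descent. -/
theorem expSum_step_le {η : ℝ} (hη0 : 0 ≤ η)
    (hη : η * (descentConst q L ρ₀ Γ₀ * lrKappa L (expSum q w)) ≤ lrMu ℓ₀ (expSum q w))
    {v : EuclideanSpace ℝ (Fin d)} (hv : v = -gradient (expSum q) w) :
    expSum q (w + η • v) ≤ expSum q w - (1 - lrMu ℓ₀ (expSum q w)) * (η * ‖v‖ ^ 2) := by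
  rcases hη0.eq_or_lt with rfl | hη_pos
  · simp
  have hw0 := hS.ne_zero hw
  have hp0 := hS.inner_pos hw
  rw [← hv] at hp0
  have hv0 : 0 < ‖v‖ := norm_pos_iff.mpr (by rintro rfl; simp at hp0)
  have hμ0 := lrMu_pos hS.loss_pos hS.loss_lt (hS.expSum_pos w) hw.loss_le
  -- The margins are smooth only off the origin; the segment avoids it since the inner product with
  -- `v` stays positive.
  have hne : ∀ s ∈ Icc (0 : ℝ) 1, w + s • (η • v) ≠ 0 := fun s hs h => by
    have h1 : inner ℝ v (w + s • (η • v)) = 0 := by rw [h, inner_zero_right]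
    rw [inner_add_right, real_inner_smul_right, real_inner_smul_right,
      real_inner_self_eq_norm_sq] at h1
    have := hs.1
    linarith [show 0 ≤ s * (η * ‖v‖ ^ 2) by positivity]
  have h0 : expSumDeriv q w (η • v) 0 = -(η * ‖v‖ ^ 2) := by
    have h1 : HasDerivAt (fun s : ℝ => expSum q (w + s • (η • v)))
        (inner ℝ (gradient (expSum q) w) (η • v)) 0 := by
      have h2 := (hasGradientAt_expSum (hS.differentiableAt hw0)).differentiableAt
      have := hasDerivAt_comp_line (u := w) (v := η • v) (s := 0) (f := expSum q) (by simpa using h2)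
      simpa using this
    rw [(hasDerivAt_expSum_line hS.contDiffOn (hne 0 ⟨le_rfl, zero_le_one⟩)).unique h1,
      real_inner_smul_right, ← neg_neg (gradient (expSum q) w), ← hv, inner_neg_left,
      real_inner_self_eq_norm_sq]
    ring
  -- Where decrease is already known, the invariants hold and give the curvature bound, as the
  -- one-dimensional lemma requires.
  have hmain := forall_le_sub_of_deriv2_le (f := fun s => expSum q (w + s • (η • v)))
    (D := η * ‖v‖ ^ 2) (by positivity) hμ0
    (fun s hs => hasDerivAt_expSum_line hS.contDiffOn (hne s hs))
    (fun s hs => hasDerivAt_expSumDeriv hS.contDiffOn (hne s hs)) h0 (fun s hs hT => by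
      simp only [zero_smul, add_zero] at hT
      obtain ⟨hle, hz⟩ := hS.isDescentPoint_of_le hw hη0 hη hs hv rfl hT
      refine (expSumDeriv2_le hS.hom hS.contDiffOn
        (fun n u hu => norm_gradient_le_lrB1 hS.contDiffOn n hu)
        (fun n u hu => norm_fderiv_gradient_le_lrB2 hS.contDiffOn n hu) (hne s hs)).trans ?_
      have h1 := hS.curvature_le hz hle (hS.expSum_lt_one hw)
      rw [norm_smul, mul_pow, Real.norm_eq_abs, sq_abs]
      calc _ ≤ 2 * (descentConst q L ρ₀ Γ₀ * lrKappa L (expSum q w)) * (η ^ 2 * ‖v‖ ^ 2) := by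
            gcongr
        _ = 2 * (η * (descentConst q L ρ₀ Γ₀ * lrKappa L (expSum q w))) * (η * ‖v‖ ^ 2) := by
            ring
        _ ≤ _ := by gcongr)
  have := hmain 1 ⟨zero_le_one, le_rfl⟩
  simpa using this

end DescentSetup

end GradientDescentStep

/-! ### Long-time behaviour and limit directions of gradient descent. -/

section GradientDescentLimit

variable {d N : ℕ} {q : Fin N → EuclideanSpace ℝ (Fin d) → ℝ} {L ℓ₀ ρ₀ Γ₀ : ℝ}

/-- A bound on the relative change of the direction in a step of gradient descent. -/
theorem DescentSetup.exists_norm_normalize_sub_le (hS : DescentSetup q L ℓ₀ ρ₀) (Γ₀ : ℝ) :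
    ∃ K : ℝ, 0 ≤ K ∧ ∀ w, IsDescentPoint q L ℓ₀ ρ₀ Γ₀ w → ∀ η : ℝ, 0 ≤ η →
      η * (descentConst q L ρ₀ Γ₀ * lrKappa L (expSum q w)) ≤ lrMu ℓ₀ (expSum q w) →
      ∀ v, v = -gradient (expSum q) w →
        ‖w‖ ^ 2 + 2 * (η * inner ℝ v w) ≤ ‖w + η • v‖ ^ 2 →
        ‖‖w + η • v‖⁻¹ • (w + η • v) - ‖w‖⁻¹ • w‖ ≤ K * (logNorm (w + η • v) - logNorm w) := by
  have hL := hS.L_pos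
  have hℓ0 := log_one_div_pos hS.loss_pos hS.loss_lt
  -- `Q` compares the full gradient with its radial part, and `D` bounds the relative step length `η
  -- ‖v‖ / ‖w‖`, so one step enlarges the norm by at most the factor `1 + D`.
  set Q := lrB1 q / (L * Real.exp Γ₀) with hQ
  set D := 1 / (L * Real.log (1 / ℓ₀)) with hD
  have hQ0 : 0 ≤ Q := div_nonneg lrB1_nonneg (by positivity)
  have hD0 : 0 ≤ D := by positivity
  refine ⟨Q * (1 + D) + 1, by positivity, fun w hw η hη0 hη v hv hgrow => ?_⟩
  have hw0 := hS.ne_zero hw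
  have hr : 0 < ‖w‖ := norm_pos_iff.mpr hw0
  have hp := hS.le_inner hw
  have hp0 := hS.inner_pos hw
  have hV := hS.mul_norm_sq_le hw hη0 hη
  have hQp := (hS.isNegLossGradient hw0).norm_div_le hS.card_pos hL hS.hom
    (hS.continuousAt hw0) lrB1_nonneg hS.norm_le_lrB1 (Real.exp_pos Γ₀) hw0
    (by rw [← Real.log_inv, ← one_div]; exact hS.exp_mul_norm_rpow_le hw)
  rw [← norm_neg (gradient (expSum q) w)] at hV
  rw [← hv] at hp hp0 hV hQp
  rw [← hQ] at hQp
  have hu0 := hS.expSum_pos w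
  have hμ1 := lrMu_le_half hS.loss_lt hu0 hw.loss_le
  have hℓ := log_one_div_anti hu0 hw.loss_le
  have hv0 : 0 < ‖v‖ := norm_pos_iff.mpr (by rintro rfl; simp at hp0)
  have hD1 : η * ‖v‖ ≤ D * ‖w‖ := by
    have h1 : η * ‖v‖ ^ 2 ≤ expSum q w := hV.trans (by nlinarith)
    have h2 : L * (expSum q w * Real.log (1 / ℓ₀)) ≤ ‖v‖ * ‖w‖ := by
      refine le_trans ?_ (hp.trans (real_inner_le_norm v w))
      gcongr
    have h3 : (η * ‖v‖) * (L * Real.log (1 / ℓ₀)) ≤ ‖w‖ := by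
      refine le_of_mul_le_mul_left ?_ hv0
      calc ‖v‖ * (η * ‖v‖ * (L * Real.log (1 / ℓ₀)))
          = L * (η * ‖v‖ ^ 2 * Real.log (1 / ℓ₀)) := by ring
        _ ≤ L * (expSum q w * Real.log (1 / ℓ₀)) := by gcongr
        _ ≤ _ := h2
    rwa [hD, one_div_mul_eq_div, le_div_iff₀ (by positivity)]
  have hle : ‖w‖ ≤ ‖w + η • v‖ := by
    refine (pow_le_pow_iff_left₀ (norm_nonneg _) (norm_nonneg _) two_ne_zero).mp ?_
    linarith [show 0 ≤ 2 * (η * inner ℝ v w) by positivity]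
  have hle' : ‖w + η • v‖ ≤ (1 + D) * ‖w‖ := by
    refine (norm_add_le _ _).trans ?_
    rw [norm_smul, Real.norm_eq_abs, abs_of_nonneg hη0]
    linarith
  have hr' : 0 < ‖w + η • v‖ := hr.trans_le hle
  have hsplit : ‖w + η • v‖⁻¹ • (w + η • v) - ‖w‖⁻¹ • w =
      ‖w + η • v‖⁻¹ • (η • v) - (‖w‖⁻¹ - ‖w + η • v‖⁻¹) • w := by
    rw [smul_add, sub_smul]
    abel
  have hlog : 1 - ‖w‖ / ‖w + η • v‖ ≤ logNorm (w + η • v) - logNorm w := by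
    have := Real.one_sub_inv_le_log_of_pos (div_pos hr' hr)
    rwa [inv_div, Real.log_div hr'.ne' hr.ne', ← logNorm_eq, ← logNorm_eq] at this
  refine le_trans ?_ (mul_le_mul_of_nonneg_left hlog (by positivity))
  have h1 : ‖(‖w‖⁻¹ - ‖w + η • v‖⁻¹) • w‖ = 1 - ‖w‖ / ‖w + η • v‖ := by
    rw [norm_smul, Real.norm_eq_abs, abs_of_nonneg
      (sub_nonneg.mpr (inv_anti₀ hr hle)), sub_mul, inv_mul_cancel₀ hr.ne', inv_mul_eq_div]
  have h2 : ‖‖w + η • v‖⁻¹ • (η • v)‖ ≤ Q * (1 + D) * (1 - ‖w‖ / ‖w + η • v‖) := by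
    rw [norm_smul, norm_smul, norm_inv, norm_norm, Real.norm_eq_abs, abs_of_nonneg hη0,
      inv_mul_le_iff₀ hr']
    have h3 : ‖w + η • v‖ * (Q * (1 + D) * (1 - ‖w‖ / ‖w + η • v‖)) =
        Q * (1 + D) * (‖w + η • v‖ - ‖w‖) := by
      field_simp
    rw [h3]
    -- From `2 η ⟨v, w⟩ ≤ ‖w + η v‖² - ‖w‖²`, a difference of squares whose sum factor is at most `2
    -- ‖w + η v‖`.
    have h4 : η * inner ℝ v w ≤ (‖w + η • v‖ - ‖w‖) * ‖w + η • v‖ := by nlinarith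
    have h5 : ‖v‖ * ‖w‖ ≤ Q * inner ℝ v w := by
      rw [div_le_iff₀ hr] at hQp
      calc ‖v‖ * ‖w‖ ≤ Q * (inner ℝ v w / ‖w‖ ^ 2) * ‖w‖ * ‖w‖ := by gcongr
        _ = Q * inner ℝ v w := by field_simp
    refine le_of_mul_le_mul_right ?_ hr
    calc η * ‖v‖ * ‖w‖ = η * (‖v‖ * ‖w‖) := by ring
      _ ≤ η * (Q * inner ℝ v w) := by gcongr
      _ = Q * (η * inner ℝ v w) := by ring
      _ ≤ Q * ((‖w + η • v‖ - ‖w‖) * ‖w + η • v‖) := by gcongr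
      _ ≤ Q * ((‖w + η • v‖ - ‖w‖) * ((1 + D) * ‖w‖)) := by
          have := sub_nonneg.mpr hle
          gcongr
      _ = _ := by ring
  rw [hsplit]
  refine (norm_sub_le _ _).trans ?_
  rw [h1]
  linarith

/-- Gradient descent on `expSum q` that satisfies the learning rate condition from `t₀` on. -/
structure IsDescentSequence (q : Fin N → EuclideanSpace ℝ (Fin d) → ℝ) (L ℓ₀ ρ₀ Γ₀ : ℝ)
    (η : ℕ → ℝ) (z : ℕ → EuclideanSpace ℝ (Fin d)) (t₀ : ℕ) : Prop where
  setup : DescentSetup q L ℓ₀ ρ₀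
  step : ∀ t, z (t + 1) = z t + η t • -gradient (expSum q) (z t)
  rate_nonneg : ∀ t, 0 ≤ η t
  tendsto_sum : Tendsto (fun T => ∑ t ∈ Finset.range T, η t) atTop atTop
  rate_le : ∀ t, t₀ ≤ t → expSum q (z t) ≤ ℓ₀ →
    η t * (descentConst q L ρ₀ Γ₀ * lrKappa L (expSum q (z t))) ≤ lrMu ℓ₀ (expSum q (z t))
  isDescentPoint_initial : IsDescentPoint q L ℓ₀ ρ₀ Γ₀ (z t₀)

namespace IsDescentSequence

variable {η : ℕ → ℝ} {z : ℕ → EuclideanSpace ℝ (Fin d)} {t₀ : ℕ}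
  (h : IsDescentSequence q L ℓ₀ ρ₀ Γ₀ η z t₀)
include h

/-- The factor `1` is the segment parameter at the end of the step, kept to match the segment
lemmas. -/
theorem expSum_succ_le_of_isDescentPoint {t : ℕ} (ht : t₀ ≤ t)
    (hw : IsDescentPoint q L ℓ₀ ρ₀ Γ₀ (z t)) :
    expSum q (z (t + 1)) ≤ expSum q (z t) - 1 * (1 - lrMu ℓ₀ (expSum q (z t))) *
      (η t * ‖-gradient (expSum q) (z t)‖ ^ 2) := by
  rw [h.step, one_mul]
  exact h.setup.expSum_step_le hw (h.rate_nonneg t) (h.rate_le t ht hw.loss_le) rfl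

theorem isDescentPoint {t : ℕ} (ht : t₀ ≤ t) : IsDescentPoint q L ℓ₀ ρ₀ Γ₀ (z t) := by
  induction t, ht using Nat.le_induction with
  | base => exact h.isDescentPoint_initial
  | succ t ht ih =>
    exact (h.setup.isDescentPoint_of_le ih (h.rate_nonneg t) (h.rate_le t ht ih.loss_le)
      ⟨zero_le_one, le_rfl⟩ rfl (by rw [one_smul]; exact h.step t) (h.expSum_succ_le_of_isDescentPoint ht ih)).2

theorem ne_zero {t : ℕ} (ht : t₀ ≤ t) : z t ≠ 0 := h.setup.ne_zero (h.isDescentPoint ht)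

theorem expSum_succ_le {t : ℕ} (ht : t₀ ≤ t) :
    expSum q (z (t + 1)) ≤ expSum q (z t) - η t * ‖gradient (expSum q) (z t)‖ ^ 2 / 2 := by
  have hw := h.isDescentPoint ht
  have h1 := h.expSum_succ_le_of_isDescentPoint ht hw
  rw [norm_neg] at h1
  have hμ1 := lrMu_le_half h.setup.loss_lt (h.setup.expSum_pos (z t)) hw.loss_le
  have := h.rate_nonneg t
  nlinarith [show 0 ≤ η t * ‖gradient (expSum q) (z t)‖ ^ 2 by positivity]

theorem growth {t : ℕ} (ht : t₀ ≤ t) {c : ℝ} (hc0 : 0 ≤ c)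
    (hc : (1 + c) * inner ℝ (-gradient (expSum q) (z t)) (z t) ^ 2 ≤
      ‖-gradient (expSum q) (z t)‖ ^ 2 * ‖z t‖ ^ 2) :
    ‖z t‖ ^ 2 + 2 * (η t * inner ℝ (-gradient (expSum q) (z t)) (z t)) ≤ ‖z (t + 1)‖ ^ 2 ∧
      L * ((1 + c) * (logNorm (z (t + 1)) - logNorm (z t))) ≤
        lrPhi L ℓ₀ (expSum q (z (t + 1))) - lrPhi L ℓ₀ (expSum q (z t)) := by
  have hw := h.isDescentPoint ht
  have h1 := h.setup.mul_logNorm_sub_le hw (h.rate_nonneg t) (h.rate_le t ht hw.loss_le)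
    ⟨zero_le_one, le_rfl⟩ rfl (by rw [one_smul]; exact h.step t)
    (h.expSum_succ_le_of_isDescentPoint ht hw) hc0 hc
  rwa [one_mul] at h1

theorem growth_zero {t : ℕ} (ht : t₀ ≤ t) :
    ‖z t‖ ^ 2 + 2 * (η t * inner ℝ (-gradient (expSum q) (z t)) (z t)) ≤ ‖z (t + 1)‖ ^ 2 ∧
      L * (logNorm (z (t + 1)) - logNorm (z t)) ≤
        lrPhi L ℓ₀ (expSum q (z (t + 1))) - lrPhi L ℓ₀ (expSum q (z t)) := by
  have h1 := h.growth ht le_rfl (by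
    rw [add_zero, one_mul, ← mul_pow, ← sq_abs]
    exact pow_le_pow_left₀ (abs_nonneg _) (abs_real_inner_le_norm _ _) 2)
  rwa [add_zero, one_mul] at h1

theorem antitoneOn_expSum : AntitoneOn (fun t => expSum q (z t)) (Ici t₀) := by
  intro a ha b hb hab
  induction b, hab using Nat.le_induction with
  | base => exact le_rfl
  | succ t hat ih =>
    have ht : t₀ ≤ t := le_trans ha hat
    have h1 := h.expSum_succ_le ht
    have := h.rate_nonneg t
    have : 0 ≤ η t * ‖gradient (expSum q) (z t)‖ ^ 2 / 2 := by positivity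
    have := ih ht
    simp only at this ⊢
    linarith

theorem monotoneOn_margin :
    MonotoneOn (fun t => lrPhi L ℓ₀ (expSum q (z t)) - L * logNorm (z t)) (Ici t₀) := by
  intro a ha b hb hab
  induction b, hab using Nat.le_induction with
  | base => exact le_rfl
  | succ t hat ih =>
    have ht : t₀ ≤ t := le_trans ha hat
    have h1 := (h.growth_zero ht).2
    have := ih ht
    simp only at this ⊢
    linarith

theorem lrPhi_le_log_log {t : ℕ} (ht : t₀ ≤ t) :
    lrPhi L ℓ₀ (expSum q (z t)) ≤ Real.log (Real.log (1 / expSum q (z t))) :=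
  lrPhi_le h.setup.L_pos h.setup.loss_pos h.setup.loss_lt (h.setup.expSum_pos _)
    (h.isDescentPoint ht).loss_le

theorem log_log_le {t : ℕ} (ht : t₀ ≤ t) :
    Real.log (Real.log (1 / expSum q (z t))) ≤ Real.log (lrB0 q) + L * logNorm (z t) := by
  have hw := h.isDescentPoint ht
  have hr : 0 < ‖z t‖ := norm_pos_iff.mpr (h.ne_zero ht)
  have h1 := Real.log_le_log (h.setup.log_pos hw) (h.setup.log_le hw)
  rwa [Real.log_mul (h.setup.lrB0_pos hw).ne' (Real.rpow_pos_of_pos hr L).ne', Real.log_rpow hr,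
    ← logNorm_eq] at h1

theorem exists_expSum_lt {ε : ℝ} (hε : 0 < ε) : ∃ T, t₀ ≤ T ∧ expSum q (z T) < ε := by
  by_contra! hcon
  have hL := h.setup.L_pos
  have hℓ0 := log_one_div_pos h.setup.loss_pos h.setup.loss_lt
  -- If the loss stays above `ε`, the margin invariant bounds `‖z‖²` by `R`. The gradient is then
  -- bounded below, and the divergent sum of the rates drives the loss below zero.
  set R := Real.exp (2 * ((Real.log (Real.log (1 / ε)) - Γ₀) / L)) with hR
  set δ := (L * (ε * Real.log (1 / ℓ₀))) ^ 2 / R / 2 with hδ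
  have hδ0 : 0 < δ := by positivity
  have hdec : ∀ t, t₀ ≤ t → expSum q (z (t + 1)) ≤ expSum q (z t) - δ * η t := by
    intro t ht
    have hw := h.isDescentPoint ht
    have hr : 0 < ‖z t‖ := norm_pos_iff.mpr (h.ne_zero ht)
    have hR1 : ‖z t‖ ^ 2 ≤ R := by
      have h1 := hw.margin_ge.trans (h.lrPhi_le_log_log ht)
      have h2 := Real.log_le_log (h.setup.log_pos hw) (log_one_div_anti hε (hcon t ht))
      have h3 : logNorm (z t) ≤ (Real.log (Real.log (1 / ε)) - Γ₀) / L := by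
        rw [le_div_iff₀ hL]
        linarith
      rw [hR, ← Real.log_le_iff_le_exp (by positivity)]
      rw [logNorm] at h3
      linarith
    have h1 : L * (ε * Real.log (1 / ℓ₀)) ≤ ‖gradient (expSum q) (z t)‖ * ‖z t‖ := by
      rw [← norm_neg (gradient (expSum q) (z t))]
      refine le_trans ?_ ((h.setup.le_inner hw).trans (real_inner_le_norm _ _))
      have h3 := h.setup.expSum_pos (z t)
      exact mul_le_mul_of_nonneg_left (mul_le_mul (hcon t ht) (log_one_div_anti h3 hw.loss_le)
        hℓ0.le h3.le) hL.le
    have h2 : (L * (ε * Real.log (1 / ℓ₀))) ^ 2 / R ≤ ‖gradient (expSum q) (z t)‖ ^ 2 := by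
      rw [div_le_iff₀ (Real.exp_pos _)]
      calc (L * (ε * Real.log (1 / ℓ₀))) ^ 2 ≤ (‖gradient (expSum q) (z t)‖ * ‖z t‖) ^ 2 := by
            gcongr
        _ = ‖gradient (expSum q) (z t)‖ ^ 2 * ‖z t‖ ^ 2 := mul_pow _ _ _
        _ ≤ _ := by gcongr
    have h3 : δ * η t ≤ η t * ‖gradient (expSum q) (z t)‖ ^ 2 / 2 := by
      have := mul_le_mul_of_nonneg_left h2 (h.rate_nonneg t)
      rw [hδ]
      linarith
    linarith [h.expSum_succ_le ht]
  have hsum : ∀ t, t₀ ≤ t → expSum q (z t) + δ * ∑ s ∈ Finset.range t, η s ≤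
      expSum q (z t₀) + δ * ∑ s ∈ Finset.range t₀, η s := by
    intro t ht
    induction t, ht using Nat.le_induction with
    | base => exact le_rfl
    | succ t ht ih =>
      rw [Finset.sum_range_succ, mul_add]
      linarith [hdec t ht]
  obtain ⟨t, ht, hlarge⟩ := ((eventually_ge_atTop t₀).and ((h.tendsto_sum.const_mul_atTop
    hδ0).eventually_gt_atTop (expSum q (z t₀) + δ * ∑ s ∈ Finset.range t₀, η s))).exists
  linarith [hsum t ht, h.setup.expSum_pos (z t)]

theorem exists_forall_le_neg_log_expSum (M : ℝ) :
    ∃ T, t₀ ≤ T ∧ ∀ t, T ≤ t → M ≤ -Real.log (expSum q (z t)) := by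
  obtain ⟨T, hT, hlt⟩ := h.exists_expSum_lt (Real.exp_pos (-M))
  refine ⟨T, hT, fun t ht => ?_⟩
  have h1 : expSum q (z t) ≤ Real.exp (-M) :=
    (h.antitoneOn_expSum hT (hT.trans ht) ht).trans hlt.le
  have := (Real.log_le_iff_le_exp (h.setup.expSum_pos _)).mpr h1
  linarith

theorem exists_le_logNorm (M : ℝ) : ∃ T, t₀ ≤ T ∧ ∀ t, T ≤ t → M ≤ logNorm (z t) := by
  have hL := h.setup.L_pos
  obtain ⟨T, hT, hlarge⟩ :=
    h.exists_forall_le_neg_log_expSum (Real.exp (Real.log (lrB0 q) + L * M))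
  refine ⟨T, hT, fun t ht => ?_⟩
  have htt := hT.trans ht
  have h1 := h.log_log_le htt
  have h2 := (Real.le_log_iff_exp_le (neg_log_expSum_pos h.setup.card_pos
    (h.setup.expSum_lt_one (h.isDescentPoint htt)))).mpr (hlarge t ht)
  rw [one_div, Real.log_inv] at h1
  have h3 : L * M ≤ L * logNorm (z t) := by linarith
  exact le_of_mul_le_mul_left h3 hL

theorem exists_norm_normalize_sub_le : ∃ K : ℝ, 0 ≤ K ∧ ∀ a b, t₀ ≤ a → a ≤ b →
    ‖‖z b‖⁻¹ • z b - ‖z a‖⁻¹ • z a‖ ≤ K * (logNorm (z b) - logNorm (z a)) := by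
  obtain ⟨K, hK0, hK⟩ := h.setup.exists_norm_normalize_sub_le Γ₀
  refine ⟨K, hK0, fun a b ha hab => ?_⟩
  induction b, hab using Nat.le_induction with
  | base => simp
  | succ t hat ih =>
    have ht : t₀ ≤ t := le_trans ha hat
    have hw := h.isDescentPoint ht
    have h1 := hK (z t) hw (η t) (h.rate_nonneg t) (h.rate_le t ht hw.loss_le) _ rfl
      (by rw [← h.step]; exact (h.growth_zero ht).1)
    rw [← h.step] at h1
    calc _ = ‖(‖z (t + 1)‖⁻¹ • z (t + 1) - ‖z t‖⁻¹ • z t) +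
          (‖z t‖⁻¹ • z t - ‖z a‖⁻¹ • z a)‖ := by rw [sub_add_sub_cancel]
      _ ≤ _ := (norm_add_le _ _).trans (by linarith)

/-- Shortly (in terms of the logarithm of the norm) after each late time there is a time at which
the gradient is almost radial. -/
theorem exists_time_of_late {c Δ : ℝ} (hc0 : 0 < c) (hΔ : 0 < Δ) :
    ∃ T, t₀ ≤ T ∧ ∀ t, T ≤ t → ∃ s, t ≤ s ∧ logNorm (z s) - logNorm (z t) ≤ Δ ∧
      ‖-gradient (expSum q) (z s)‖ ^ 2 * ‖z s‖ ^ 2 ≤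
        (1 + c) * inner ℝ (-gradient (expSum q) (z s)) (z s) ^ 2 := by
  have hL := h.setup.L_pos
  obtain ⟨T, hT, hsmall⟩ := exists_forall_sub_lt_of_monotoneOn_Ici h.monotoneOn_margin
    (M := Real.log (lrB0 q))
    (fun t ht => by linarith [h.lrPhi_le_log_log ht, h.log_log_le ht])
    (by positivity : 0 < L * c * Δ)
  refine ⟨T, hT, fun t ht => ?_⟩
  have htt := hT.trans ht
  by_contra! hcon
  -- In discrete time no iterate need sit at the end of the window, so both bounds are carried by
  -- one induction: the margin has less than `L c Δ` left to gain, so the log-norm never leaves the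
  -- window, contradicting its divergence.
  have hgain : ∀ s, t ≤ s → L * c * (logNorm (z s) - logNorm (z t)) ≤
      (lrPhi L ℓ₀ (expSum q (z s)) - L * logNorm (z s)) -
        (lrPhi L ℓ₀ (expSum q (z t)) - L * logNorm (z t)) ∧
        logNorm (z s) - logNorm (z t) ≤ Δ := by
    intro s hs
    induction s, hs using Nat.le_induction with
    | base => simp [hΔ.le]
    | succ s hs ih =>
      have h1 := (h.growth (htt.trans hs) hc0.le (hcon s hs ih.2).le).2
      have h2 : L * c * (logNorm (z (s + 1)) - logNorm (z t)) ≤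
          (lrPhi L ℓ₀ (expSum q (z (s + 1))) - L * logNorm (z (s + 1))) -
            (lrPhi L ℓ₀ (expSum q (z t)) - L * logNorm (z t)) := by
        linarith [ih.1]
      have h3 := hsmall t (s + 1) ht (hs.trans s.le_succ)
      exact ⟨h2, le_of_mul_le_mul_left (h2.trans h3.le) (by positivity : 0 < L * c)⟩
  obtain ⟨T', -, hlarge⟩ := h.exists_le_logNorm (logNorm (z t) + Δ + 1)
  linarith [(hgain (max t T') (le_max_left _ _)).2, hlarge _ (le_max_right t T')]

/-- Limit directions of gradient descent are along KKT directions. -/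
theorem exists_isKKTPoint_smul {θ : EuclideanSpace ℝ (Fin d)}
    (hθ : MapClusterPt θ atTop fun t : ℕ => ‖z t‖⁻¹ • z t) :
    ∃ α : ℝ, 0 < α ∧
      IsKKTPoint (fun w => (1 / 2 : ℝ) * ‖w‖ ^ 2) (fun n w => 1 - q n w) (α • θ) := by
  refine exists_isKKTPoint_smul_of_mapClusterPt h.setup.card_pos h.setup.L_pos h.setup.hom
    (fun n x hx => ((h.setup.contDiffOn n).contDiffAt_of_ne_zero hx).lipschitzNear)
    (Real.exp_pos Γ₀) (fun ε hε => ?_) hθ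
  obtain ⟨C, hC0, hC⟩ := h.exists_norm_normalize_sub_le
  obtain ⟨T₁, hT₁, h₁⟩ := h.exists_forall_le_neg_log_expSum ε⁻¹
  obtain ⟨T₂, hT₂, h₂⟩ := h.exists_time_of_late (by positivity : 0 < ε ^ 2 / 2)
    (by positivity : 0 < ε / (C + 1))
  filter_upwards [eventually_ge_atTop T₁, eventually_ge_atTop T₂] with t ht1 ht2
  obtain ⟨s, hts, hΔ, hrad⟩ := h₂ t ht2
  have hss := (hT₂.trans ht2).trans hts
  have hw := h.isDescentPoint hss
  refine ⟨z s, _, h.ne_zero hss, h.setup.isNegLossGradient (h.ne_zero hss), fun n => ?_,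
    fun n => ?_, ?_, ?_⟩
  · have h3 := h.setup.exp_mul_norm_rpow_le hw
    rw [one_div, Real.log_inv] at h3
    exact h3.trans (neg_log_expSum_le h.setup.card_pos _ n)
  · exact (h₁ s (ht1.trans hts)).trans (neg_log_expSum_le h.setup.card_pos _ n)
  · refine (hC t s (hT₂.trans ht2) hts).trans ((mul_le_mul_of_nonneg_left hΔ hC0).trans ?_)
    rw [mul_div_assoc', div_le_iff₀ (by positivity)]
    nlinarith
  · have h3 := norm_normalize_sub_sq_le (by positivity) (h.setup.inner_pos hw) hrad
    rw [mul_div_cancel₀ _ two_ne_zero] at h3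
    exact (pow_le_pow_iff_left₀ (norm_nonneg _) hε.le two_ne_zero).mp h3

end IsDescentSequence

end GradientDescentLimit

/-! ### Translation from the training problem. -/

section Margin

variable {d dx N : ℕ} {Φ : EuclideanSpace ℝ (Fin d) → EuclideanSpace ℝ (Fin dx) → ℝ}
  {x : Fin N → EuclideanSpace ℝ (Fin dx)} {y : Fin N → ℝ} {L : ℝ}

theorem IsHomogeneousModel.margin (hΦ : IsHomogeneousModel L Φ) (n : Fin N)
    (θ : EuclideanSpace ℝ (Fin d)) (α : ℝ) (hα : 0 < α) :
    margin Φ x y n (α • θ) = α ^ L * margin Φ x y n θ := by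
  rw [_root_.margin, _root_.margin, hΦ _ _ _ hα]
  ring

theorem LearningRateCondition.isDescentSequence (hN : 0 < N) (hL : 0 < L)
    (hΦ : IsHomogeneousModel L Φ) (hC : ∀ x', ContDiffOn ℝ 2 (fun θ => Φ θ x') {0}ᶜ)
    {η : ℕ → ℝ} {θ : ℕ → EuclideanSpace ℝ (Fin d)} {t₀ : ℕ}
    (hθ : IsGradientDescent (trainLoss Φ x y) η θ) (hlt : trainLoss Φ x y (θ t₀) < 1)
    (hη : LearningRateCondition L Φ x y η θ t₀) :
    IsDescentSequence (margin Φ x y) L (trainLoss Φ x y (θ t₀)) ‖θ t₀‖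
      (lrPhi L (trainLoss Φ x y (θ t₀)) (trainLoss Φ x y (θ t₀)) - L * logNorm (θ t₀)) η θ t₀ := by
  have hθ0 : θ t₀ ≠ 0 := ne_zero_of_expSum_lt_one (q := margin Φ x y) hN hL hΦ.margin hlt
  have hr : 0 < ‖θ t₀‖ := norm_pos_iff.mpr hθ0
  have hS : DescentSetup (margin Φ x y) L (trainLoss Φ x y (θ t₀)) ‖θ t₀‖ :=
    { card_pos := hN
      L_pos := hL
      hom := hΦ.margin
      contDiffOn := fun n => contDiffOn_const.mul (hC (x n))
      loss_pos := expSum_pos (q := margin Φ x y) hN _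
      loss_lt := hlt
      norm_pos := hr }
  set Γ₀ := lrPhi L (trainLoss Φ x y (θ t₀)) (trainLoss Φ x y (θ t₀)) - L * logNorm (θ t₀) with hΓ
  -- `Γ₀` is the logarithm of `γ̂(θ₀)`, so the two constants agree.
  have hconst : lrConst L (trainLoss Φ x y (θ t₀)) (margin Φ x y) (θ t₀) =
      descentConst (margin Φ x y) L ‖θ t₀‖ Γ₀ := by
    have h1 : Real.exp (L * logNorm (θ t₀)) = ‖θ t₀‖ ^ L := by
      rw [logNorm_eq, Real.rpow_def_of_pos hr, mul_comm]
    rw [lrConst, descentConst, lrGammaHat, hΓ, Real.exp_sub, h1]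
  refine ⟨hS, fun t => ?_, hη.1, hη.2.1, fun t ht hle => ?_, ⟨le_rfl, le_rfl, ?_⟩⟩
  · rw [hθ t, smul_neg, ← sub_eq_add_neg]
    rfl
  · have h1 := hη.2.2 t ht
    rw [hconst] at h1
    have hu0 : 0 < expSum (margin Φ x y) (θ t) := expSum_pos hN _
    have hκ := (lrKappa_pos (L := L) hu0 (hle.trans_lt hlt)).le
    -- If `C_η κ` vanishes, the quotient in the condition is a division by zero, but the product
    -- form holds trivially.
    rcases (mul_nonneg (hS.descentConst_nonneg (Γ₀ := Γ₀)) hκ).eq_or_lt with h2 | h2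
    · rw [← h2, mul_zero]
      exact (lrMu_pos hS.loss_pos hlt hu0 hle).le
    · exact (le_div_iff₀ h2).mp h1
  · rw [hΓ, sub_add_cancel]
    exact le_rfl

theorem margin_eq_or_eq_neg (hy : ∀ n, y n = 1 ∨ y n = -1) (n : Fin N) :
    margin Φ x y n = (fun θ => Φ θ (x n)) ∨ margin Φ x y n = fun θ => -Φ θ (x n) := by
  rcases hy n with h | h
  · left; funext θ; rw [margin, h, one_mul]
  · right; funext θ; rw [margin, h, neg_one_mul]

end Margin

theorem theorem4p4 {d dx N : ℕ} (hN : 0 < N)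
    (Φ : EuclideanSpace ℝ (Fin d) → EuclideanSpace ℝ (Fin dx) → ℝ)
    (x : Fin N → EuclideanSpace ℝ (Fin dx)) (y : Fin N → ℝ) (hy : ∀ n, y n = 1 ∨ y n = -1)
    (L : ℝ) (hL : 0 < L) (hΦ : IsHomogeneousModel L Φ) :
    -- gradient flow on locally Lipschitz models that admit a chain rule
    ((∀ x', LocallyLipschitz (fun θ => Φ θ x') ∧ AdmitsChainRule (fun θ => Φ θ x')) →
      ∀ θ : ℝ → EuclideanSpace ℝ (Fin d), IsGradientFlow (trainLoss Φ x y) θ →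
        (∃ t₀ : ℝ, 0 ≤ t₀ ∧ trainLoss Φ x y (θ t₀) < 1) →
        ∀ θbar, MapClusterPt θbar atTop (fun t : ℝ => ‖θ t‖⁻¹ • θ t) →
          IsAlongKKTDirection Φ x y θbar) ∧
    -- gradient descent on models that are twice continuously differentiable away from the origin
    ((∀ x', ContDiffOn ℝ 2 (fun θ => Φ θ x') {0}ᶜ) →
      ∀ (η : ℕ → ℝ) (θ : ℕ → EuclideanSpace ℝ (Fin d)),
        IsGradientDescent (trainLoss Φ x y) η θ →
        (∃ t₀ : ℕ, trainLoss Φ x y (θ t₀) < 1 ∧ LearningRateCondition L Φ x y η θ t₀) →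
        ∀ θbar, MapClusterPt θbar atTop (fun t : ℕ => ‖θ t‖⁻¹ • θ t) →
          IsAlongKKTDirection Φ x y θbar) := by
  refine ⟨fun hq z hz ⟨t₀, ht₀, hlt⟩ θ hθ => ?_, fun hC η z hz ⟨t₀, hlt, hη⟩ θ hθ =>
    (hη.isDescentSequence hN hL hΦ hC hz hlt).exists_isKKTPoint_smul hθ⟩
  refine exists_isKKTPoint_smul_of_gradientFlow hN hL hΦ.margin (fun n => ?_) (fun n => ?_) hz ht₀
    hlt hθ
  · rcases margin_eq_or_eq_neg (Φ := Φ) (x := x) hy n with h | h <;> rw [h]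
    · exact (hq (x n)).1
    · exact (hq (x n)).1.neg
  · rcases margin_eq_or_eq_neg (Φ := Φ) (x := x) hy n with h | h <;> rw [h]
    · exact (hq (x n)).2
    · exact (hq (x n)).2.neg
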